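/- **Coupled matrix NLS with complex time and mKdV.** Let $\Omega\subset\mathbb C$ be either (i) a set without accumulation points in $\mathbb C$, with $\mu$ the counting measure, or (ii) a finite union of pairwise disjoint, oriented, locally rectifiable simple contours, each of which is closed or extends to infinity in both directions, with $d\mu=dz$. In case (i) put $|\mu|=\mu$, and in case (ii) let $|\mu|=|dz|$ be arc length. Let $L^2(\Omega)=L^2(\Omega,|\mu|)$ and $L^\infty(\Omega)=L^\infty(\Omega,|\mu|)$. Let $m\ge 1$, and for parameters $w=(x,y,t)$ with $x,y,t\in\mathbb R^m$ put $$\Delta(z|w)=\mathrm{diag}(\mathsf m_1(z),\dots,\mathsf m_m(z),1),\qquad \mathsf m_j(z)=\exp(t_jz^3+y_jz^2+x_jz).$$ Let $F,G:\Omega\to\mathbb C^{m+1}$ be vector functions that do not depend on $w$ and satisfy $F_i(u)G_i(u)=0$ for all $u\in\Omega$ and $1\le i\le m+1$. Let $U\subset\mathbb R^{3m}$ be open, and for $w\in U$ let $c(\cdot|w)$ be a measurable non-vanishing scalar function on $\Omega$. Put $$f(u|w)=c(u|w)\,\Delta(u|w)F(u),\qquad g(u|w)=c(u|w)^{-1}\Delta(u|w)^{-1}G(u).$$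 Suppose that for every $w\in U$ the components of $f(\cdot|w)$ and $g(\cdot|w)$ lie in $L^2(\Omega)\cap L^\infty(\Omega)$, and that $H=H(w)$ is a bounded integral operator on $L^2(\Omega)$ with kernel $$H(u,v)=\frac{f(u|w)^Tg(v|w)}{u-v}\ (u\ne v),\qquad H(u,u)=0,$$ with respect to $\mu$ (the integral being understood as the limit of the integrals over $|u-v|>\varepsilon$ as $\varepsilon\downarrow0$, which is the ordinary integral or sum whenever that converges absolutely). That is, $H$ is a cubic integrable operator for the parameters in $U$. The scalar $c$ may depend on the parameters, in the following locally regular way: for every $w_0\in U$ and all $w$ sufficiently close to $w_0$, the components of $c(\cdot|w_0)\Delta(\cdot|w)F$ and of $c(\cdot|w_0)^{-1}\Delta(\cdot|w)^{-1}G$ lie in $L^2(\Omega)$, and $c(\cdot|w)/c(\cdot|w_0)$ is bounded on bounded subsets of $\Omega$. (This condition holds automatically if $c$ does not depend on $w$.) Assume that $I-H(w)$ is invertible for every $w\in U$, and define the $(m+1)\times(m+1)$ matrix $$Y_1(w)=\int_\Omega \big((I-H)^{-1}f\big)(s)\,g(s)^T\,d\mu(s).$$ Let $S\subset\{1,\dots,m\}$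 be non-empty, let $k_1<\dots<k_{|S|}$ be the elements of $S$ and $k_{|S|+1}<\dots<k_m$ those of $\{1,\dots,m\}\setminus S$, put $\pi(i)=k_i$ for $i\le m$, $\pi(m+1)=m+1$, and $P=(\delta_{\pi(i),j})_{i,j=1}^{m+1}$. Write $$P\,Y_1\,P^T=\begin{pmatrix} q&p\\ r&s\end{pmatrix}$$ with $q$ of size $|S|\times|S|$, and let $\partial_x=\sum_{k\in S}\partial_{x_k}$, $\partial_y=\sum_{k\in S}\partial_{y_k}$, $\partial_t=\sum_{k\in S}\partial_{t_k}$. Then the entries of $p$ and $r$ are three times continuously differentiable on $U$, and on $U$: (a) $p$ and $r$ satisfy the coupled matrix nonlinear Schrödinger system with complex time $$\partial_y p=\partial_x^2p+2prp,\qquad \partial_y r=-\partial_x^2 r-2rpr;$$ (b) $p$ and $r$ satisfy the coupled matrix modified Korteweg–de Vries system $$\partial_t p=\partial_x^3p+3(\partial_xp)rp+3pr(\partial_xp),\qquad \partial_t r=\partial_x^3r+3(\partial_xr)pr+3rp(\partial_xr).$$ -/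

import Mathlib

open MeasureTheory Filter Topology

/-- A locally rectifiable, oriented, simple contour without finite endpoints, parametrized by arc
length: it is either closed (of some length `L`, one period being `[0, L)`) or it extends to
infinity in both directions. -/
structure Contour where
  path : ℝ → ℂ
  dom : Set ℝ
  lipschitz : LipschitzWith 1 path
  unit_speed : ∀ᵐ s : ℝ, ‖deriv path s‖ = 1
  simple : Set.InjOn path dom
  closed_or_unbounded :
    (∃ L : ℝ, 0 < L ∧ dom = Set.Ico 0 L ∧ Function.Periodic path L) ∨
      (dom = Set.univ ∧ Tendsto path (cocompact ℝ) (cocompact ℂ))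

namespace Contour

/-- The set of points of the contour. -/
def trace (γ : Contour) : Set ℂ := γ.path '' γ.dom

/-- Arc length on the contour, as a measure on `ℂ`. -/
noncomputable def arcLength (γ : Contour) : Measure ℂ :=
  (volume.restrict γ.dom).map γ.path

/-- The unit tangent at a point of the contour (zero off the contour), so that
`dz = tangent(z) |dz|` along the contour. -/
noncomputable def tangent (γ : Contour) : ℂ → ℂ :=
  γ.trace.indicator fun z => deriv γ.path (Function.invFunOn γ.path γ.dom z)

end Contour

/-- The sets `Ω ⊂ ℂ` on which the operators live: either a subset of `ℂ` without accumulation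
points, or a finite union of pairwise disjoint simple contours. -/
inductive SpectralSet where
  | discrete (s : Set ℂ) (no_acc : ∀ z : ℂ, ¬ AccPt z (𝓟 s)) : SpectralSet
  | contours (n : ℕ) (γ : Fin n → Contour)
      (disjoint : Pairwise fun j k => Disjoint (γ j).trace (γ k).trace) : SpectralSet

namespace SpectralSet

/-- The underlying set of points. -/
def carrier : SpectralSet → Set ℂ
  | discrete s _ => s
  | contours _ γ _ => ⋃ j, (γ j).trace

/-- The positive measure `|μ|`: counting measure on a discrete set, arc length `|dz|` on contours. -/
noncomputable def absMeasure : SpectralSet → Measure ℂ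
  | discrete s _ => Measure.count.restrict s
  | contours _ γ _ => ∑ j, (γ j).arcLength

/-- The density of `μ` with respect to `|μ|`: it is `1` on a discrete set, and the unit tangent
on contours, where `dμ = dz`. -/
noncomputable def density : SpectralSet → ℂ → ℂ
  | discrete _ _ => fun _ => 1
  | contours _ γ _ => fun z => ∑ j, (γ j).tangent z

/-- The Hilbert space `ℓ²(Ω)`, respectively `L²(Ω, dz)`. -/
abbrev L2 (Ω : SpectralSet) : Type := Lp ℂ 2 Ω.absMeasure

/-- The integral `∫_A φ dμ`. -/
noncomputable def integralOn (Ω : SpectralSet) (A : Set ℂ) (φ : ℂ → ℂ) : ℂ :=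
  ∫ z in A, φ z * Ω.density z ∂Ω.absMeasure

/-- The element of `L²` given by a square integrable function (zero for other functions). -/
noncomputable def toL2 (Ω : SpectralSet) (φ : ℂ → ℂ) : Ω.L2 :=
  open scoped Classical in
  if h : MemLp φ 2 Ω.absMeasure then h.toLp φ else 0

/-- `H` is the integral operator `(H φ)(u) = ∫ K(u, v) φ(v) dμ(v)`. The integral is the limit of the
integrals over `|u - v| > ε`; this is the ordinary integral (or sum) if `K(u, u) = 0` and the
integral converges absolutely. -/
def IsIntegralOperator (Ω : SpectralSet) (K : ℂ → ℂ → ℂ) (H : Ω.L2 →L[ℂ] Ω.L2) : Prop :=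
  ∀ φ : Ω.L2, ∀ᵐ u ∂Ω.absMeasure,
    (∀ ε : ℝ, 0 < ε → IntegrableOn (fun v => K u v * φ v) {v | ε < ‖u - v‖} Ω.absMeasure) ∧
    Tendsto (fun ε : ℝ => Ω.integralOn {v | ε < ‖u - v‖} fun v => K u v * φ v)
      (𝓝[>] 0) (𝓝 (H φ u))

end SpectralSet

namespace CubicIntegrable

/-- The real parameters `(x, y, t)`, each with `m` components. -/
abbrev Params (m : ℕ) : Type := (Fin m → ℝ) × (Fin m → ℝ) × (Fin m → ℝ)

/-- The cubic exponential function `exp (t_j z ^ 3 + y_j z ^ 2 + x_j z)`. -/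
noncomputable def cubicExp {m : ℕ} (w : Params m) (j : Fin m) (z : ℂ) : ℂ :=
  Complex.exp ((w.2.2 j : ℂ) * z ^ 3 + (w.2.1 j : ℂ) * z ^ 2 + (w.1 j : ℂ) * z)

/-- The diagonal matrix with the `m` cubic exponentials and a final `1` on its diagonal. -/
noncomputable def Delta {m : ℕ} (w : Params m) (z : ℂ) : Matrix (Fin (m + 1)) (Fin (m + 1)) ℂ :=
  Matrix.diagonal (Fin.snoc (α := fun _ => ℂ) (fun j => cubicExp w j z) 1)

/-- `c(u) Δ(u) F(u)`, for a scalar function `c`. -/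
noncomputable def fVec {m : ℕ} (F : ℂ → Fin (m + 1) → ℂ) (c : ℂ → ℂ) (w : Params m) (u : ℂ) :
    Fin (m + 1) → ℂ :=
  c u • Matrix.mulVec (Delta w u) (F u)

/-- `c(u)⁻¹ Δ(u)⁻¹ G(u)`, for a scalar function `c`. -/
noncomputable def gVec {m : ℕ} (G : ℂ → Fin (m + 1) → ℂ) (c : ℂ → ℂ) (w : Params m) (u : ℂ) :
    Fin (m + 1) → ℂ :=
  (c u)⁻¹ • Matrix.mulVec (Delta w u)⁻¹ (G u)

/-- The integrable kernel `f(u)ᵀ g(v) / (u - v)`, set to zero on the diagonal. -/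
noncomputable def integrableKernel {m : ℕ} (f g : ℂ → Fin (m + 1) → ℂ) (u v : ℂ) : ℂ :=
  open scoped Classical in
  if u = v then 0 else (f u ⬝ᵥ g v) / (u - v)

/-- The bounded operator `H` on `L²(Ω, μ)` is, at the parameters `w`, the cubic integrable operator
with vector functions `F`, `G` and scalar function `c`. -/
structure IsCubicIntegrable {m : ℕ} (Ω : SpectralSet) (F G : ℂ → Fin (m + 1) → ℂ) (c : ℂ → ℂ)
    (w : Params m) (H : Ω.L2 →L[ℂ] Ω.L2) : Prop where
  orthogonal : ∀ u ∈ Ω.carrier, ∀ i : Fin (m + 1),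
    F u ⬝ᵥ Matrix.mulVec (Matrix.single i i (1 : ℂ)) (G u) = 0
  scalar_ne_zero : ∀ u ∈ Ω.carrier, c u ≠ 0
  scalar_measurable : AEStronglyMeasurable c Ω.absMeasure
  f_memLp_two : ∀ i, MemLp (fun u => fVec F c w u i) 2 Ω.absMeasure
  f_memLp_top : ∀ i, MemLp (fun u => fVec F c w u i) ⊤ Ω.absMeasure
  g_memLp_two : ∀ i, MemLp (fun u => gVec G c w u i) 2 Ω.absMeasure
  g_memLp_top : ∀ i, MemLp (fun u => gVec G c w u i) ⊤ Ω.absMeasure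
  kernel : Ω.IsIntegralOperator (integrableKernel (fVec F c w) (gVec G c w)) H

/-- The regularity of the dependence of the scalar `c` on the parameters, near `w₀`: for all `w`
close to `w₀`, the vectors at `w` remain square integrable if `c` is frozen at `w₀`, and the
quotient `c w / c w₀` is bounded on bounded parts of `Ω`. If `c` does not depend on the parameters,
this follows from cubic integrability near `w₀`. -/
def TameScalarAt {m : ℕ} (Ω : SpectralSet) (F G : ℂ → Fin (m + 1) → ℂ) (c : Params m → ℂ → ℂ)
    (w₀ : Params m) : Prop :=
  ∀ᶠ w in 𝓝 w₀,
    (∀ i, MemLp (fun u => fVec F (c w₀) w u i) 2 Ω.absMeasure) ∧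
    (∀ i, MemLp (fun u => gVec G (c w₀) w u i) 2 Ω.absMeasure) ∧
    ∀ ρ : ℝ, ∃ C : ℝ, ∀ u ∈ Ω.carrier, ‖u‖ ≤ ρ → ‖c w u‖ ≤ C * ‖c w₀ u‖

/-- The matrix `Y₁ = ∫_Ω ((1 - H)⁻¹ f)(s) g(s)ᵀ dμ(s)`. -/
noncomputable def Y1 {m : ℕ} (Ω : SpectralSet) (F G : ℂ → Fin (m + 1) → ℂ) (c : ℂ → ℂ)
    (w : Params m) (H : Ω.L2 →L[ℂ] Ω.L2) : Matrix (Fin (m + 1)) (Fin (m + 1)) ℂ :=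
  Matrix.of fun i j => Ω.integralOn Set.univ fun s =>
    (Ring.inverse (1 - H) (Ω.toL2 fun u => fVec F c w u i) : Ω.L2) s * gVec G c w s j

/-- `S ⊂ {1, …, m}` as a subset of `{1, …, m + 1}`. -/
def liftSet {m : ℕ} (S : Finset (Fin m)) : Finset (Fin (m + 1)) := S.map Fin.castSuccEmb

theorem card_liftSet {m : ℕ} (S : Finset (Fin m)) : (liftSet S).card = S.card :=
  Finset.card_map _

theorem card_compl_liftSet {m : ℕ} (S : Finset (Fin m)) :
    (liftSet S)ᶜ.card = m + 1 - S.card := by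
  rw [Finset.card_compl, card_liftSet, Fintype.card_fin]

/-- The permutation `π`. The indices `1, …, m + 1` of its domain are written as the first `|S|`
followed by the last `m + 1 - |S|` ones; the former are sent increasingly onto `S`, the latter
increasingly onto the complement of `S` in `{1, …, m + 1}`, so the last one goes to `m + 1`. -/
def perm {m : ℕ} (S : Finset (Fin m)) : Fin S.card ⊕ Fin (m + 1 - S.card) ≃ Fin (m + 1) :=
  finSumEquivOfFinset (card_liftSet S) (card_compl_liftSet S)

/-- The permutation matrix `(δ_{π(i), j})`. -/
def permMatrix {m : ℕ} (S : Finset (Fin m)) :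
    Matrix (Fin S.card ⊕ Fin (m + 1 - S.card)) (Fin (m + 1)) ℂ :=
  Matrix.of fun i j => if perm S i = j then 1 else 0

/-- The upper right block of `P Y Pᵀ`. -/
noncomputable def pBlock {m : ℕ} (S : Finset (Fin m)) (Y : Matrix (Fin (m + 1)) (Fin (m + 1)) ℂ) :
    Matrix (Fin S.card) (Fin (m + 1 - S.card)) ℂ :=
  (permMatrix S * Y * (permMatrix S).transpose).toBlocks₁₂

/-- The lower left block of `P Y Pᵀ`. -/
noncomputable def rBlock {m : ℕ} (S : Finset (Fin m)) (Y : Matrix (Fin (m + 1)) (Fin (m + 1)) ℂ) :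
    Matrix (Fin (m + 1 - S.card)) (Fin S.card) ℂ :=
  (permMatrix S * Y * (permMatrix S).transpose).toBlocks₂₁

section Derivatives

variable {m : ℕ} {a b : Type}

/-- `∂_x = ∑_{k ∈ S} ∂/∂x_k`, applied entrywise to a matrix valued function. -/
noncomputable def Dx (S : Finset (Fin m)) (A : Params m → Matrix a b ℂ) :
    Params m → Matrix a b ℂ := fun w =>
  Matrix.of fun i j => ∑ k ∈ S, lineDeriv ℝ (fun w' => A w' i j) w (Pi.single k 1, 0, 0)

/-- `∂_y = ∑_{k ∈ S} ∂/∂y_k`, applied entrywise to a matrix valued function. -/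
noncomputable def Dy (S : Finset (Fin m)) (A : Params m → Matrix a b ℂ) :
    Params m → Matrix a b ℂ := fun w =>
  Matrix.of fun i j => ∑ k ∈ S, lineDeriv ℝ (fun w' => A w' i j) w (0, Pi.single k 1, 0)

/-- `∂_t = ∑_{k ∈ S} ∂/∂t_k`, applied entrywise to a matrix valued function. -/
noncomputable def Dt (S : Finset (Fin m)) (A : Params m → Matrix a b ℂ) :
    Params m → Matrix a b ℂ := fun w =>
  Matrix.of fun i j => ∑ k ∈ S, lineDeriv ℝ (fun w' => A w' i j) w (0, 0, Pi.single k 1)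

end Derivatives

end CubicIntegrable

/-! The proof studies the moments `∫ ((I - H)⁻¹ z^a f_i) z^b g_j dμ`, of which `Y₁` is the case `a =
b = 0`. Differentiating in the coordinate `x_k`, `y_k` or `t_k` (`n = 0, 1, 2`) multiplies `f_k` by
`z^(n+1)` and `g_k` by `-z^(n+1)`. It turns the kernel of `H` into `f_k(u) g_k(v) (u^(n+1) -
v^(n+1)) / (u - v)`, a finite sum of rank-one kernels. Hence the derivative of a moment is a
quadratic polynomial in moments, and moments are smooth. The commutator of multiplication by `z`
with `H` has kernel `f(u)ᵀ g(v)`, so moving a factor `z` from `g` to `f` costs a sum of products of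
moments. For the blocks cut out by `S` this gives `∂_x Q_{kl} = -P_k R_l`, and both systems become
identities between noncommutative polynomials (`IsCubicFlow.flow_equations`).

The analytic work is to justify this for unbounded `Ω`. Square integrability at the corners of a
small cube around `w₀` gives square integrability against an exponential weight, which absorbs all
powers of `z` after a small loss (`exists_pow_mul_expWeight_le`). Taylor expansions with quadratic
remainder follow in `L²` and in operator norm (`exists_norm_expFamily_remainder_le`,
`exists_expQuotOperator`). As `z` is unbounded, the commutator is a limit of commutators with
bounded Lipschitz functions (`moment_commute`). The condition `F_i G_i = 0` reconciles the value `0`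
of the kernel on the diagonal with the polynomial kernels that arise, which matters at atoms.

The scalar `c` is frozen at `w₀`. Changing it conjugates `H` by `ρ = c_w / c_{w₀}`, which formally
preserves the moments; since `ρ` is only locally bounded, cut-offs are needed
(`moment_gauge_invariant`). `exists_isCubicFlow` assembles these facts near each `w₀`. -/

namespace CubicIntegrable

/-! ### Cubic flows and the derivatives of their moments. -/

/-- The `n`-th real coordinate (`x`, `y` or `t`) with index `i` of the parameters; it is zero for
the last index. -/
noncomputable def coord {m : ℕ} (n : Fin 3) (i : Fin (m + 1)) : Params m →L[ℝ] ℝ :=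
  Fin.snoc (α := fun _ => Params m →L[ℝ] ℝ)
    (fun k => (ContinuousLinearMap.proj k).comp
      (![ContinuousLinearMap.fst ℝ _ _,
        (ContinuousLinearMap.fst ℝ _ _).comp (ContinuousLinearMap.snd ℝ _ _),
        (ContinuousLinearMap.snd ℝ _ _).comp (ContinuousLinearMap.snd ℝ _ _)] n)) 0 i

section Coord

variable {m : ℕ}

@[simp] theorem coord_last (n : Fin 3) : coord (m := m) n (Fin.last m) = 0 := by
  simp [coord]

@[simp] theorem coord_zero_castSucc (k : Fin m) (w : Params m) :
    coord 0 k.castSucc w = w.1 k := by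
  simp [coord]

@[simp] theorem coord_one_castSucc (k : Fin m) (w : Params m) :
    coord 1 k.castSucc w = w.2.1 k := by
  simp [coord]

@[simp] theorem coord_two_castSucc (k : Fin m) (w : Params m) :
    coord 2 k.castSucc w = w.2.2 k := by
  simp [coord]

theorem norm_coord_le (n : Fin 3) (i : Fin (m + 1)) (w : Params m) : ‖coord n i w‖ ≤ ‖w‖ := by
  induction i using Fin.lastCases with
  | last => simp
  | cast k =>
    fin_cases n
    · simpa using (norm_le_pi_norm w.1 k).trans (norm_fst_le w)
    · simpa using (norm_le_pi_norm w.2.1 k).trans ((norm_fst_le w.2).trans (norm_snd_le w))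
    · simpa using (norm_le_pi_norm w.2.2 k).trans ((norm_snd_le w.2).trans (norm_snd_le w))

end Coord

/-- Vectors `f a i`, functionals `g b j` and operators `A` on a Banach space which depend on the
parameters in the way the moments `z ^ a f_i`, `z ^ b g_j` and the operator of a cubic integrable
operator do. -/
structure IsCubicFlow {m : ℕ} {E : Type*} [NormedAddCommGroup E] [NormedSpace ℂ E]
    (W : Set (Params m)) (f : ℕ → Fin (m + 1) → Params m → E)
    (g : ℕ → Fin (m + 1) → Params m → (E →L[ℂ] ℂ)) (A : Params m → (E →L[ℂ] E)) : Prop where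
  isOpen : IsOpen W
  isUnit : ∀ w ∈ W, IsUnit (1 - A w)
  hasFDerivAt_f : ∀ a i, ∀ w ∈ W,
    HasFDerivAt (f a i) (∑ n : Fin 3, (coord n i).smulRight (f (a + n + 1) i w)) w
  hasFDerivAt_g : ∀ b j, ∀ w ∈ W,
    HasFDerivAt (g b j) (-∑ n : Fin 3, (coord n j).smulRight (g (b + n + 1) j w)) w
  hasFDerivAt_A : ∀ w ∈ W,
    HasFDerivAt A (∑ n : Fin 3, ∑ k, (coord n k).smulRight
      (∑ x ∈ Finset.HasAntidiagonal.antidiagonal (n : ℕ), (g x.2 k w).smulRight (f x.1 k w))) w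
  -- Only the first `m` indices occur as `i` and `j`: for the last one, `z f` and `z g` need not lie
  -- in `L²`.
  commute : ∀ w ∈ W, ∀ a b (i j : Fin m),
    g (b + 1) j.castSucc w (Ring.inverse (1 - A w) (f a i.castSucc w)) =
      g b j.castSucc w (Ring.inverse (1 - A w) (f (a + 1) i.castSucc w)) +
        ∑ l, g b j.castSucc w (Ring.inverse (1 - A w) (f 0 l w)) *
          g 0 l w (Ring.inverse (1 - A w) (f a i.castSucc w))

/-- The moments `∫ ((1 - A)⁻¹ z ^ a f_i) z ^ b g_j`. -/
noncomputable def moment {m : ℕ} {E : Type*} [NormedAddCommGroup E] [NormedSpace ℂ E]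
    (f : ℕ → Fin (m + 1) → Params m → E)
    (g : ℕ → Fin (m + 1) → Params m → (E →L[ℂ] ℂ)) (A : Params m → (E →L[ℂ] E))
    (a b : ℕ) (i j : Fin (m + 1)) (w : Params m) : ℂ :=
  g b j w (Ring.inverse (1 - A w) (f a i w))

/-- The parameters are real while the operators are complex linear, so the product rule is applied
after restricting scalars. Describing the derivative by its values keeps that coercion out of later
statements. -/
theorem hasFDerivAt_clm_apply {P E F : Type*} [NormedAddCommGroup P] [NormedSpace ℝ P]
    [NormedAddCommGroup E] [NormedSpace ℂ E] [NormedAddCommGroup F] [NormedSpace ℂ F]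
    {T : P → (E →L[ℂ] F)} {v : P → E} {T' : P →L[ℝ] (E →L[ℂ] F)} {v' : P →L[ℝ] E} {w : P}
    (hT : HasFDerivAt T T' w) (hv : HasFDerivAt v v' w) :
    ∃ L : P →L[ℝ] F, HasFDerivAt (fun w => T w (v w)) L w ∧
      ∀ h, L h = T' h (v w) + T w (v' h) := by
  have h1 := ((ContinuousLinearMap.restrictScalarsL ℂ E F ℝ ℝ).hasFDerivAt
    (x := T w)).comp w hT
  refine ⟨_, h1.clm_apply hv, fun h => ?_⟩
  simp [add_comm]

section Moment

variable {m : ℕ} {E : Type*} [NormedAddCommGroup E] [NormedSpace ℂ E] [CompleteSpace E]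
  {W : Set (Params m)} {f : ℕ → Fin (m + 1) → Params m → E}
  {g : ℕ → Fin (m + 1) → Params m → (E →L[ℂ] ℂ)} {A : Params m → (E →L[ℂ] E)}

/-- The resolvent has derivative `(1 - A)⁻¹ dA (1 - A)⁻¹`, and `dA` is a sum of rank-one operators,
each of which splits the moment into a product of two moments. -/
theorem IsCubicFlow.hasFDerivAt_moment (h : IsCubicFlow W f g A) (a b : ℕ) (i j : Fin (m + 1))
    {w : Params m} (hw : w ∈ W) :
    HasFDerivAt (moment f g A a b i j) (∑ n : Fin 3,
      ((coord n i).smulRight (moment f g A (a + n + 1) b i j w)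
        - (coord n j).smulRight (moment f g A a (b + n + 1) i j w)
        + ∑ k, (coord n k).smulRight (∑ x ∈ Finset.HasAntidiagonal.antidiagonal (n : ℕ),
            moment f g A x.1 b k j w * moment f g A a x.2 i k w))) w := by
  obtain ⟨v, hv⟩ := h.isUnit w hw
  have h1 : HasFDerivAt (fun w => 1 - A w) _ w := (h.hasFDerivAt_A w hw).const_sub 1
  have h3 : HasFDerivAt (Ring.inverse : (E →L[ℂ] E) → (E →L[ℂ] E))
      (-ContinuousLinearMap.mulLeftRight ℝ (E →L[ℂ] E) ↑v⁻¹ ↑v⁻¹) (1 - A w) := by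
    rw [← hv]
    exact hasFDerivAt_ringInverse v
  have h2 := h3.comp w h1
  obtain ⟨L, hL, hL'⟩ := hasFDerivAt_clm_apply (T := fun w => Ring.inverse (1 - A w)) h2 (h.hasFDerivAt_f a i w hw)
  obtain ⟨L2, hL2, hL2'⟩ := hasFDerivAt_clm_apply (h.hasFDerivAt_g b j w hw) hL
  have hi : Ring.inverse (1 - A w) = ((v⁻¹ : (E →L[ℂ] E)ˣ) : E →L[ℂ] E) := by
    rw [← hv, Ring.inverse_unit]
  refine hL2.congr_fderiv (ContinuousLinearMap.ext fun d => ?_)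
  rw [hL2', hL']
  simp only [sum_apply, add_apply, sub_apply, neg_apply, ContinuousLinearMap.smulRight_apply,
    ContinuousLinearMap.comp_apply, ContinuousLinearMap.mulLeftRight_apply, mul_neg, neg_mul,
    neg_neg, map_sum, map_add, FunLike.coe_smul, Pi.smul_apply, Finset.mul_sum, Finset.sum_mul,
    Finset.sum_add_distrib, Finset.sum_sub_distrib, hi, mul_smul_comm, smul_mul_assoc,
    ← Complex.coe_smul, map_smul, moment, mul_apply_eq_comp, smul_eq_mul]
  simp only [fun (x : ℕ × ℕ) k => mul_comm (g x.2 k w ((↑v⁻¹ : E →L[ℂ] E) (f a i w)))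
    (g b j w ((↑v⁻¹ : E →L[ℂ] E) (f x.1 k w)))]
  ring_nf

/-- The derivative is again a polynomial in moments, so differentiability bootstraps. -/
theorem IsCubicFlow.contDiffOn_moment (h : IsCubicFlow W f g A) (n : ℕ) :
    ∀ (a b : ℕ) (i j : Fin (m + 1)), ContDiffOn ℝ n (moment f g A a b i j) W := by
  induction n with
  | zero =>
    intro a b i j
    refine contDiffOn_zero.2 fun w hw => ?_
    exact (h.hasFDerivAt_moment a b i j hw).continuousAt.continuousWithinAt
  | succ n ih =>
    intro a b i j
    rw [Nat.cast_succ]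
    refine (contDiffOn_succ_iff_fderiv_of_isOpen h.isOpen).2 ⟨fun w hw =>
      (h.hasFDerivAt_moment a b i j hw).differentiableAt.differentiableWithinAt, fun h => by simp at h, ?_⟩
    refine ContDiffOn.congr ?_ fun w hw => (h.hasFDerivAt_moment a b i j hw).fderiv
    refine ContDiffOn.sum fun n _ => ((contDiffOn_const.smulRight (ih _ _ _ _)).sub
      (contDiffOn_const.smulRight (ih _ _ _ _))).add ?_
    refine ContDiffOn.sum fun k _ => contDiffOn_const.smulRight ?_
    exact ContDiffOn.sum fun x _ => (ih _ _ _ _).mul (ih _ _ _ _)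

end Moment

/-! ### Derivatives of blocks and the algebra of the two systems. -/

/-- The derivative of the entries of `A` in the direction `v` is given by the entries of `A'`. -/
def HasEntryDeriv {m : ℕ} {a b : Type} (v : Params m) (A : Params m → Matrix a b ℂ)
    (A' : Matrix a b ℂ) (w : Params m) : Prop :=
  ∀ i j, ∃ L : Params m →L[ℝ] ℂ, HasFDerivAt (fun w => A w i j) L w ∧ L v = A' i j

namespace HasEntryDeriv

variable {m : ℕ} {a b d : Type} {v w : Params m} {A B : Params m → Matrix a b ℂ}
  {A' B' : Matrix a b ℂ}

theorem add (hA : HasEntryDeriv v A A' w) (hB : HasEntryDeriv v B B' w) :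
    HasEntryDeriv v (fun w => A w + B w) (A' + B') w := fun i j => by
  obtain ⟨L, hL, h1⟩ := hA i j
  obtain ⟨L2, hL2, h2⟩ := hB i j
  exact ⟨L + L2, hL.add hL2, by simp [h1, h2]⟩

theorem neg (hA : HasEntryDeriv v A A' w) :
    HasEntryDeriv v (fun w => -A w) (-A') w := fun i j => by
  obtain ⟨L, hL, h1⟩ := hA i j
  exact ⟨-L, hL.neg, by simp [h1]⟩

theorem mul [Fintype b] {C : Params m → Matrix b d ℂ} {C' : Matrix b d ℂ}
    (hA : HasEntryDeriv v A A' w) (hC : HasEntryDeriv v C C' w) :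
    HasEntryDeriv v (fun w => A w * C w) (A' * C w + A w * C') w := fun i j => by
  choose L hL h1 using hA i
  choose L2 hL2 h2 using fun k => hC k j
  refine ⟨∑ k, (A w i k • L2 k + C w k j • L k), ?_, ?_⟩
  · simp only [Matrix.mul_apply]
    exact HasFDerivAt.fun_sum fun k _ => (hL k).mul (hL2 k)
  · simp [Matrix.mul_apply, h1, h2, Finset.sum_add_distrib, add_comm, mul_comm]

end HasEntryDeriv

/-- The unit vectors in the space of parameters. -/
def unitVec {m : ℕ} (n : Fin 3) (k : Fin m) : Params m :=
  ![(Pi.single k 1, 0, 0), (0, Pi.single k 1, 0), (0, 0, Pi.single k 1)] n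

theorem coord_castSucc_unitVec {m : ℕ} (n n' : Fin 3) (k k' : Fin m) :
    coord n' k'.castSucc (unitVec n k) = if n = n' ∧ k = k' then 1 else 0 := by
  fin_cases n <;> fin_cases n' <;> simp [unitVec, Pi.single_apply, eq_comm]

/-- The direction of `∂_x`, `∂_y` or `∂_t`. -/
def flowDir {m : ℕ} (S : Finset (Fin m)) (n : Fin 3) : Params m := ∑ k ∈ S, unitVec n k

theorem coord_flowDir {m : ℕ} (S : Finset (Fin m)) (n n' : Fin 3) (i : Fin (m + 1)) :
    coord n' i (flowDir S n) = if n = n' ∧ i ∈ liftSet S then 1 else 0 := by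
  induction i using Fin.lastCases with
  | last => simp [liftSet]
  | cast k =>
    simp only [flowDir, map_sum, coord_castSucc_unitVec, liftSet]
    by_cases hn : n = n' <;> simp [hn]

theorem perm_inl_mem {m : ℕ} (S : Finset (Fin m)) (i : Fin S.card) :
    perm S (Sum.inl i) ∈ liftSet S := by
  simp [perm]

theorem perm_inr_notMem {m : ℕ} (S : Finset (Fin m)) (i : Fin (m + 1 - S.card)) :
    perm S (Sum.inr i) ∉ liftSet S := by
  rw [← Finset.mem_compl]
  simp [perm]

theorem HasEntryDeriv.sum_lineDeriv_eq {m : ℕ} {a b : Type} {S : Finset (Fin m)} {n : Fin 3}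
    {A : Params m → Matrix a b ℂ} {A' : Matrix a b ℂ} {w : Params m}
    (hA : HasEntryDeriv (flowDir S n) A A' w) :
    (Matrix.of fun i j => ∑ k ∈ S, lineDeriv ℝ (fun w' => A w' i j) w (unitVec n k)) = A' := by
  ext i j
  obtain ⟨L, hL, h⟩ := hA i j
  rw [← h, flowDir, map_sum]
  exact Finset.sum_congr rfl fun k _ => (hL.hasLineDerivAt _).lineDeriv

section Congr

variable {m : ℕ} {a b : Type} {S : Finset (Fin m)} {A B : Params m → Matrix a b ℂ}
  {A' : Matrix a b ℂ} {w : Params m}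

theorem HasEntryDeriv.Dx_eq (hA : HasEntryDeriv (flowDir S 0) A A' w) : Dx S A w = A' :=
  hA.sum_lineDeriv_eq

theorem HasEntryDeriv.Dy_eq (hA : HasEntryDeriv (flowDir S 1) A A' w) : Dy S A w = A' :=
  hA.sum_lineDeriv_eq

theorem HasEntryDeriv.Dt_eq (hA : HasEntryDeriv (flowDir S 2) A A' w) : Dt S A w = A' :=
  hA.sum_lineDeriv_eq

theorem HasEntryDeriv.congr {v : Params m} (hB : HasEntryDeriv v B A' w) (h : A =ᶠ[𝓝 w] B) :
    HasEntryDeriv v A A' w := fun i j => by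
  obtain ⟨L, hL, h1⟩ := hB i j
  exact ⟨L, hL.congr_of_eventuallyEq (h.mono fun w hw => by simp only [hw]), h1⟩

end Congr

/-- The matrix of the moments with row indices `e` and column indices `e'`. -/
noncomputable def momentBlock {m : ℕ} {E a b : Type*} [NormedAddCommGroup E] [NormedSpace ℂ E]
    (f : ℕ → Fin (m + 1) → Params m → E)
    (g : ℕ → Fin (m + 1) → Params m → (E →L[ℂ] ℂ)) (A : Params m → (E →L[ℂ] E))
    (e : a → Fin (m + 1)) (e' : b → Fin (m + 1)) (k l : ℕ) (w : Params m) : Matrix a b ℂ :=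
  Matrix.of fun i j => moment f g A k l (e i) (e' j) w

section Block

variable {m : ℕ} {E : Type*} [NormedAddCommGroup E] [NormedSpace ℂ E]
  {W : Set (Params m)} {f : ℕ → Fin (m + 1) → Params m → E}
  {g : ℕ → Fin (m + 1) → Params m → (E →L[ℂ] ℂ)} {A : Params m → (E →L[ℂ] E)}

/-- The numbers `s` and `s'` record whether the rows and columns lie in `S`. The direction `flowDir
S n` moves only indices in `S`, so the products of moments pass through `S`. -/
theorem IsCubicFlow.hasEntryDeriv_momentBlock [CompleteSpace E] (h : IsCubicFlow W f g A)
    (S : Finset (Fin m))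
    {a b : Type} (e : a → Fin (m + 1)) (e' : b → Fin (m + 1)) (s s' : ℂ)
    (hs : ∀ i, (if e i ∈ liftSet S then (1 : ℂ) else 0) = s)
    (hs' : ∀ j, (if e' j ∈ liftSet S then (1 : ℂ) else 0) = s')
    (n : Fin 3) (k l : ℕ) {w : Params m} (hw : w ∈ W) :
    HasEntryDeriv (flowDir S n) (momentBlock f g A e e' k l)
      (s • momentBlock f g A e e' (k + n + 1) l w - s' • momentBlock f g A e e' k (l + n + 1) w
        + ∑ x ∈ Finset.HasAntidiagonal.antidiagonal (n : ℕ),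
          momentBlock f g A e (perm S ∘ Sum.inl) k x.2 w *
            momentBlock f g A (perm S ∘ Sum.inl) e' x.1 l w) w := fun i j => by
  refine ⟨_, h.hasFDerivAt_moment k l (e i) (e' j) hw, ?_⟩
  have hc : ∀ (n' : Fin 3) (i : Fin (m + 1)) (z : ℂ), coord n' i (flowDir S n) • z =
      if n = n' then (if i ∈ liftSet S then (1 : ℂ) else 0) * z else 0 := by
    intro n' i z
    rw [coord_flowDir]
    by_cases h1 : n = n' <;> by_cases h2 : i ∈ liftSet S <;> simp [h1, h2]
  have hl : ∀ i, perm S (Sum.inl i) ∈ liftSet S := perm_inl_mem S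
  have hr : ∀ i, perm S (Sum.inr i) ∉ liftSet S := perm_inr_notMem S
  simp only [sum_apply, add_apply, sub_apply, ContinuousLinearMap.smulRight_apply, hc,
    Finset.sum_add_distrib, Finset.sum_sub_distrib, hs, hs', ← Equiv.sum_comp (perm S),
    Fintype.sum_sum_type, hl, hr, Finset.sum_ite_eq, Finset.mem_univ]
  simp [momentBlock, Matrix.sum_apply, Matrix.mul_apply, mul_comm]
  exact Finset.sum_comm

/-- The sum over `l` in `commute` splits into `S` and its complement. Rows and columns lie in `S`,
hence avoid the last index, as `commute` requires. -/
theorem IsCubicFlow.momentBlock_commute (h : IsCubicFlow W f g A) (S : Finset (Fin m)) (k l : ℕ)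
    {w : Params m} (hw : w ∈ W) :
    momentBlock f g A (perm S ∘ Sum.inl) (perm S ∘ Sum.inl) k (l + 1) w =
      momentBlock f g A (perm S ∘ Sum.inl) (perm S ∘ Sum.inl) (k + 1) l w +
      momentBlock f g A (perm S ∘ Sum.inl) (perm S ∘ Sum.inl) k 0 w *
        momentBlock f g A (perm S ∘ Sum.inl) (perm S ∘ Sum.inl) 0 l w +
      momentBlock f g A (perm S ∘ Sum.inl) (perm S ∘ Sum.inr) k 0 w *
        momentBlock f g A (perm S ∘ Sum.inr) (perm S ∘ Sum.inl) 0 l w := by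
  ext i j
  obtain ⟨i', -, hi⟩ := Finset.mem_map.1 (perm_inl_mem S i)
  obtain ⟨j', -, hj⟩ := Finset.mem_map.1 (perm_inl_mem S j)
  have := h.commute w hw k l i' j'
  rw [← Equiv.sum_comp (perm S), Fintype.sum_sum_type] at this
  simp only [Fin.castSuccEmb_apply] at hi hj
  simpa [momentBlock, moment, Matrix.mul_apply, ← hi, ← hj, add_assoc, mul_comm] using this

/-- The coupled nonlinear Schrödinger and modified Korteweg–de Vries systems for the off-diagonal
blocks of the matrix of moments. -/
theorem IsCubicFlow.flow_equations [CompleteSpace E] (h : IsCubicFlow W f g A)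
    (S : Finset (Fin m))
    {p : Params m → Matrix (Fin S.card) (Fin (m + 1 - S.card)) ℂ}
    {r : Params m → Matrix (Fin (m + 1 - S.card)) (Fin S.card) ℂ}
    (hp : p = momentBlock f g A (perm S ∘ Sum.inl) (perm S ∘ Sum.inr) 0 0)
    (hr : r = momentBlock f g A (perm S ∘ Sum.inr) (perm S ∘ Sum.inl) 0 0)
    {w : Params m} (hw : w ∈ W) :
    Dy S p w = Dx S (Dx S p) w + (2 : ℂ) • (p w * r w * p w) ∧
    Dy S r w = -Dx S (Dx S r) w - (2 : ℂ) • (r w * p w * r w) ∧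
    Dt S p w = Dx S (Dx S (Dx S p)) w
      + (3 : ℂ) • (Dx S p w * r w * p w) + (3 : ℂ) • (p w * r w * Dx S p w) ∧
    Dt S r w = Dx S (Dx S (Dx S r)) w
      + (3 : ℂ) • (Dx S r w * p w * r w) + (3 : ℂ) • (r w * p w * Dx S r w) := by
  -- `P k` carries `z^k` on the `f` side, `R l` carries `z^l` on the `g` side, `Q k l` carries both.
  -- Indices outside `S` never acquire a power of `z`.
  set P := fun k => momentBlock f g A (perm S ∘ Sum.inl) (perm S ∘ Sum.inr) k 0 with hP
  set R := fun l => momentBlock f g A (perm S ∘ Sum.inr) (perm S ∘ Sum.inl) 0 l with hR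
  set Q := fun k l => momentBlock f g A (perm S ∘ Sum.inl) (perm S ∘ Sum.inl) k l with hQ
  replace hp : p = P 0 := hp
  replace hr : r = R 0 := hr
  subst hp hr
  have hl : ∀ i, (if (perm S ∘ Sum.inl) i ∈ liftSet S then (1 : ℂ) else 0) = 1 := fun i =>
    if_pos (perm_inl_mem S i)
  have hr : ∀ i, (if (perm S ∘ Sum.inr) i ∈ liftSet S then (1 : ℂ) else 0) = 0 := fun i =>
    if_neg (perm_inr_notMem S i)
  have comm : ∀ k l, ∀ w ∈ W, Q k (l + 1) w = Q (k + 1) l w + Q k 0 w * Q 0 l w + P k w * R l w :=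
    fun k l w hw => h.momentBlock_commute S k l hw
  have dP : ∀ (n : Fin 3) k, ∀ w ∈ W, HasEntryDeriv (flowDir S n) (P k) (P (k + n + 1) w +
      ∑ x ∈ Finset.HasAntidiagonal.antidiagonal (n : ℕ), Q k x.2 w * P x.1 w) w := by
    intro n k w hw
    simpa using h.hasEntryDeriv_momentBlock S _ _ _ _ hl hr n k 0 hw
  have dR : ∀ (n : Fin 3) k, ∀ w ∈ W, HasEntryDeriv (flowDir S n) (R k) (-R (k + n + 1) w +
      ∑ x ∈ Finset.HasAntidiagonal.antidiagonal (n : ℕ), R x.2 w * Q x.1 k w) w := by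
    intro n k w hw
    simpa using h.hasEntryDeriv_momentBlock S _ _ _ _ hr hl n 0 k hw
  -- The commutation relation collapses `Q (k+1) l - Q k (l+1) + Q k 0 * Q 0 l` into a single
  -- product of off-diagonal blocks.
  have dQ : ∀ k l, ∀ w ∈ W, HasEntryDeriv (flowDir S 0) (Q k l) (-(P k w * R l w)) w := by
    intro k l w hw
    have h1 := h.hasEntryDeriv_momentBlock S _ _ _ _ hl hl 0 k l hw
    have h2 := comm k l w hw
    simp only [one_smul, Fin.val_zero, Nat.add_zero, Finset.Nat.antidiagonal_zero,
      Finset.sum_singleton] at h1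
    convert h1 using 1
    change _ = Q (k + 1) l w - Q k (l + 1) w + Q k 0 w * Q 0 l w
    rw [h2]
    abel
  have dP0 : ∀ k, ∀ w ∈ W, HasEntryDeriv (flowDir S 0) (P k) (P (k + 1) w + Q k 0 w * P 0 w) w :=
    fun k w hw => by simpa using dP 0 k w hw
  have dR0 : ∀ k, ∀ w ∈ W, HasEntryDeriv (flowDir S 0) (R k) (-R (k + 1) w + R 0 w * Q 0 k w) w :=
    fun k w hw => by simpa using dR 0 k w hw
  have hnhds : ∀ w ∈ W, W ∈ 𝓝 w := fun w hw => h.isOpen.mem_nhds hw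
  have P1 : ∀ w ∈ W, Dx S (P 0) w = P 1 w + Q 0 0 w * P 0 w := fun w hw => (dP0 0 w hw).Dx_eq
  have R1 : ∀ w ∈ W, Dx S (R 0) w = -R 1 w + R 0 w * Q 0 0 w := fun w hw => (dR0 0 w hw).Dx_eq
  have P2 : ∀ w ∈ W, Dx S (Dx S (P 0)) w = P 2 w + Q 1 0 w * P 0 w +
      (-(P 0 w * R 0 w) * P 0 w + Q 0 0 w * (P 1 w + Q 0 0 w * P 0 w)) := fun w hw =>
    (((dP0 1 w hw).add ((dQ 0 0 w hw).mul (dP0 0 w hw))).congr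
      (eventually_of_mem (hnhds w hw) P1)).Dx_eq
  have R2 : ∀ w ∈ W, Dx S (Dx S (R 0)) w = -(-R 2 w + R 0 w * Q 0 1 w) +
      ((-R 1 w + R 0 w * Q 0 0 w) * Q 0 0 w + R 0 w * -(P 0 w * R 0 w)) := fun w hw =>
    (((dR0 1 w hw).neg.add ((dR0 0 w hw).mul (dQ 0 0 w hw))).congr
      (eventually_of_mem (hnhds w hw) R1)).Dx_eq
  have P3 := (((((dP0 2 w hw).add ((dQ 1 0 w hw).mul (dP0 0 w hw))).add
    ((((dP0 0 w hw).mul (dR0 0 w hw)).neg.mul (dP0 0 w hw)).add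
      ((dQ 0 0 w hw).mul ((dP0 1 w hw).add ((dQ 0 0 w hw).mul (dP0 0 w hw))))))).congr
      (eventually_of_mem (hnhds w hw) P2)).Dx_eq
  have R3 := ((((((dR0 2 w hw).neg).add ((dR0 0 w hw).mul (dQ 0 1 w hw))).neg.add
    ((((dR0 1 w hw).neg.add ((dR0 0 w hw).mul (dQ 0 0 w hw))).mul (dQ 0 0 w hw)).add
      ((dR0 0 w hw).mul ((dP0 0 w hw).mul (dR0 0 w hw)).neg)))).congr
      (eventually_of_mem (hnhds w hw) R2)).Dx_eq
  have Py : Dy S (P 0) w = P 2 w + (Q 0 1 w * P 0 w + Q 0 0 w * P 1 w) := by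
    simpa [Finset.Nat.antidiagonal_succ] using (dP 1 0 w hw).Dy_eq
  have Ry : Dy S (R 0) w = -R 2 w + (R 1 w * Q 0 0 w + R 0 w * Q 1 0 w) := by
    simpa [Finset.Nat.antidiagonal_succ] using (dR 1 0 w hw).Dy_eq
  have Pt : Dt S (P 0) w = P 3 w + (Q 0 2 w * P 0 w + (Q 0 1 w * P 1 w + Q 0 0 w * P 2 w)) := by
    simpa [Finset.Nat.antidiagonal_succ] using (dP 2 0 w hw).Dt_eq
  have Rt : Dt S (R 0) w = -R 3 w + (R 2 w * Q 0 0 w + (R 1 w * Q 1 0 w + R 0 w * Q 2 0 w)) := by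
    simpa [Finset.Nat.antidiagonal_succ] using (dR 2 0 w hw).Dt_eq
  have c01 := comm 0 0 w hw
  have c02 := comm 0 1 w hw
  have c11 := comm 1 0 w hw
  simp only [zero_add, one_add_one_eq_two] at c01 c02 c11
  -- Expresses `Q 0 2` through the moments `Q k 0`; together with `c01` this leaves no algebraic
  -- relation between the remaining blocks to be used.
  rw [c11, c01] at c02
  rw [Py, Ry, Pt, Rt, P3, R3, P2 w hw, R2 w hw, P1 w hw, R1 w hw]
  -- With opaque blocks the four claims are identities between noncommutative polynomials, settled
  -- by expansion.
  clear_value P R Q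
  refine ⟨?_, ?_, ?_, ?_⟩ <;>
  · simp only [c02, c01, Matrix.mul_add, Matrix.add_mul, Matrix.mul_neg, Matrix.neg_mul,
      Matrix.mul_assoc, smul_add, smul_neg, neg_neg, neg_add_rev]
    module

end Block

/-! ### Exponential weights and pointwise bounds for phases. -/

/-- Mean value inequality along the segment from `0` to `z`, where `exp (s Re z) ≤ 1 + exp (Re z)`.
The exponent must keep `Re z` rather than `‖z‖`, because the weights control only real parts of
phases. -/
theorem norm_exp_sub_one_le_mul (z : ℂ) :
    ‖Complex.exp z - 1‖ ≤ ‖z‖ * (1 + Real.exp z.re) := by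
  have hd : ∀ s ∈ Set.Icc (0 : ℝ) 1, HasDerivWithinAt (fun s : ℝ => Complex.exp (s * z))
      (Complex.exp (s * z) * z) (Set.Icc 0 1) s := fun s _ => by
    have h1 : HasDerivAt (fun s : ℝ => (s : ℂ) * z) z s := by
      simpa using (Complex.ofRealCLM.hasDerivAt (x := s)).mul_const z
    exact h1.cexp.hasDerivWithinAt
  have hb : ∀ s ∈ Set.Ico (0 : ℝ) 1,
      ‖Complex.exp (s * z) * z‖ ≤ ‖z‖ * (1 + Real.exp z.re) := fun s hs => by
    rw [norm_mul, mul_comm]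
    gcongr
    rw [Complex.norm_exp, Complex.re_ofReal_mul]
    rcases le_total 0 z.re with h | h
    · have : Real.exp (s * z.re) ≤ Real.exp z.re :=
        Real.exp_le_exp.2 (by nlinarith [hs.2])
      linarith
    · have : Real.exp (s * z.re) ≤ 1 := Real.exp_le_one_iff.2 (by nlinarith [hs.1])
      linarith [Real.exp_pos z.re]
  simpa using norm_image_sub_le_of_norm_deriv_le_segment_01' hd hb

theorem norm_exp_sub_one_sub_le_mul (z : ℂ) :
    ‖Complex.exp z - 1 - z‖ ≤ 2 * ‖z‖ ^ 2 * (1 + Real.exp z.re) := by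
  have hd : ∀ s ∈ Set.Icc (0 : ℝ) 1,
      HasDerivWithinAt (fun s : ℝ => Complex.exp (s * z) - 1 - s * z)
      (Complex.exp (s * z) * z - z) (Set.Icc 0 1) s := fun s _ => by
    have h1 : HasDerivAt (fun s : ℝ => (s : ℂ) * z) z s := by
      simpa using (Complex.ofRealCLM.hasDerivAt (x := s)).mul_const z
    exact ((h1.cexp.sub_const 1).sub h1).hasDerivWithinAt
  have hb : ∀ s ∈ Set.Ico (0 : ℝ) 1,
      ‖Complex.exp (s * z) * z - z‖ ≤ 2 * ‖z‖ ^ 2 * (1 + Real.exp z.re) := fun s hs => by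
    have h1 := norm_exp_sub_one_le_mul (s * z)
    rw [Complex.re_ofReal_mul, norm_mul, Complex.norm_real, Real.norm_of_nonneg hs.1] at h1
    have h2 : 1 + Real.exp (s * z.re) ≤ 2 * (1 + Real.exp z.re) := by
      rcases le_total 0 z.re with h | h
      · have : Real.exp (s * z.re) ≤ Real.exp z.re :=
          Real.exp_le_exp.2 (by nlinarith [hs.2])
        linarith [Real.exp_pos z.re]
      · have : Real.exp (s * z.re) ≤ 1 := Real.exp_le_one_iff.2 (by nlinarith [hs.1])
        linarith [Real.exp_pos z.re]
    calc ‖Complex.exp (s * z) * z - z‖ = ‖Complex.exp (s * z) - 1‖ * ‖z‖ := by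
          rw [← norm_mul]; ring_nf
      _ ≤ (1 * ‖z‖ * (2 * (1 + Real.exp z.re))) * ‖z‖ := by
          have := hs.2.le
          gcongr
          refine h1.trans ?_
          gcongr
      _ = _ := by ring
  simpa using norm_image_sub_le_of_norm_deriv_le_segment_01' hd hb

/-- The real linear phase function with coefficients `ξ`. -/
noncomputable def phase (ξ : Fin 3 → ℝ) (z : ℂ) : ℂ := ∑ n : Fin 3, (ξ n : ℂ) * z ^ (n + 1 : ℕ)

theorem phase_add (ξ η : Fin 3 → ℝ) (z : ℂ) : phase (ξ + η) z = phase ξ z + phase η z := by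
  simp [phase, add_mul, Finset.sum_add_distrib]

theorem phase_neg (ξ : Fin 3 → ℝ) (z : ℂ) : phase (-ξ) z = -phase ξ z := by
  simp [phase]

@[simp] theorem phase_zero (z : ℂ) : phase 0 z = 0 := by simp [phase]

@[fun_prop] theorem continuous_phase (ξ : Fin 3 → ℝ) : Continuous (phase ξ) := by
  unfold phase; fun_prop

/-- The weight that dominates all exponentials of phases with coefficients of size `δ`. -/
noncomputable def expWeight (δ : ℝ) (z : ℂ) : ℝ :=
  Real.exp (δ * ∑ n : Fin 3, |(z ^ (n + 1 : ℕ)).re|)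

@[fun_prop] theorem continuous_expWeight (δ : ℝ) : Continuous (expWeight δ) := by
  unfold expWeight; fun_prop

theorem expWeight_pos (δ : ℝ) (z : ℂ) : 0 < expWeight δ z := Real.exp_pos _

theorem one_le_expWeight {δ : ℝ} (hδ : 0 ≤ δ) (z : ℂ) : 1 ≤ expWeight δ z :=
  Real.one_le_exp (by positivity)

theorem re_phase (ξ : Fin 3 → ℝ) (z : ℂ) :
    (phase ξ z).re = ∑ n : Fin 3, ξ n * (z ^ (n + 1 : ℕ)).re := by
  simp [phase, -Complex.ofReal_pow]

theorem norm_exp_phase_le {δ : ℝ} {ξ : Fin 3 → ℝ} (hξ : ‖ξ‖ ≤ δ) (z : ℂ) :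
    ‖Complex.exp (phase ξ z)‖ ≤ expWeight δ z := by
  rw [Complex.norm_exp, expWeight, Real.exp_le_exp, re_phase, Finset.mul_sum]
  refine Finset.sum_le_sum fun n _ => ?_
  calc ξ n * (z ^ (n + 1 : ℕ)).re ≤ |ξ n * (z ^ (n + 1 : ℕ)).re| := le_abs_self _
    _ = ‖ξ n‖ * |(z ^ (n + 1 : ℕ)).re| := by rw [abs_mul, Real.norm_eq_abs]
    _ ≤ δ * |(z ^ (n + 1 : ℕ)).re| := by
      gcongr
      exact (norm_le_pi_norm ξ n).trans hξ

/-- The weight equals one of the eight summands. It is thus controlled by finitely many exponentials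
of phases, that is, by finitely many values of the parameters. -/
theorem expWeight_le_sum (δ : ℝ) (z : ℂ) : expWeight δ z ≤
    ∑ σ : Fin 3 → ℤˣ, ‖Complex.exp (phase (fun n => δ * ((σ n : ℤ) : ℝ)) z)‖ := by
  -- With these signs each term `δ σ_n Re z^(n+1)` becomes `δ |Re z^(n+1)|`.
  let σ : Fin 3 → ℤˣ := fun n => if 0 ≤ (z ^ (n + 1 : ℕ)).re then 1 else -1
  have : expWeight δ z = ‖Complex.exp (phase (fun n => δ * ((σ n : ℤ) : ℝ)) z)‖ := by
    rw [Complex.norm_exp, expWeight, re_phase, Finset.mul_sum]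
    congr 1
    refine Finset.sum_congr rfl fun n _ => ?_
    by_cases h : 0 ≤ (z ^ (n + 1 : ℕ)).re
    · simp [σ, h, abs_of_nonneg h]
    · simp [σ, h, abs_of_neg (not_le.1 h)]
  rw [this]
  exact Finset.single_le_sum
    (f := fun σ : Fin 3 → ℤˣ => ‖Complex.exp (phase (fun n => δ * ((σ n : ℤ) : ℝ)) z)‖)
    (fun _ _ => norm_nonneg _) (Finset.mem_univ σ)

/-- Since `|z|² = 2 (Re z)² - Re z²`, the exponent of the weight controls `‖z‖`, and an arbitrarily
small loss in `δ` absorbs every power of `z`. -/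
theorem exists_pow_mul_expWeight_le (N : ℕ) {δ' δ : ℝ} (h : δ' < δ) :
    ∃ C : ℝ, 0 < C ∧ ∀ z : ℂ, (1 + ‖z‖) ^ N * expWeight δ' z ≤ C * expWeight δ z := by
  have hε : 0 < δ - δ' := sub_pos.2 h
  set ε := δ - δ' with hεd
  -- The factor `3 ^ N` comes from `1 + ‖z‖ ≤ 3 (1 + s)`, the rest from `x ^ N / N! ≤ exp x` at `x =
  -- ε (1 + s)`.
  refine ⟨3 ^ N * (N.factorial * Real.exp ε / ε ^ N), by positivity, fun z => ?_⟩
  set s := ∑ n : Fin 3, |(z ^ (n + 1 : ℕ)).re| with hs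
  have hs0 : 0 ≤ s := by positivity
  have h1 : ‖z‖ ≤ 2 * (1 + s) := by
    have h2 : |z.re| + |(z ^ 2).re| ≤ s := by
      rw [hs, Fin.sum_univ_three]
      simp
    have h3 : ‖z‖ ^ 2 ≤ 2 * |z.re| ^ 2 + |(z ^ 2).re| := by
      rw [sq_abs, ← Complex.normSq_eq_norm_sq, Complex.normSq_apply]
      have : (z ^ 2).re = z.re * z.re - z.im * z.im := by rw [pow_two, Complex.mul_re]
      rw [this]
      nlinarith [neg_abs_le (z.re * z.re - z.im * z.im)]
    refine le_of_sq_le_sq ?_ (by positivity)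
    nlinarith [abs_nonneg z.re, abs_nonneg (z ^ 2).re]
  have h2 : (1 + s) ^ N ≤ N.factorial * Real.exp ε / ε ^ N * Real.exp (ε * s) := by
    have := Real.pow_div_factorial_le_exp (ε * (1 + s)) (by positivity) N
    rw [mul_pow, mul_add, mul_one, Real.exp_add, div_le_iff₀ (by positivity)] at this
    rw [div_mul_eq_mul_div, le_div_iff₀ (by positivity)]
    linarith
  have h3 : expWeight δ z = Real.exp (ε * s) * expWeight δ' z := by
    rw [expWeight, expWeight, ← Real.exp_add, hεd, ← hs]
    ring_nf
  rw [h3]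
  have h4 : (1 + ‖z‖) ^ N ≤ 3 ^ N * (1 + s) ^ N := by
    rw [← mul_pow]
    gcongr
    linarith
  calc (1 + ‖z‖) ^ N * expWeight δ' z
      ≤ 3 ^ N * (N.factorial * Real.exp ε / ε ^ N * Real.exp (ε * s)) * expWeight δ' z := by
        have := (expWeight_pos δ' z).le
        gcongr
        exact h4.trans (by gcongr)
    _ = _ := by ring

theorem norm_phase_le (ξ : Fin 3 → ℝ) (z : ℂ) : ‖phase ξ z‖ ≤ 3 * ‖ξ‖ * (1 + ‖z‖) ^ 3 := by
  calc ‖phase ξ z‖ ≤ ∑ n : Fin 3, ‖ξ‖ * (1 + ‖z‖) ^ 3 := by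
        refine norm_sum_le_of_le _ fun n _ => ?_
        rw [norm_mul, norm_pow, Complex.norm_real]
        gcongr
        · exact norm_le_pi_norm ξ n
        · calc ‖z‖ ^ (n + 1 : ℕ) ≤ (1 + ‖z‖) ^ (n + 1 : ℕ) := by gcongr; linarith
            _ ≤ _ := pow_le_pow_right₀ (by linarith [norm_nonneg z]) (by omega)
    _ = _ := by simp; ring

/-- The divided difference of a phase. -/
noncomputable def phaseQuot (ξ : Fin 3 → ℝ) (u v : ℂ) : ℂ :=
  ∑ n : Fin 3, (ξ n : ℂ) * ∑ x ∈ Finset.HasAntidiagonal.antidiagonal (n : ℕ), u ^ x.1 * v ^ x.2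

theorem sub_mul_phaseQuot (ξ : Fin 3 → ℝ) (u v : ℂ) :
    (u - v) * phaseQuot ξ u v = phase ξ u - phase ξ v := by
  simp [phaseQuot, phase, Fin.sum_univ_three, Finset.Nat.antidiagonal_succ]
  ring

theorem norm_phaseQuot_le (ξ : Fin 3 → ℝ) (u v : ℂ) :
    ‖phaseQuot ξ u v‖ ≤ 9 * ‖ξ‖ * ((1 + ‖u‖) ^ 2 * (1 + ‖v‖) ^ 2) := by
  have h1 : ∀ z : ℂ, 1 ≤ 1 + ‖z‖ := fun z => by linarith [norm_nonneg z]
  calc ‖phaseQuot ξ u v‖ ≤ ∑ n : Fin 3, ‖ξ‖ * (3 * ((1 + ‖u‖) ^ 2 * (1 + ‖v‖) ^ 2)) := by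
        refine norm_sum_le_of_le _ fun n _ => ?_
        rw [norm_mul, Complex.norm_real]
        gcongr
        · exact norm_le_pi_norm ξ n
        · calc _ ≤ ∑ x ∈ Finset.HasAntidiagonal.antidiagonal (n : ℕ),
                (1 + ‖u‖) ^ 2 * (1 + ‖v‖) ^ 2 := by
                refine norm_sum_le_of_le _ fun x hx => ?_
                rw [Finset.HasAntidiagonal.mem_antidiagonal] at hx
                rw [norm_mul, norm_pow, norm_pow]
                have : ∀ (z : ℂ) (k : ℕ), k ≤ 2 → ‖z‖ ^ k ≤ (1 + ‖z‖) ^ 2 := fun z k hk =>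
                  (pow_le_pow_left₀ (norm_nonneg z) (by linarith) k).trans
                    (pow_le_pow_right₀ (h1 z) hk)
                gcongr
                · exact this u _ (by omega)
                · exact this v _ (by omega)
            _ ≤ _ := by
                rw [Finset.sum_const, Finset.Nat.card_antidiagonal, nsmul_eq_mul]
                have : ((n + 1 : ℕ) : ℝ) ≤ 3 := by
                  have := n.2
                  exact_mod_cast this
                gcongr
    _ = _ := by simp; ring

theorem exists_norm_pow_mul_exp_phase_le (a : ℕ) {δ' δ : ℝ} (hδ : δ' < δ) :
    ∃ C : ℝ, 0 < C ∧ ∀ ξ : Fin 3 → ℝ, ‖ξ‖ ≤ δ' → ∀ z : ℂ,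
      ‖z ^ a * Complex.exp (phase ξ z)‖ ≤ C * expWeight δ z := by
  obtain ⟨C, hC, h⟩ := exists_pow_mul_expWeight_le a hδ
  refine ⟨C, hC, fun ξ hξ z => le_trans ?_ (h z)⟩
  rw [norm_mul, norm_pow]
  gcongr
  · linarith
  · exact norm_exp_phase_le hξ z

theorem exists_norm_exp_phase_remainder_le (a : ℕ) {δ' δ : ℝ} (hδ : δ' < δ) :
    ∃ C : ℝ, 0 < C ∧ ∀ ξ h : Fin 3 → ℝ, ‖ξ‖ ≤ δ' → ‖ξ + h‖ ≤ δ' → ∀ z : ℂ,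
      ‖z ^ a * Complex.exp (phase (ξ + h) z) - z ^ a * Complex.exp (phase ξ z) -
        ∑ n : Fin 3, (h n : ℂ) * (z ^ (a + n + 1 : ℕ) * Complex.exp (phase ξ z))‖ ≤
        C * ‖h‖ ^ 2 * expWeight δ z := by
  -- Squaring `norm_phase_le` adds `6` to the power and gives `3²` in `36 = 2 · 3² · 2`; the outer
  -- factors come from the second order bound and from two exponentials.
  obtain ⟨C, hC, H⟩ := exists_pow_mul_expWeight_le (a + 6) hδ
  refine ⟨36 * C, by positivity, fun ξ h hξ hξh z => ?_⟩
  have e1 : z ^ a * Complex.exp (phase (ξ + h) z) - z ^ a * Complex.exp (phase ξ z) -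
        ∑ n : Fin 3, (h n : ℂ) * (z ^ (a + n + 1 : ℕ) * Complex.exp (phase ξ z)) =
      z ^ a * (Complex.exp (phase ξ z) * (Complex.exp (phase h z) - 1 - phase h z)) := by
    rw [phase_add, Complex.exp_add]
    simp only [phase, Fin.sum_univ_three, Fin.val_zero, Fin.val_one, Fin.val_two]
    ring
  rw [e1, norm_mul, norm_mul, norm_pow]
  have e2 : ‖Complex.exp (phase ξ z)‖ * (1 + Real.exp (phase h z).re) ≤ 2 * expWeight δ' z := by
    have : ‖Complex.exp (phase ξ z)‖ * Real.exp (phase h z).re =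
        ‖Complex.exp (phase (ξ + h) z)‖ := by
      rw [phase_add, Complex.exp_add, norm_mul, Complex.norm_exp (phase h z)]
    rw [mul_add, this, mul_one]
    linarith [norm_exp_phase_le hξ z, norm_exp_phase_le hξh z]
  calc ‖z‖ ^ a * (‖Complex.exp (phase ξ z)‖ * ‖Complex.exp (phase h z) - 1 - phase h z‖)
      ≤ ‖z‖ ^ a * (‖Complex.exp (phase ξ z)‖ *
          (2 * ‖phase h z‖ ^ 2 * (1 + Real.exp (phase h z).re))) := by
        gcongr
        exact norm_exp_sub_one_sub_le_mul _
    _ = 2 * ‖z‖ ^ a * ‖phase h z‖ ^ 2 *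
          (‖Complex.exp (phase ξ z)‖ * (1 + Real.exp (phase h z).re)) := by ring
    _ ≤ 2 * (1 + ‖z‖) ^ a * (3 * ‖h‖ * (1 + ‖z‖) ^ 3) ^ 2 * (2 * expWeight δ' z) := by
        gcongr
        · linarith
        · exact norm_phase_le h z
    _ = 36 * ‖h‖ ^ 2 * ((1 + ‖z‖) ^ (a + 6) * expWeight δ' z) := by ring
    _ ≤ 36 * ‖h‖ ^ 2 * (C * expWeight δ z) :=
        mul_le_mul_of_nonneg_left (H z) (by positivity)
    _ = _ := by ring

/-- The kernel `(exp (φ(u) - φ(v)) - 1) / (u - v)`, where `φ` is a phase. -/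
noncomputable def expQuot (ξ : Fin 3 → ℝ) (u v : ℂ) : ℂ :=
  (Complex.exp (phase ξ u - phase ξ v) - 1) / (u - v)

theorem norm_exp_phase_sub_le {δ : ℝ} {ξ : Fin 3 → ℝ} (hξ : ‖ξ‖ ≤ δ) (u v : ℂ) :
    ‖Complex.exp (phase ξ u - phase ξ v)‖ ≤ expWeight δ u * expWeight δ v := by
  rw [sub_eq_add_neg, ← phase_neg, Complex.exp_add, norm_mul]
  exact mul_le_mul (norm_exp_phase_le hξ u) (norm_exp_phase_le (by rwa [norm_neg]) v)
    (norm_nonneg _) (expWeight_pos _ _).le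

/-- The numerator is of the order of `φ(u) - φ(v)`, which is `u - v` times a polynomial, so the
singularity cancels. -/
theorem exists_norm_expQuot_le {δ' δ : ℝ} (hδ : δ' < δ) :
    ∃ C : ℝ, 0 < C ∧ ∀ ξ : Fin 3 → ℝ, ‖ξ‖ ≤ δ' → ∀ u v : ℂ,
      ‖expQuot ξ u v‖ ≤ C * (expWeight δ u * expWeight δ v) := by
  obtain ⟨C, hC, H⟩ := exists_pow_mul_expWeight_le 2 hδ
  -- The summand `1` keeps the constant positive when `δ' = 0`.
  refine ⟨18 * |δ'| * C ^ 2 + 1, by positivity, fun ξ hξ u v => ?_⟩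
  have hδ' : 0 ≤ δ' := (norm_nonneg ξ).trans hξ
  have pu := expWeight_pos δ u
  have pv := expWeight_pos δ v
  have pu' := expWeight_pos δ' u
  have pv' := expWeight_pos δ' v
  rcases eq_or_ne u v with rfl | huv
  · simp only [expQuot, sub_self, div_zero, norm_zero]
    positivity
  have huv' : 0 < ‖u - v‖ := norm_pos_iff.2 (sub_ne_zero.2 huv)
  rw [expQuot, norm_div, div_le_iff₀ huv', ← sub_mul_phaseQuot]
  have h1 := norm_exp_sub_one_le_mul ((u - v) * phaseQuot ξ u v)
  rw [← Complex.norm_exp, sub_mul_phaseQuot] at h1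
  have h2 := norm_exp_phase_sub_le hξ u v
  have h3 : 1 ≤ expWeight δ' u * expWeight δ' v :=
    one_le_mul_of_one_le_of_one_le (one_le_expWeight hδ' u) (one_le_expWeight hδ' v)
  rw [sub_mul_phaseQuot]
  calc ‖Complex.exp (phase ξ u - phase ξ v) - 1‖
      ≤ ‖phase ξ u - phase ξ v‖ * (1 + ‖Complex.exp (phase ξ u - phase ξ v)‖) := h1
    _ ≤ (‖u - v‖ * (9 * |δ'| * ((1 + ‖u‖) ^ 2 * (1 + ‖v‖) ^ 2))) *
          (2 * (expWeight δ' u * expWeight δ' v)) := by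
        rw [← sub_mul_phaseQuot ξ u v, norm_mul]
        rw [← sub_mul_phaseQuot ξ u v] at h2
        gcongr
        · refine (norm_phaseQuot_le ξ u v).trans ?_
          gcongr
          exact hξ.trans (le_abs_self _)
        · linarith
    _ = 18 * |δ'| * ‖u - v‖ * (((1 + ‖u‖) ^ 2 * expWeight δ' u) *
          ((1 + ‖v‖) ^ 2 * expWeight δ' v)) := by ring
    _ ≤ 18 * |δ'| * ‖u - v‖ * ((C * expWeight δ u) * (C * expWeight δ v)) :=
        mul_le_mul_of_nonneg_left (mul_le_mul (H u) (H v) (by positivity) (by positivity))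
          (by positivity)
    _ ≤ _ := by
        have : 0 ≤ expWeight δ u * expWeight δ v * ‖u - v‖ := by positivity
        linarith

/-- The diagonal is excluded because `expQuot` is zero there by the convention for division by zero,
whereas `phaseQuot h u u` need not vanish. -/
theorem exists_norm_expQuot_remainder_le {δ' δ : ℝ} (hδ : δ' < δ) :
    ∃ C : ℝ, 0 < C ∧ ∀ ξ h : Fin 3 → ℝ, ‖ξ‖ ≤ δ' → ‖ξ + h‖ ≤ δ' → ∀ u v : ℂ, u ≠ v →
      ‖expQuot (ξ + h) u v - expQuot ξ u v -
        phaseQuot h u v * Complex.exp (phase ξ u - phase ξ v)‖ ≤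
        C * ‖h‖ ^ 2 * (expWeight δ u * expWeight δ v) := by
  obtain ⟨C, hC, H⟩ := exists_pow_mul_expWeight_le 5 hδ
  refine ⟨216 * C ^ 2, by positivity, fun ξ h hξ hξh u v huv => ?_⟩
  have pu := expWeight_pos δ u
  have pv := expWeight_pos δ v
  have pu' := expWeight_pos δ' u
  have pv' := expWeight_pos δ' v
  have huv0 : u - v ≠ 0 := sub_ne_zero.2 huv
  have huv' : 0 < ‖u - v‖ := norm_pos_iff.2 huv0
  set D := phase h u - phase h v with hD
  have e1 : expQuot (ξ + h) u v - expQuot ξ u v -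
        phaseQuot h u v * Complex.exp (phase ξ u - phase ξ v) =
      Complex.exp (phase ξ u - phase ξ v) * (Complex.exp D - 1 - D) / (u - v) := by
    rw [expQuot, expQuot, phase_add, phase_add, hD,
      show phase ξ u + phase h u - (phase ξ v + phase h v) =
        (phase ξ u - phase ξ v) + (phase h u - phase h v) by ring, Complex.exp_add,
      ← sub_mul_phaseQuot h]
    field_simp
    ring
  have e2 : ‖Complex.exp (phase ξ u - phase ξ v)‖ * (1 + Real.exp D.re) ≤
      2 * (expWeight δ' u * expWeight δ' v) := by
    have : ‖Complex.exp (phase ξ u - phase ξ v)‖ * Real.exp D.re =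
        ‖Complex.exp (phase (ξ + h) u - phase (ξ + h) v)‖ := by
      rw [← Complex.norm_exp, ← norm_mul, ← Complex.exp_add, phase_add, phase_add, hD]
      ring_nf
    rw [mul_add, this, mul_one]
    linarith [norm_exp_phase_sub_le hξ u v, norm_exp_phase_sub_le hξh u v]
  have hu1 : 1 ≤ 1 + ‖u‖ := by linarith [norm_nonneg u]
  have hv1 : 1 ≤ 1 + ‖v‖ := by linarith [norm_nonneg v]
  have e3 : ‖D‖ ≤ 6 * ‖h‖ * ((1 + ‖u‖) ^ 3 * (1 + ‖v‖) ^ 3) := by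
    have h1 := norm_phase_le h u
    have h2 := norm_phase_le h v
    have h3 : (1 + ‖u‖) ^ 3 ≤ (1 + ‖u‖) ^ 3 * (1 + ‖v‖) ^ 3 :=
      le_mul_of_one_le_right (by positivity) (one_le_pow₀ hv1)
    have h4 : (1 + ‖v‖) ^ 3 ≤ (1 + ‖u‖) ^ 3 * (1 + ‖v‖) ^ 3 :=
      le_mul_of_one_le_left (by positivity) (one_le_pow₀ hu1)
    calc ‖D‖ ≤ ‖phase h u‖ + ‖phase h v‖ := norm_sub_le _ _
      _ ≤ 3 * ‖h‖ * ((1 + ‖u‖) ^ 3 * (1 + ‖v‖) ^ 3) +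
          3 * ‖h‖ * ((1 + ‖u‖) ^ 3 * (1 + ‖v‖) ^ 3) :=
        add_le_add (h1.trans (by gcongr)) (h2.trans (by gcongr))
      _ = _ := by ring
  have e4 : ‖D‖ ≤ ‖u - v‖ * (9 * ‖h‖ * ((1 + ‖u‖) ^ 2 * (1 + ‖v‖) ^ 2)) := by
    rw [hD, ← sub_mul_phaseQuot, norm_mul]
    gcongr
    exact norm_phaseQuot_le h u v
  rw [e1, norm_div, norm_mul, div_le_iff₀ huv']
  calc ‖Complex.exp (phase ξ u - phase ξ v)‖ * ‖Complex.exp D - 1 - D‖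
      ≤ ‖Complex.exp (phase ξ u - phase ξ v)‖ * (2 * ‖D‖ ^ 2 * (1 + Real.exp D.re)) := by
        gcongr
        exact norm_exp_sub_one_sub_le_mul _
    _ = 2 * ‖D‖ * ‖D‖ *
          (‖Complex.exp (phase ξ u - phase ξ v)‖ * (1 + Real.exp D.re)) := by ring
    -- One factor `‖D‖` is bounded by `e4`, which supplies `‖u - v‖` to cancel the denominator, the
    -- other by `e3`. Both keep a factor `‖h‖`, so the remainder is quadratic.
    _ ≤ 2 * (6 * ‖h‖ * ((1 + ‖u‖) ^ 3 * (1 + ‖v‖) ^ 3)) *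
          (‖u - v‖ * (9 * ‖h‖ * ((1 + ‖u‖) ^ 2 * (1 + ‖v‖) ^ 2))) *
          (2 * (expWeight δ' u * expWeight δ' v)) := by gcongr
    _ = 216 * ‖h‖ ^ 2 * ‖u - v‖ * (((1 + ‖u‖) ^ 5 * expWeight δ' u) *
          ((1 + ‖v‖) ^ 5 * expWeight δ' v)) := by ring
    _ ≤ 216 * ‖h‖ ^ 2 * ‖u - v‖ * ((C * expWeight δ u) * (C * expWeight δ v)) :=
        mul_le_mul_of_nonneg_left (mul_le_mul (H u) (H v) (by positivity) (by positivity))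
          (by positivity)
    _ = _ := by ring

/-! ### Pairing, dominated convergence and truncated integrals in `L²`. -/

variable {μ : Measure ℂ}

/-- The class in `L²` of a square integrable function (zero for other functions). -/
noncomputable def toLpTwo (μ : Measure ℂ) (φ : ℂ → ℂ) : Lp ℂ 2 μ :=
  open scoped Classical in
  if h : MemLp φ 2 μ then h.toLp φ else 0

theorem coeFn_toLpTwo {φ : ℂ → ℂ} (h : MemLp φ 2 μ) : toLpTwo μ φ =ᵐ[μ] φ := by
  rw [toLpTwo, dif_pos h]
  exact h.coeFn_toLp

theorem integrable_mul_of_memLp_two {a b : ℂ → ℂ} (ha : MemLp a 2 μ) (hb : MemLp b 2 μ) :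
    Integrable (fun z => a z * b z) μ := ha.integrable_mul hb

theorem integral_norm_mul_norm_le {a b : ℂ → ℂ} (ha : MemLp a 2 μ) (hb : MemLp b 2 μ) :
    ∫ z, ‖a z‖ * ‖b z‖ ∂μ ≤ (eLpNorm a 2 μ).toReal * (eLpNorm b 2 μ).toReal := by
  have h := integral_mul_norm_le_Lp_mul_Lq (μ := μ) (f := a) (g := b)
    Real.HolderConjugate.two_two (by simpa using ha) (by simpa using hb)
  rw [ha.eLpNorm_eq_integral_rpow_norm (by simp) (by simp),
    hb.eLpNorm_eq_integral_rpow_norm (by simp) (by simp), ENNReal.toReal_ofReal (by positivity),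
    ENNReal.toReal_ofReal (by positivity)]
  simpa using h

theorem norm_le_of_ae_norm_le {x : Lp ℂ 2 μ} {a : ℂ → ℂ} (ha : MemLp a 2 μ) {c : ℝ}
    (h : ∀ᵐ u ∂μ, ‖x u‖ ≤ c * ‖a u‖) : ‖x‖ ≤ c * (eLpNorm a 2 μ).toReal := by
  rw [← Lp.norm_toLp a ha]
  refine Lp.norm_le_mul_norm_of_ae_le_mul ?_
  filter_upwards [h, ha.coeFn_toLp] with u h1 h2
  rwa [h2]

/-- Dominated convergence in `L²`. -/
theorem tendsto_Lp_two_of_dominated {x : ℕ → Lp ℂ 2 μ} {y : Lp ℂ 2 μ} {a : ℂ → ℝ}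
    (ha : MemLp a 2 μ) (hx : ∀ n, ∀ᵐ u ∂μ, ‖x n u‖ ≤ a u)
    (hy : ∀ᵐ u ∂μ, Tendsto (fun n => x n u) atTop (𝓝 (y u))) :
    Tendsto x atTop (𝓝 y) := by
  have hnorm : ∀ n, ‖x n - y‖ = (∫ u, ‖x n u - y u‖ ^ (2 : ℝ) ∂μ) ^ (2 : ℝ)⁻¹ := fun n => by
    rw [Lp.norm_def, (Lp.memLp _).eLpNorm_eq_integral_rpow_norm (by simp) (by simp),
      ENNReal.toReal_ofReal (by positivity), ENNReal.toReal_ofNat]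
    congr 1
    refine integral_congr_ae ?_
    filter_upwards [Lp.coeFn_sub (x n) y] with u hu
    rw [hu, Pi.sub_apply]
  have hya : ∀ᵐ u ∂μ, ‖y u‖ ≤ a u := by
    filter_upwards [ae_all_iff.2 hx, hy] with u h1 h2
    exact le_of_tendsto h2.norm (Eventually.of_forall h1)
  have hlim : Tendsto (fun n => ∫ u, ‖x n u - y u‖ ^ (2 : ℝ) ∂μ) atTop (𝓝 0) := by
    rw [← integral_zero ℂ ℝ (μ := μ)]
    refine tendsto_integral_of_dominated_convergence (fun u => 4 * a u ^ 2) (fun n => ?_)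
      (ha.integrable_sq.const_mul 4) (fun n => ?_) ?_
    · exact (((Lp.aestronglyMeasurable (x n)).sub (Lp.aestronglyMeasurable y)).norm.aemeasurable.pow_const
        (2 : ℝ)).aestronglyMeasurable
    · filter_upwards [hx n, hya] with u h1 h2
      rw [Real.norm_of_nonneg (by positivity), Real.rpow_two]
      have : ‖x n u - y u‖ ≤ 2 * a u := (norm_sub_le _ _).trans (by linarith)
      nlinarith [norm_nonneg (x n u - y u)]
    · filter_upwards [hy] with u hu
      have := ((hu.sub_const (y u)).norm).pow 2
      simpa using this
  rw [tendsto_iff_norm_sub_tendsto_zero]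
  simp_rw [hnorm]
  have := hlim.rpow_const (p := (2 : ℝ)⁻¹) (Or.inr (by norm_num))
  rwa [Real.zero_rpow (by norm_num)] at this

/-- The pairing is bilinear, without complex conjugation, so multiplication operators are symmetric
for it. The function `d` stands for the density of `μ` with respect to `|μ|`. -/
theorem exists_pairing {d : ℂ → ℂ} (hd : AEStronglyMeasurable d μ) {D : ℝ}
    (hD : ∀ z, ‖d z‖ ≤ D) :
    ∃ B : Lp ℂ 2 μ →L[ℂ] Lp ℂ 2 μ →L[ℂ] ℂ, ∀ ψ φ : Lp ℂ 2 μ,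
      B ψ φ = ∫ z, φ z * ψ z * d z ∂μ := by
  have hint : ∀ ψ φ : Lp ℂ 2 μ, Integrable (fun z => φ z * ψ z * d z) μ := fun ψ φ =>
    (integrable_mul_of_memLp_two (Lp.memLp φ) (Lp.memLp ψ)).mul_bdd (c := D) hd
      (Eventually.of_forall hD)
  refine ⟨LinearMap.mkContinuous₂ (LinearMap.mk₂ ℂ (fun ψ φ => ∫ z, φ z * ψ z * d z ∂μ)
    ?_ ?_ ?_ ?_) D ?_, fun ψ φ => rfl⟩
  · intro ψ₁ ψ₂ φ
    rw [← integral_add (hint _ _) (hint _ _)]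
    refine integral_congr_ae ?_
    filter_upwards [Lp.coeFn_add ψ₁ ψ₂] with z hz
    rw [hz, Pi.add_apply]; ring
  · intro c ψ φ
    rw [smul_eq_mul, ← integral_const_mul]
    refine integral_congr_ae ?_
    filter_upwards [Lp.coeFn_smul c ψ] with z hz
    rw [hz, Pi.smul_apply, smul_eq_mul]; ring
  · intro ψ φ₁ φ₂
    rw [← integral_add (hint _ _) (hint _ _)]
    refine integral_congr_ae ?_
    filter_upwards [Lp.coeFn_add φ₁ φ₂] with z hz
    rw [hz, Pi.add_apply]; ring
  · intro c ψ φ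
    rw [smul_eq_mul, ← integral_const_mul]
    refine integral_congr_ae ?_
    filter_upwards [Lp.coeFn_smul c φ] with z hz
    rw [hz, Pi.smul_apply, smul_eq_mul]; ring
  · intro ψ φ
    rw [LinearMap.mk₂_apply]
    have hD0 : 0 ≤ D := (norm_nonneg _).trans (hD 0)
    calc ‖∫ z, φ z * ψ z * d z ∂μ‖ ≤ ∫ z, D * (‖ψ z‖ * ‖φ z‖) ∂μ := by
          refine norm_integral_le_of_norm_le
            (((integrable_mul_of_memLp_two (Lp.memLp ψ) (Lp.memLp φ)).norm.congr
              (Eventually.of_forall fun z => norm_mul _ _)).const_mul D)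
            (Eventually.of_forall fun z => ?_)
          rw [norm_mul, norm_mul, mul_comm D, mul_comm ‖ψ z‖]
          gcongr
          exact hD z
      _ ≤ D * (‖ψ‖ * ‖φ‖) := by
          rw [integral_const_mul]
          gcongr
          exact integral_norm_mul_norm_le (Lp.memLp ψ) (Lp.memLp φ)
      _ = _ := by ring

/-- Truncated integrals converge to the integral of an integrable function. -/
theorem tendsto_setIntegral_norm_sub_gt {X : ℂ → ℂ} (hX : Integrable X μ) {u : ℂ}
    (hu : X u = 0) :
    Tendsto (fun ε : ℝ => ∫ v in {v | ε < ‖u - v‖}, X v ∂μ) (𝓝[>] 0) (𝓝 (∫ v, X v ∂μ)) := by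
  have hm : ∀ ε : ℝ, MeasurableSet {v : ℂ | ε < ‖u - v‖} := fun ε =>
    measurableSet_lt measurable_const (by fun_prop)
  simp_rw [← integral_indicator (hm _)]
  refine tendsto_integral_filter_of_dominated_convergence (fun v => ‖X v‖)
    (Eventually.of_forall fun ε => hX.aestronglyMeasurable.indicator (hm ε))
    (Eventually.of_forall fun ε => Eventually.of_forall fun v => norm_indicator_le_norm_self _ _)
    hX.norm (Eventually.of_forall fun v => ?_)
  -- For `ε > 0` the truncated domain omits `u`, which loses nothing at an atom because `X u = 0`.
  rcases eq_or_ne u v with rfl | huv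
  · refine Tendsto.congr (f₁ := fun _ => 0) (fun ε => ?_) (by rw [hu]; exact tendsto_const_nhds)
    rw [Set.indicator_apply, hu, ite_self]
  · refine tendsto_const_nhds.congr' ?_
    have h0 : 0 < ‖u - v‖ := norm_pos_iff.2 (sub_ne_zero.2 huv)
    filter_upwards [nhdsWithin_le_nhds (eventually_lt_nhds h0)] with ε hε
    rw [Set.indicator_of_mem (show v ∈ {v : ℂ | ε < ‖u - v‖} from hε)]

/-! ### Weighted families of functions and operators with weighted kernels. -/

variable {μ : Measure ℂ} {δ δ' : ℝ} {F₀ G₀ : ℂ → ℂ}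

theorem aestronglyMeasurable_of_expWeight_mul
    (hF : MemLp (fun z => (expWeight δ z : ℂ) * F₀ z) 2 μ) : AEStronglyMeasurable F₀ μ := by
  have h1 : AEStronglyMeasurable (fun z => ((expWeight δ z : ℂ))⁻¹) μ :=
    (by fun_prop : Measurable fun z => ((expWeight δ z : ℂ))⁻¹).aestronglyMeasurable
  refine (h1.mul hF.1).congr (Eventually.of_forall fun z => ?_)
  have : (expWeight δ z : ℂ) ≠ 0 := by exact_mod_cast (expWeight_pos δ z).ne'
  simp [this]

theorem memLp_of_norm_le_expWeight (hF : MemLp (fun z => (expWeight δ z : ℂ) * F₀ z) 2 μ)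
    {k : ℂ → ℂ} (hk : Measurable k) {C : ℝ} (hC : ∀ z, ‖k z‖ ≤ C * expWeight δ z) :
    MemLp (fun z => k z * F₀ z) 2 μ := by
  refine hF.of_le_mul (c := C)
    (hk.aestronglyMeasurable.mul (aestronglyMeasurable_of_expWeight_mul hF))
    (Eventually.of_forall fun z => ?_)
  rw [norm_mul, norm_mul, Complex.norm_real, Real.norm_of_nonneg (expWeight_pos δ z).le,
    ← mul_assoc]
  gcongr
  exact hC z

theorem memLp_pow_mul_exp_phase (hF : MemLp (fun z => (expWeight δ z : ℂ) * F₀ z) 2 μ)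
    (hδ : δ' < δ) (a : ℕ) {ξ : Fin 3 → ℝ} (hξ : ‖ξ‖ ≤ δ') :
    MemLp (fun z => z ^ a * Complex.exp (phase ξ z) * F₀ z) 2 μ := by
  obtain ⟨C, -, h⟩ := exists_norm_pow_mul_exp_phase_le a hδ
  exact memLp_of_norm_le_expWeight hF (by fun_prop) (h ξ hξ)

/-- The functions `z ^ a exp (φ(z)) F₀(z)` as elements of `L²`. -/
noncomputable def expFamily (μ : Measure ℂ) (F₀ : ℂ → ℂ) (a : ℕ) (ξ : Fin 3 → ℝ) : Lp ℂ 2 μ :=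
  toLpTwo μ fun z => z ^ a * Complex.exp (phase ξ z) * F₀ z

theorem coeFn_expFamily (hF : MemLp (fun z => (expWeight δ z : ℂ) * F₀ z) 2 μ)
    (hδ : δ' < δ) (a : ℕ) {ξ : Fin 3 → ℝ} (hξ : ‖ξ‖ ≤ δ') :
    expFamily μ F₀ a ξ =ᵐ[μ] fun z => z ^ a * Complex.exp (phase ξ z) * F₀ z :=
  coeFn_toLpTwo (memLp_pow_mul_exp_phase hF hδ a hξ)

/-- The pointwise Taylor estimate, multiplied by `F₀`, is dominated by one square integrable
function for all `ξ` in the ball. -/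
theorem exists_norm_expFamily_remainder_le
    (hF : MemLp (fun z => (expWeight δ z : ℂ) * F₀ z) 2 μ) (hδ : δ' < δ) (a : ℕ) :
    ∃ C : ℝ, ∀ ξ h : Fin 3 → ℝ, ‖ξ‖ ≤ δ' → ‖ξ + h‖ ≤ δ' →
      ‖expFamily μ F₀ a (ξ + h) - expFamily μ F₀ a ξ -
        ∑ n : Fin 3, (h n : ℂ) • expFamily μ F₀ (a + n + 1) ξ‖ ≤ C * ‖h‖ ^ 2 := by
  obtain ⟨C, hC, H⟩ := exists_norm_exp_phase_remainder_le a hδ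
  refine ⟨C * (eLpNorm (fun z => (expWeight δ z : ℂ) * F₀ z) 2 μ).toReal,
    fun ξ h hξ hξh => ?_⟩
  rw [mul_right_comm]
  refine norm_le_of_ae_norm_le hF ?_
  simp only [Fin.sum_univ_three]
  filter_upwards [Lp.coeFn_sub (expFamily μ F₀ a (ξ + h) - expFamily μ F₀ a ξ)
      ((h 0 : ℂ) • expFamily μ F₀ (a + (0 : Fin 3) + 1) ξ +
        (h 1 : ℂ) • expFamily μ F₀ (a + (1 : Fin 3) + 1) ξ +
        (h 2 : ℂ) • expFamily μ F₀ (a + (2 : Fin 3) + 1) ξ),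
    Lp.coeFn_sub (expFamily μ F₀ a (ξ + h)) (expFamily μ F₀ a ξ),
    Lp.coeFn_add ((h 0 : ℂ) • expFamily μ F₀ (a + (0 : Fin 3) + 1) ξ +
        (h 1 : ℂ) • expFamily μ F₀ (a + (1 : Fin 3) + 1) ξ)
        ((h 2 : ℂ) • expFamily μ F₀ (a + (2 : Fin 3) + 1) ξ),
    Lp.coeFn_add ((h 0 : ℂ) • expFamily μ F₀ (a + (0 : Fin 3) + 1) ξ)
        ((h 1 : ℂ) • expFamily μ F₀ (a + (1 : Fin 3) + 1) ξ),
    Lp.coeFn_smul (h 0 : ℂ) (expFamily μ F₀ (a + (0 : Fin 3) + 1) ξ),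
    Lp.coeFn_smul (h 1 : ℂ) (expFamily μ F₀ (a + (1 : Fin 3) + 1) ξ),
    Lp.coeFn_smul (h 2 : ℂ) (expFamily μ F₀ (a + (2 : Fin 3) + 1) ξ),
    coeFn_expFamily hF hδ a hξ, coeFn_expFamily hF hδ a hξh,
    coeFn_expFamily hF hδ (a + (0 : Fin 3) + 1) hξ,
    coeFn_expFamily hF hδ (a + (1 : Fin 3) + 1) hξ,
    coeFn_expFamily hF hδ (a + (2 : Fin 3) + 1) hξ] with z h1 h2 h3 h4 h5 h6 h7 h8 h9 h10 h11 h12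
  have hH := H ξ h hξ hξh z
  rw [Fin.sum_univ_three] at hH
  rw [h1, Pi.sub_apply, h2, Pi.sub_apply, h3, Pi.add_apply, h4, Pi.add_apply, h5, h6, h7,
    Pi.smul_apply, Pi.smul_apply, Pi.smul_apply, h8, h9, h10, h11, h12, norm_mul,
    Complex.norm_real, Real.norm_of_nonneg (expWeight_pos δ z).le, ← mul_assoc]
  refine le_trans (le_of_eq ?_) (mul_le_mul_of_nonneg_right hH (norm_nonneg (F₀ z)))
  rw [← norm_mul]
  congr 1
  simp only [smul_eq_mul]
  ring

section KernelOperator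

variable {d : ℂ → ℂ} {D : ℝ}

theorem integrable_kernel_mul (hd : AEStronglyMeasurable d μ) (hD : ∀ z, ‖d z‖ ≤ D)
    (hG : MemLp (fun z => (expWeight δ z : ℂ) * G₀ z) 2 μ) {k : ℂ → ℂ} (hk : Measurable k)
    {C : ℝ} (hC : ∀ v, ‖k v‖ ≤ C * expWeight δ v) (φ : Lp ℂ 2 μ) :
    Integrable (fun v => k v * G₀ v * φ v * d v) μ :=
  (integrable_mul_of_memLp_two (memLp_of_norm_le_expWeight hG hk hC) (Lp.memLp φ)).mul_bdd
    (c := D) hd (Eventually.of_forall hD)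

theorem norm_integral_kernel_mul_le (hD : ∀ z, ‖d z‖ ≤ D)
    (hG : MemLp (fun z => (expWeight δ z : ℂ) * G₀ z) 2 μ) {k : ℂ → ℂ} {b : ℂ}
    {C : ℝ} (hC0 : 0 ≤ C) (hC : ∀ v, ‖b * k v * G₀ v‖ ≤ C * ‖(expWeight δ v : ℂ) * G₀ v‖)
    (φ : Lp ℂ 2 μ) :
    ‖b * ∫ v, k v * G₀ v * φ v * d v ∂μ‖ ≤
      C * D * ((eLpNorm (fun z => (expWeight δ z : ℂ) * G₀ z) 2 μ).toReal * ‖φ‖) := by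
  have hD0 : 0 ≤ D := (norm_nonneg _).trans (hD 0)
  rw [← integral_const_mul]
  calc _ ≤ ∫ v, C * D * (‖(expWeight δ v : ℂ) * G₀ v‖ * ‖φ v‖) ∂μ := by
        refine norm_integral_le_of_norm_le
          (((integrable_mul_of_memLp_two hG (Lp.memLp φ)).norm.congr
            (Eventually.of_forall fun z => norm_mul _ _)).const_mul (C * D))
          (Eventually.of_forall fun v => ?_)
        calc ‖b * (k v * G₀ v * φ v * d v)‖ = ‖b * k v * G₀ v‖ * ‖φ v‖ * ‖d v‖ := by
              simp only [norm_mul]; ring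
          _ ≤ (C * ‖(expWeight δ v : ℂ) * G₀ v‖) * ‖φ v‖ * D := by
              gcongr
              · exact hC v
              · exact hD v
          _ = _ := by ring
    _ ≤ _ := by
        rw [integral_const_mul]
        gcongr
        exact integral_norm_mul_norm_le hG (Lp.memLp φ)

/-- Kernels that are dominated by the exponential weights define bounded operators. -/
theorem exists_kernelOperator [SFinite μ] (hd : AEStronglyMeasurable d μ) (hD : ∀ z, ‖d z‖ ≤ D)
    (hF : MemLp (fun z => (expWeight δ z : ℂ) * F₀ z) 2 μ)
    (hG : MemLp (fun z => (expWeight δ z : ℂ) * G₀ z) 2 μ)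
    {k : ℂ → ℂ → ℂ} (hk : Measurable (Function.uncurry k)) {C : ℝ} (hC0 : 0 ≤ C)
    (hC : ∀ u v, ‖k u v‖ ≤ C * (expWeight δ u * expWeight δ v)) :
    ∃ T : Lp ℂ 2 μ →L[ℂ] Lp ℂ 2 μ, ∀ φ : Lp ℂ 2 μ,
      T φ =ᵐ[μ] fun u => F₀ u * ∫ v, k u v * G₀ v * φ v * d v ∂μ := by
  have hku : ∀ u, Measurable (k u) := fun u => hk.comp measurable_prodMk_left
  have hint : ∀ (φ : Lp ℂ 2 μ) u, Integrable (fun v => k u v * G₀ v * φ v * d v) μ :=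
    fun φ u => integrable_kernel_mul hd hD hG (C := C * expWeight δ u) (hku u)
      (fun v => by rw [mul_assoc]; exact hC u v) φ
  set NG := (eLpNorm (fun z => (expWeight δ z : ℂ) * G₀ z) 2 μ).toReal
  set NF := (eLpNorm (fun z => (expWeight δ z : ℂ) * F₀ z) 2 μ).toReal
  -- The bound is a constant times the square integrable function `expWeight δ u * F₀ u`; it gives
  -- both membership in `L²` and the operator bound.
  have hbd : ∀ (φ : Lp ℂ 2 μ) u, ‖F₀ u * ∫ v, k u v * G₀ v * φ v * d v ∂μ‖ ≤
      (C * D * (NG * ‖φ‖)) * ‖(expWeight δ u : ℂ) * F₀ u‖ := by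
    intro φ u
    refine (norm_integral_kernel_mul_le (C := C * ‖(expWeight δ u : ℂ) * F₀ u‖) hD hG
      (by positivity) (fun v => ?_) φ).trans (le_of_eq (by ring))
    simp only [norm_mul, Complex.norm_real, Real.norm_of_nonneg (expWeight_pos δ _).le]
    calc ‖F₀ u‖ * ‖k u v‖ * ‖G₀ v‖
        ≤ ‖F₀ u‖ * (C * (expWeight δ u * expWeight δ v)) * ‖G₀ v‖ := by
          gcongr
          exact hC u v
      _ = _ := by ring
  have hmeas : ∀ φ : Lp ℂ 2 μ,
      AEStronglyMeasurable (fun u => F₀ u * ∫ v, k u v * G₀ v * φ v * d v ∂μ) μ := fun φ => by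
    refine (aestronglyMeasurable_of_expWeight_mul hF).mul ?_
    refine AEStronglyMeasurable.integral_prod_right'
      (f := fun p : ℂ × ℂ => k p.1 p.2 * G₀ p.2 * φ p.2 * d p.2) ?_
    refine ((AEStronglyMeasurable.mul ?_ ?_).mul ?_).mul ?_
    · exact hk.aestronglyMeasurable
    · exact (aestronglyMeasurable_of_expWeight_mul hG).comp_snd
    · exact (Lp.aestronglyMeasurable φ).comp_snd
    · exact hd.comp_snd
  have hmem : ∀ φ : Lp ℂ 2 μ,
      MemLp (fun u => F₀ u * ∫ v, k u v * G₀ v * φ v * d v ∂μ) 2 μ := fun φ =>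
    hF.of_le_mul (hmeas φ) (Eventually.of_forall (hbd φ))
  refine ⟨LinearMap.mkContinuous
    { toFun := fun φ => (hmem φ).toLp _
      map_add' := fun φ ψ => ?_
      map_smul' := fun c φ => ?_ } (C * D * NG * NF) fun φ => ?_, fun φ => (hmem φ).coeFn_toLp⟩
  · rw [← MemLp.toLp_add]
    refine MemLp.toLp_congr _ _ (Eventually.of_forall fun u => ?_)
    rw [Pi.add_apply, ← mul_add, ← integral_add (hint φ u) (hint ψ u)]
    refine congrArg (F₀ u * ·) (integral_congr_ae (μ := μ) ?_)
    filter_upwards [Lp.coeFn_add φ ψ] with v hv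
    rw [hv, Pi.add_apply]; ring
  · rw [RingHom.id_apply, ← MemLp.toLp_const_smul]
    refine MemLp.toLp_congr _ _ (Eventually.of_forall fun u => ?_)
    rw [Pi.smul_apply, smul_eq_mul, mul_left_comm, ← integral_const_mul]
    refine congrArg (F₀ u * ·) (integral_congr_ae (μ := μ) ?_)
    filter_upwards [Lp.coeFn_smul c φ] with v hv
    rw [hv, Pi.smul_apply, smul_eq_mul]; ring
  · refine (norm_le_of_ae_norm_le (c := C * D * (NG * ‖φ‖)) hF ?_).trans (le_of_eq (by ring))
    filter_upwards [(hmem φ).coeFn_toLp] with u hu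
    simp only [LinearMap.coe_mk, AddHom.coe_mk]
    rw [hu]
    exact hbd φ u

theorem measurable_expQuot (ξ : Fin 3 → ℝ) : Measurable (Function.uncurry (expQuot ξ)) := by
  unfold Function.uncurry expQuot
  fun_prop

/-- The element `x` of `L²` is the function `u ↦ F₀(u) ∫ k(u, v) G₀(v) φ(v) d(v) dμ(v)`. -/
def IsKernelValue (μ : Measure ℂ) (F₀ G₀ d φ : ℂ → ℂ) (x : Lp ℂ 2 μ) (k : ℂ → ℂ → ℂ) : Prop :=
  (∀ u, Integrable (fun v => k u v * G₀ v * φ v * d v) μ) ∧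
    x =ᵐ[μ] fun u => F₀ u * ∫ v, k u v * G₀ v * φ v * d v ∂μ

namespace IsKernelValue

variable {φ : ℂ → ℂ} {x y : Lp ℂ 2 μ} {k l : ℂ → ℂ → ℂ}

theorem zero : IsKernelValue μ F₀ G₀ d φ 0 fun _ _ => 0 := by
  refine ⟨fun u => by simp, ?_⟩
  filter_upwards [Lp.coeFn_zero ℂ 2 μ] with u hu
  simp only [hu, Pi.zero_apply, zero_mul, integral_zero, mul_zero]

theorem add (hx : IsKernelValue μ F₀ G₀ d φ x k) (hy : IsKernelValue μ F₀ G₀ d φ y l) :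
    IsKernelValue μ F₀ G₀ d φ (x + y) fun u v => k u v + l u v := by
  refine ⟨fun u => ((hx.1 u).add (hy.1 u)).congr (Eventually.of_forall fun v => ?_), ?_⟩
  · simp only [Pi.add_apply]; ring
  filter_upwards [Lp.coeFn_add x y, hx.2, hy.2] with u h1 h2 h3
  rw [h1, Pi.add_apply, h2, h3, ← mul_add, ← integral_add (hx.1 u) (hy.1 u)]
  refine congrArg (F₀ u * ·) (integral_congr_ae (Eventually.of_forall fun v => ?_))
  ring

theorem const_smul (c : ℂ) (hx : IsKernelValue μ F₀ G₀ d φ x k) :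
    IsKernelValue μ F₀ G₀ d φ (c • x) fun u v => c * k u v := by
  refine ⟨fun u => ((hx.1 u).const_mul c).congr (Eventually.of_forall fun v => ?_), ?_⟩
  · ring
  filter_upwards [Lp.coeFn_smul c x, hx.2] with u h1 h2
  rw [h1, Pi.smul_apply, h2, smul_eq_mul, mul_left_comm, ← integral_const_mul]
  refine congrArg (F₀ u * ·) (integral_congr_ae (Eventually.of_forall fun v => ?_))
  ring

theorem sub (hx : IsKernelValue μ F₀ G₀ d φ x k) (hy : IsKernelValue μ F₀ G₀ d φ y l) :
    IsKernelValue μ F₀ G₀ d φ (x - y) fun u v => k u v - l u v := by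
  simpa [sub_eq_add_neg] using hx.add (hy.const_smul (-1))

theorem sum {ι : Type*} (s : Finset ι) {x : ι → Lp ℂ 2 μ} {k : ι → ℂ → ℂ → ℂ}
    (h : ∀ i, IsKernelValue μ F₀ G₀ d φ (x i) (k i)) :
    IsKernelValue μ F₀ G₀ d φ (∑ i ∈ s, x i) fun u v => ∑ i ∈ s, k i u v := by
  classical
  induction s using Finset.induction_on with
  | empty => simpa using zero
  | insert a s ha ih => simpa [Finset.sum_insert ha] using (h a).add ih

end IsKernelValue

/-- The operators with kernels `F₀(u) (exp (φ(u) - φ(v)) - 1) / (u - v) G₀(v)`. -/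
theorem exists_expQuotOperator [SFinite μ] (hd : AEStronglyMeasurable d μ)
    (hD : ∀ z, ‖d z‖ ≤ D) {B : Lp ℂ 2 μ →L[ℂ] Lp ℂ 2 μ →L[ℂ] ℂ}
    (hB : ∀ ψ φ : Lp ℂ 2 μ, B ψ φ = ∫ z, φ z * ψ z * d z ∂μ)
    (hF : MemLp (fun z => (expWeight δ z : ℂ) * F₀ z) 2 μ)
    (hG : MemLp (fun z => (expWeight δ z : ℂ) * G₀ z) 2 μ)
    (hFG : ∀ᵐ u ∂μ, F₀ u * G₀ u = 0) (hδ : δ' < δ) :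
    ∃ T : (Fin 3 → ℝ) → (Lp ℂ 2 μ →L[ℂ] Lp ℂ 2 μ),
      (∀ ξ, ‖ξ‖ ≤ δ' → ∀ φ : Lp ℂ 2 μ,
        T ξ φ =ᵐ[μ] fun u => F₀ u * ∫ v, expQuot ξ u v * G₀ v * φ v * d v ∂μ) ∧
      ∃ C : ℝ, ∀ ξ h : Fin 3 → ℝ, ‖ξ‖ ≤ δ' → ‖ξ + h‖ ≤ δ' →
        ‖T (ξ + h) - T ξ - ∑ n : Fin 3, (h n : ℂ) •
          ∑ x ∈ Finset.HasAntidiagonal.antidiagonal (n : ℕ),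
            (B (expFamily μ G₀ x.2 (-ξ))).smulRight (expFamily μ F₀ x.1 ξ)‖ ≤ C * ‖h‖ ^ 2 := by
  obtain ⟨C, hC, H⟩ := exists_norm_expQuot_le hδ
  have hT : ∀ ξ : Fin 3 → ℝ, ∃ T : Lp ℂ 2 μ →L[ℂ] Lp ℂ 2 μ, ‖ξ‖ ≤ δ' → ∀ φ : Lp ℂ 2 μ,
        T φ =ᵐ[μ] fun u => F₀ u * ∫ v, expQuot ξ u v * G₀ v * φ v * d v ∂μ := fun ξ => by
    -- Outside the ball the value of `T` is arbitrary.
    by_cases hξ : ‖ξ‖ ≤ δ'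
    · obtain ⟨T, hT⟩ := exists_kernelOperator hd hD hF hG (measurable_expQuot ξ) hC.le (H ξ hξ)
      exact ⟨T, fun _ => hT⟩
    · exact ⟨0, fun h => absurd h hξ⟩
  choose T hT using hT
  refine ⟨T, hT, ?_⟩
  obtain ⟨C₁, hC₁, H₁⟩ := exists_norm_expQuot_remainder_le hδ
  have hD0 : 0 ≤ D := (norm_nonneg _).trans (hD 0)
  set NG := (eLpNorm (fun z => (expWeight δ z : ℂ) * G₀ z) 2 μ).toReal with hNG
  set NF := (eLpNorm (fun z => (expWeight δ z : ℂ) * F₀ z) 2 μ).toReal with hNF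
  refine ⟨C₁ * D * NG * NF, fun ξ h hξ hξh => ?_⟩
  have hξn : ‖-ξ‖ ≤ δ' := by rwa [norm_neg]
  refine ContinuousLinearMap.opNorm_le_bound _ (by positivity) fun φ => ?_
  refine (norm_le_of_ae_norm_le (c := C₁ * ‖h‖ ^ 2 * D * (NG * ‖φ‖)) hF ?_).trans
    (le_of_eq (by ring))
  -- The exponential of `φ(u) - φ(v)` factors, so each monomial of `phaseQuot` times this
  -- exponential is a rank-one kernel.
  have hrank : ∀ x : ℕ × ℕ, IsKernelValue μ F₀ G₀ d φ
      ((B (expFamily μ G₀ x.2 (-ξ))).smulRight (expFamily μ F₀ x.1 ξ) φ)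
      fun u v => u ^ x.1 * v ^ x.2 * Complex.exp (phase ξ u - phase ξ v) := by
    intro x
    have hexp : ∀ u v, u ^ x.1 * v ^ x.2 * Complex.exp (phase ξ u - phase ξ v) =
        u ^ x.1 * Complex.exp (phase ξ u) * (v ^ x.2 * Complex.exp (phase (-ξ) v)) := by
      intro u v
      rw [phase_neg, sub_eq_add_neg, Complex.exp_add]
      ring
    simp only [hexp]
    constructor
    · intro u
      obtain ⟨C₂, -, H₂⟩ := exists_norm_pow_mul_exp_phase_le x.2 hδ
      refine integrable_kernel_mul hd hD hG
        (C := ‖u ^ x.1 * Complex.exp (phase ξ u)‖ * C₂) (by fun_prop) (fun v => ?_) φ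
      rw [norm_mul, mul_assoc]
      gcongr
      exact H₂ _ hξn v
    rw [ContinuousLinearMap.smulRight_apply, hB]
    have h1 : ∫ z, φ z * expFamily μ G₀ x.2 (-ξ) z * d z ∂μ =
        ∫ v, v ^ x.2 * Complex.exp (phase (-ξ) v) * G₀ v * φ v * d v ∂μ := by
      refine integral_congr_ae ?_
      filter_upwards [coeFn_expFamily hG hδ x.2 hξn] with v hv
      rw [hv]
      ring
    rw [h1]
    filter_upwards [Lp.coeFn_smul
      (∫ v, v ^ x.2 * Complex.exp (phase (-ξ) v) * G₀ v * φ v * d v ∂μ)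
      (expFamily μ F₀ x.1 ξ), coeFn_expFamily hF hδ x.1 hξ] with u h2 h3
    rw [h2, Pi.smul_apply, smul_eq_mul, h3, mul_comm, mul_comm _ (F₀ u), mul_assoc,
      ← integral_const_mul]
    refine congrArg (F₀ u * ·) (integral_congr_ae (Eventually.of_forall fun v => ?_))
    ring
  have hker : ∀ ξ : Fin 3 → ℝ, ‖ξ‖ ≤ δ' → IsKernelValue μ F₀ G₀ d φ (T ξ φ) (expQuot ξ) := by
    intro ξ hξ
    refine ⟨fun u => integrable_kernel_mul hd hD hG (C := C * expWeight δ u)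
      ((measurable_expQuot ξ).comp measurable_prodMk_left)
      (fun v => by rw [mul_assoc]; exact H ξ hξ u v) φ, hT ξ hξ φ⟩
  have hall := ((hker _ hξh).sub (hker _ hξ)).sub (IsKernelValue.sum Finset.univ
    fun n : Fin 3 => (IsKernelValue.sum (Finset.HasAntidiagonal.antidiagonal (n : ℕ))
      hrank).const_smul (h n : ℂ))
  filter_upwards [hall.2, hFG] with u hu hu0
  have hval : ((T (ξ + h) - T ξ - ∑ n : Fin 3, (h n : ℂ) •
      ∑ x ∈ Finset.HasAntidiagonal.antidiagonal (n : ℕ),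
        (B (expFamily μ G₀ x.2 (-ξ))).smulRight (expFamily μ F₀ x.1 ξ)) φ : Lp ℂ 2 μ) =
      T (ξ + h) φ - T ξ φ - ∑ n : Fin 3, (h n : ℂ) •
      ∑ x ∈ Finset.HasAntidiagonal.antidiagonal (n : ℕ),
        (B (expFamily μ G₀ x.2 (-ξ))).smulRight (expFamily μ F₀ x.1 ξ) φ := by
    simp only [sub_apply, sum_apply, FunLike.coe_smul, Pi.smul_apply]
  rw [hval, hu]
  have hquot : ∀ v, ∑ n : Fin 3, (h n : ℂ) * ∑ x ∈ Finset.HasAntidiagonal.antidiagonal (n : ℕ),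
      u ^ x.1 * v ^ x.2 * Complex.exp (phase ξ u - phase ξ v) =
      phaseQuot h u v * Complex.exp (phase ξ u - phase ξ v) := by
    intro v
    simp only [phaseQuot, Finset.sum_mul, Finset.mul_sum, mul_assoc]
  simp only [hquot]
  refine (norm_integral_kernel_mul_le (C := C₁ * ‖h‖ ^ 2 * ‖(expWeight δ u : ℂ) * F₀ u‖) hD hG
    (by positivity) (fun v => ?_) φ).trans (le_of_eq (by ring))
  -- The remainder estimate is not available on the diagonal, but there the factor `F₀ u * G₀ u`
  -- vanishes.
  rcases eq_or_ne u v with rfl | huv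
  · rw [mul_right_comm, hu0, zero_mul, norm_zero]
    positivity
  simp only [norm_mul, Complex.norm_real, Real.norm_of_nonneg (expWeight_pos δ _).le]
  calc _ ≤ ‖F₀ u‖ * (C₁ * ‖h‖ ^ 2 * (expWeight δ u * expWeight δ v)) * ‖G₀ v‖ := by
        gcongr
        exact H₁ ξ h hξ hξh u v huv
    _ = _ := by ring

end KernelOperator

end CubicIntegrable

/-! ### Measurability on contours and spectral sets. -/

namespace Contour

theorem measurableSet_dom (γ : Contour) : MeasurableSet γ.dom := by
  rcases γ.closed_or_unbounded with ⟨L, -, h, -⟩ | ⟨h, -⟩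
  · rw [h]; exact measurableSet_Ico
  · rw [h]; exact MeasurableSet.univ

/-- An injective continuous map on a Borel subset of the line is a measurable embedding
(Lusin–Souslin). -/
theorem measurableEmbedding_restrict (γ : Contour) :
    MeasurableEmbedding (γ.dom.domRestrict γ.path) :=
  ContinuousOn.measurableEmbedding γ.measurableSet_dom γ.lipschitz.continuous.continuousOn
    γ.simple

theorem measurableSet_trace (γ : Contour) : MeasurableSet γ.trace := by
  have := γ.measurableEmbedding_restrict.measurableSet_range
  rwa [Set.range_domRestrict] at this

/-- The choice made by `invFunOn` is not visibly measurable, whereas extension along a measurable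
embedding is. -/
theorem tangent_eq_extend (γ : Contour) :
    γ.tangent = Function.extend (γ.dom.domRestrict γ.path) (fun s => deriv γ.path s) 0 := by
  have hinj : Function.Injective (γ.dom.domRestrict γ.path) := Set.injOn_iff_injective.1 γ.simple
  ext z
  by_cases hz : z ∈ γ.trace
  · obtain ⟨s, hs, rfl⟩ := hz
    have h1 : Function.invFunOn γ.path γ.dom (γ.path s) = s :=
      γ.simple.leftInvOn_invFunOn hs
    have h2 : γ.path s ∈ γ.trace := Set.mem_image_of_mem _ hs
    rw [tangent, Set.indicator_of_mem h2, h1]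
    exact (hinj.extend_apply (fun s : γ.dom => deriv γ.path s) 0 ⟨s, hs⟩).symm
  · rw [tangent, Set.indicator_of_notMem hz, Function.extend_apply', Pi.zero_apply]
    rintro ⟨s, rfl⟩
    exact hz ⟨s, s.2, rfl⟩

theorem measurable_tangent (γ : Contour) : Measurable γ.tangent := by
  rw [tangent_eq_extend]
  exact γ.measurableEmbedding_restrict.measurable_extend
    ((measurable_deriv γ.path).comp measurable_subtype_coe) measurable_const

theorem norm_tangent_le (γ : Contour) (z : ℂ) : ‖γ.tangent z‖ ≤ 1 := by
  refine (norm_indicator_le_norm_self _ _).trans ?_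
  simpa using norm_deriv_le_of_lipschitz (x₀ := Function.invFunOn γ.path γ.dom z) γ.lipschitz

theorem ae_mem_trace (γ : Contour) : ∀ᵐ z ∂γ.arcLength, z ∈ γ.trace := by
  rw [arcLength]
  refine (ae_map_iff γ.lipschitz.continuous.aemeasurable γ.measurableSet_trace).2 ?_
  filter_upwards [ae_restrict_mem γ.measurableSet_dom] with s hs
  exact Set.mem_image_of_mem _ hs

end Contour

namespace SpectralSet

/-- The subspace is discrete and Lindelöf. -/
theorem countable_of_no_accPt {s : Set ℂ} (h : ∀ z : ℂ, ¬ AccPt z (𝓟 s)) : s.Countable := by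
  have : DiscreteTopology s := discreteTopology_of_noAccPts fun z _ => h z
  exact Set.countable_coe_iff.1 (countable_of_Lindelof_of_discrete (X := s))

theorem isClosed_of_no_accPt {s : Set ℂ} (h : ∀ z : ℂ, ¬ AccPt z (𝓟 s)) : IsClosed s :=
  isClosed_iff_accPt.2 fun z hz => absurd hz (h z)

/-- Required in `exists_kernelOperator` for the measurability of an integral as a function of the
outer variable. -/
instance sFinite_absMeasure (Ω : SpectralSet) : SFinite Ω.absMeasure := by
  cases Ω with
  | discrete s h =>
    have hs := countable_of_no_accPt h
    have := hs.to_subtype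
    show SFinite (Measure.count.restrict s)
    rw [← Set.iUnion_of_singleton_coe s, Measure.restrict_iUnion
      (fun x y hxy => Set.disjoint_singleton.2 (Subtype.coe_injective.ne hxy))
      fun x => measurableSet_singleton _]
    have : ∀ x : s, IsFiniteMeasure ((Measure.count : Measure ℂ).restrict {(x : ℂ)}) :=
      fun x => ⟨by simp⟩
    infer_instance
  | contours n γ h =>
    have : ∀ j, SFinite (γ j).arcLength := fun j => by unfold Contour.arcLength; infer_instance
    show SFinite (∑ j, (γ j).arcLength)
    rw [← Measure.sum_fintype]
    infer_instance

theorem ae_mem_carrier (Ω : SpectralSet) : ∀ᵐ z ∂Ω.absMeasure, z ∈ Ω.carrier := by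
  cases Ω with
  | discrete s h => exact ae_restrict_mem (isClosed_of_no_accPt h).measurableSet
  | contours n γ h =>
    have hm : MeasurableSet (⋃ j, (γ j).trace) :=
      MeasurableSet.iUnion fun j => (γ j).measurableSet_trace
    show ∀ᵐ z ∂(∑ j, (γ j).arcLength), z ∈ ⋃ j, (γ j).trace
    rw [← Measure.sum_fintype, Measure.ae_sum_iff]
    intro j
    filter_upwards [(γ j).ae_mem_trace] with z hz
    exact Set.mem_iUnion_of_mem j hz

theorem measurable_density (Ω : SpectralSet) : Measurable Ω.density := by
  cases Ω with
  | discrete s h => exact measurable_const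
  | contours n γ h => exact Finset.measurable_fun_sum _ fun j _ => (γ j).measurable_tangent

theorem exists_norm_density_le (Ω : SpectralSet) : ∃ D : ℝ, ∀ z, ‖Ω.density z‖ ≤ D := by
  cases Ω with
  | discrete s h => exact ⟨1, fun z => by simp [density]⟩
  | contours n γ h =>
    exact ⟨∑ j : Fin n, 1, fun z => norm_sum_le_of_le _ fun j _ => (γ j).norm_tangent_le z⟩

theorem toL2_eq_toLpTwo (Ω : SpectralSet) (φ : ℂ → ℂ) :
    Ω.toL2 φ = CubicIntegrable.toLpTwo Ω.absMeasure φ := rfl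

end SpectralSet

/-! ### Commutators with multiplication operators. -/

namespace CubicIntegrable

/-- Multiplication of an element of `L²` by a function (zero if the product is not in `L²`). -/
noncomputable def mulLp {μ : Measure ℂ} (η : ℂ → ℂ) (φ : Lp ℂ 2 μ) : Lp ℂ 2 μ :=
  toLpTwo μ fun u => η u * φ u

theorem coeFn_mulLp {μ : Measure ℂ} {η : ℂ → ℂ} (hη : AEStronglyMeasurable η μ) (φ : Lp ℂ 2 μ)
    {C : ℝ} (hC : ∀ᵐ u ∂μ, ‖η u * φ u‖ ≤ C * ‖φ u‖) :
    mulLp η φ =ᵐ[μ] fun u => η u * φ u :=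
  coeFn_toLpTwo ((Lp.memLp φ).of_le_mul (hη.mul (Lp.aestronglyMeasurable φ)) hC)

theorem coeFn_mulLp_of_bounded {μ : Measure ℂ} {η : ℂ → ℂ} (hη : Continuous η) {C : ℝ}
    (hC : ∀ u, ‖η u‖ ≤ C) (φ : Lp ℂ 2 μ) : mulLp η φ =ᵐ[μ] fun u => η u * φ u :=
  coeFn_mulLp (C := C) hη.aestronglyMeasurable φ (Eventually.of_forall fun u => by
    rw [norm_mul]; gcongr; exact hC u)

theorem coeFn_sum_smul {μ : Measure ℂ} {ι : Type*} (s : Finset ι) (c : ι → ℂ) {x : ι → Lp ℂ 2 μ}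
    {F : ι → ℂ → ℂ} (h : ∀ i, x i =ᵐ[μ] F i) :
    (∑ i ∈ s, c i • x i : Lp ℂ 2 μ) =ᵐ[μ] fun u => ∑ i ∈ s, c i * F i u := by
  classical
  induction s using Finset.induction_on with
  | empty =>
    simp only [Finset.sum_empty]
    exact Lp.coeFn_zero ℂ 2 μ
  | insert a s ha ih =>
    simp only [Finset.sum_insert ha]
    filter_upwards [ih, h a, Lp.coeFn_add (c a • x a) (∑ i ∈ s, c i • x i),
      Lp.coeFn_smul (c a) (x a)] with u h1 h2 h3 h4
    rw [h3, Pi.add_apply, h4, Pi.smul_apply, h1, h2, smul_eq_mul]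

section Commutator

variable {m : ℕ} {Ω : SpectralSet} {f g : ℂ → Fin (m + 1) → ℂ} {H : Ω.L2 →L[ℂ] Ω.L2}
  {η : ℂ → ℂ} {L D : ℝ}

theorem memLp_dotProduct (hg : ∀ i, MemLp (fun u => g u i) 2 Ω.absMeasure)
    (a : Fin (m + 1) → ℂ) : MemLp (fun v => a ⬝ᵥ g v) 2 Ω.absMeasure := by
  simp only [dotProduct]
  exact memLp_finsetSum _ fun i _ => (hg i).const_mul (a i)

theorem integrable_dotProduct_mul (hg : ∀ i, MemLp (fun u => g u i) 2 Ω.absMeasure)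
    (hD : ∀ z, ‖Ω.density z‖ ≤ D) (a : Fin (m + 1) → ℂ) {k : ℂ → ℂ} (hk : Measurable k) {C : ℝ}
    (hC : ∀ v, ‖k v‖ ≤ C) (φ : Ω.L2) :
    Integrable (fun v => (a ⬝ᵥ g v) * k v * φ v * Ω.density v) Ω.absMeasure := by
  refine (((integrable_mul_of_memLp_two (memLp_dotProduct hg a) (Lp.memLp φ)).mul_bdd
    (c := C) hk.aestronglyMeasurable (Eventually.of_forall hC)).mul_bdd
    (c := D) Ω.measurable_density.aestronglyMeasurable (Eventually.of_forall hD)).congr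
    (Eventually.of_forall fun v => ?_)
  ring

theorem norm_divided_difference_le (hL : 0 ≤ L) (hη : ∀ u v, ‖η u - η v‖ ≤ L * ‖u - v‖)
    (u v : ℂ) : ‖(η u - η v) / (u - v)‖ ≤ L := by
  rcases eq_or_ne u v with rfl | huv
  · simpa using hL
  · rw [norm_div, div_le_iff₀ (norm_pos_iff.2 (sub_ne_zero.2 huv))]
    exact hη u v

theorem continuous_of_norm_sub_le (hL : 0 ≤ L) (hη : ∀ u v, ‖η u - η v‖ ≤ L * ‖u - v‖) :
    Continuous η :=
  (LipschitzWith.of_dist_le_mul (K := L.toNNReal) fun u v => by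
    simpa [dist_eq_norm, hL] using hη u v).continuous

/-- The commutator of an integrable operator with the multiplication by a Lipschitz function. -/
theorem commutator_ae (hg : ∀ i, MemLp (fun u => g u i) 2 Ω.absMeasure)
    (hH : Ω.IsIntegralOperator (integrableKernel f g) H) (hL : 0 ≤ L)
    (hη : ∀ u v, ‖η u - η v‖ ≤ L * ‖u - v‖) {φ ψ : Ω.L2}
    (hψ : ψ =ᵐ[Ω.absMeasure] fun u => η u * φ u) :
    ∀ᵐ u ∂Ω.absMeasure, η u * H φ u - H ψ u =
      ∫ v, (f u ⬝ᵥ g v) * ((η u - η v) / (u - v)) * φ v * Ω.density v ∂Ω.absMeasure := by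
  obtain ⟨D, hD⟩ := Ω.exists_norm_density_le
  have hηc := continuous_of_norm_sub_le hL hη
  filter_upwards [hH φ, hH ψ] with u hu1 hu2
  -- The divided difference of a Lipschitz function is bounded, so the commutator kernel is
  -- absolutely integrable and its truncated integrals converge to an ordinary integral.
  have hX := integrable_dotProduct_mul hg hD (f u) (k := fun v => (η u - η v) / (u - v))
    (by have := hηc.measurable; fun_prop) (norm_divided_difference_le hL hη u) φ
  refine tendsto_nhds_unique ((hu1.2.const_mul (η u)).sub hu2.2) ?_
  refine (tendsto_setIntegral_norm_sub_gt hX (u := u) (by simp)).congr' ?_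
  filter_upwards [self_mem_nhdsWithin] with ε hε
  have hε' : 0 < ε := hε
  have hm : MeasurableSet {v : ℂ | ε < ‖u - v‖} := measurableSet_lt measurable_const (by fun_prop)
  have hint : ∀ χ : Ω.L2, IntegrableOn (fun v => integrableKernel f g u v * χ v)
      {v | ε < ‖u - v‖} Ω.absMeasure → IntegrableOn (fun v => integrableKernel f g u v * χ v *
        Ω.density v) {v | ε < ‖u - v‖} Ω.absMeasure := fun χ h =>
    h.mul_bdd (c := D) Ω.measurable_density.aestronglyMeasurable (Eventually.of_forall hD)
  rw [SpectralSet.integralOn, SpectralSet.integralOn, ← integral_const_mul,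
    ← integral_sub ((hint φ (hu1.1 ε hε')).const_mul _) (hint ψ (hu2.1 ε hε'))]
  refine setIntegral_congr_ae hm ?_
  filter_upwards [hψ] with v hv hvε
  have huv : u ≠ v := by
    rintro rfl
    replace hvε : ε < ‖u - u‖ := hvε
    rw [sub_self, norm_zero] at hvε
    linarith
  rw [hv, integrableKernel, if_neg huv]
  ring

theorem norm_integral_dotProduct_le (hg : ∀ i, MemLp (fun u => g u i) 2 Ω.absMeasure)
    (hD : ∀ z, ‖Ω.density z‖ ≤ D) (a : Fin (m + 1) → ℂ) {k : ℂ → ℂ} (hL : 0 ≤ L)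
    (hk : ∀ v, ‖k v‖ ≤ L) (φ : Ω.L2) :
    ‖∫ v, (a ⬝ᵥ g v) * k v * φ v * Ω.density v ∂Ω.absMeasure‖ ≤
      L * ∑ i, (D * ((eLpNorm (fun u => g u i) 2 Ω.absMeasure).toReal * ‖φ‖)) * ‖a i‖ := by
  have hD0 : 0 ≤ D := (norm_nonneg _).trans (hD 0)
  have hi : ∀ i, Integrable (fun v => ‖g v i‖ * ‖φ v‖) Ω.absMeasure := fun i =>
    (integrable_mul_of_memLp_two (hg i) (Lp.memLp φ)).norm.congr
      (Eventually.of_forall fun z => norm_mul _ _)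
  calc _ ≤ ∫ v, ∑ i, L * D * ‖a i‖ * (‖g v i‖ * ‖φ v‖) ∂Ω.absMeasure := by
        refine norm_integral_le_of_norm_le
          (integrable_finsetSum _ fun i _ => (hi i).const_mul _) (Eventually.of_forall fun v => ?_)
        have h1 : ‖a ⬝ᵥ g v‖ ≤ ∑ i, ‖a i‖ * ‖g v i‖ :=
          norm_sum_le_of_le _ fun i _ => (norm_mul _ _).le
        calc _ = ‖a ⬝ᵥ g v‖ * ‖k v‖ * ‖φ v‖ * ‖Ω.density v‖ := by simp only [norm_mul]
          _ ≤ (∑ i, ‖a i‖ * ‖g v i‖) * L * ‖φ v‖ * D := by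
              gcongr
              · exact hk v
              · exact hD v
          _ = _ := by
              simp only [Finset.sum_mul]
              exact Finset.sum_congr rfl fun i _ => by ring
    _ = ∑ i, L * D * ‖a i‖ * ∫ v, ‖g v i‖ * ‖φ v‖ ∂Ω.absMeasure := by
        rw [integral_finsetSum _ fun i _ => (hi i).const_mul _]
        exact Finset.sum_congr rfl fun i _ => integral_const_mul _ _
    _ ≤ ∑ i, L * D * ‖a i‖ * ((eLpNorm (fun u => g u i) 2 Ω.absMeasure).toReal * ‖φ‖) := by
        gcongr with i
        exact integral_norm_mul_norm_le (hg i) (Lp.memLp φ)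
    _ = _ := by
        rw [Finset.mul_sum]
        exact Finset.sum_congr rfl fun i _ => by ring

end Commutator

/-- The componentwise retraction of `ℂ` onto a square. -/
noncomputable def clamp (n : ℕ) (z : ℂ) : ℂ :=
  ⟨max (-n) (min n z.re), max (-n) (min n z.im)⟩

theorem norm_clamp_sub_le (n : ℕ) (u v : ℂ) : ‖clamp n u - clamp n v‖ ≤ 1 * ‖u - v‖ := by
  have h : ∀ x y : ℝ, (max (-(n : ℝ)) (min n x) - max (-(n : ℝ)) (min n y)) ^ 2 ≤
      (x - y) ^ 2 := by
    intro x y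
    rw [sq_le_sq, max_comm, max_comm (-(n : ℝ)), min_comm, min_comm (n : ℝ)]
    refine (abs_max_sub_max_le_abs _ _ _).trans ?_
    have := abs_min_sub_min_le_max x n y n
    simpa using this
  rw [one_mul, ← sq_le_sq₀ (norm_nonneg _) (norm_nonneg _), ← Complex.normSq_eq_norm_sq,
    ← Complex.normSq_eq_norm_sq, Complex.normSq_apply, Complex.normSq_apply]
  have h1 := h u.re v.re
  have h2 := h u.im v.im
  simp only [clamp, Complex.sub_re, Complex.sub_im]
  nlinarith

@[simp] theorem clamp_zero (n : ℕ) : clamp n 0 = 0 := by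
  apply Complex.ext <;> simp [clamp]

theorem norm_clamp_le (n : ℕ) (z : ℂ) : ‖clamp n z‖ ≤ ‖z‖ := by
  simpa using norm_clamp_sub_le n z 0

theorem norm_clamp_le_nat (n : ℕ) (z : ℂ) : ‖clamp n z‖ ≤ n + n := by
  have h : ∀ x : ℝ, |max (-(n : ℝ)) (min n x)| ≤ n := fun x =>
    abs_le.2 ⟨le_max_left _ _, max_le (by linarith [(Nat.cast_nonneg n : (0 : ℝ) ≤ n)])
      (min_le_left _ _)⟩
  exact (Complex.norm_le_abs_re_add_abs_im _).trans (add_le_add (h _) (h _))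

theorem clamp_of_norm_le {n : ℕ} {z : ℂ} (h : ‖z‖ ≤ n) : clamp n z = z := by
  have h1 := abs_le.1 ((Complex.abs_re_le_norm z).trans h)
  have h2 := abs_le.1 ((Complex.abs_im_le_norm z).trans h)
  apply Complex.ext <;> simp [clamp, h1, h2]

theorem eventually_clamp_eq (z : ℂ) : ∀ᶠ n : ℕ in atTop, clamp n z = z := by
  obtain ⟨N, hN⟩ := exists_nat_ge ‖z‖
  filter_upwards [eventually_ge_atTop N] with n hn
  exact clamp_of_norm_le (hN.trans (by exact_mod_cast hn))

theorem continuous_clamp (n : ℕ) : Continuous (clamp n) :=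
  continuous_of_norm_sub_le zero_le_one (norm_clamp_sub_le n)

/-- The functions are dominated by `ψ` itself, since `‖clamp n u‖ ≤ ‖u‖`. -/
theorem tendsto_mulLp_clamp {μ : Measure ℂ} {φ ψ : Lp ℂ 2 μ} (h : ψ =ᵐ[μ] fun u => u * φ u) :
    Tendsto (fun n => mulLp (clamp n) φ) atTop (𝓝 ψ) := by
  have hc : ∀ n, mulLp (clamp n) φ =ᵐ[μ] fun u => clamp n u * φ u := fun n =>
    coeFn_mulLp_of_bounded (continuous_clamp n) (norm_clamp_le_nat n) φ
  refine tendsto_Lp_two_of_dominated (Lp.memLp ψ).norm (fun n => ?_) ?_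
  · filter_upwards [hc n, h] with u h1 h2
    rw [h1, h2, norm_mul, norm_mul]
    gcongr
    exact norm_clamp_le n u
  · filter_upwards [ae_all_iff.2 hc, h] with u h1 h2
    refine tendsto_const_nhds.congr' ?_
    filter_upwards [eventually_clamp_eq u] with n hn
    rw [h1, h2, hn]

section Moments

variable {m : ℕ} {Ω : SpectralSet} {f g : ℂ → Fin (m + 1) → ℂ} {H : Ω.L2 →L[ℂ] Ω.L2}
  {B : Ω.L2 →L[ℂ] Ω.L2 →L[ℂ] ℂ}

/-- The commutator kernel is `f(u)ᵀ g(v)` times a divided difference of `clamp n`, which is bounded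
by `1` and eventually equal to `1` off the diagonal. Dominated convergence is applied in `v` and
then in `L²`. -/
theorem tendsto_commutator_clamp (hf : ∀ i, MemLp (fun u => f u i) 2 Ω.absMeasure)
    (hg : ∀ i, MemLp (fun u => g u i) 2 Ω.absMeasure)
    (hfg : ∀ᵐ u ∂Ω.absMeasure, f u ⬝ᵥ g u = 0)
    (hH : Ω.IsIntegralOperator (integrableKernel f g) H)
    (hB : ∀ ψ φ : Ω.L2, B ψ φ = ∫ z, φ z * ψ z * Ω.density z ∂Ω.absMeasure) (φ : Ω.L2) :
    Tendsto (fun n => mulLp (clamp n) (H φ) - H (mulLp (clamp n) φ)) atTop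
      (𝓝 (∑ l, B (Ω.toL2 fun u => g u l) φ • Ω.toL2 fun u => f u l)) := by
  obtain ⟨D, hD⟩ := Ω.exists_norm_density_le
  have hc : ∀ n (φ : Ω.L2), mulLp (clamp n) φ =ᵐ[Ω.absMeasure] fun u => clamp n u * φ u :=
    fun n φ => coeFn_mulLp_of_bounded (continuous_clamp n) (norm_clamp_le_nat n) φ
  have hcomm : ∀ n, ∀ᵐ u ∂Ω.absMeasure,
      (mulLp (clamp n) (H φ) - H (mulLp (clamp n) φ) : Ω.L2) u =
      ∫ v, (f u ⬝ᵥ g v) * ((clamp n u - clamp n v) / (u - v)) * φ v * Ω.density v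
        ∂Ω.absMeasure := fun n => by
    filter_upwards [commutator_ae hg hH zero_le_one (norm_clamp_sub_le n) (hc n φ), hc n (H φ),
      Lp.coeFn_sub (mulLp (clamp n) (H φ)) (H (mulLp (clamp n) φ))] with u h1 h2 h3
    rw [h3, Pi.sub_apply, h2, h1]
  have hlim : ∀ᵐ u ∂Ω.absMeasure,
      (∑ l, B (Ω.toL2 fun u => g u l) φ • Ω.toL2 fun u => f u l : Ω.L2) u =
      ∫ v, (f u ⬝ᵥ g v) * φ v * Ω.density v ∂Ω.absMeasure := by
    filter_upwards [coeFn_sum_smul Finset.univ (fun l => B (Ω.toL2 fun u => g u l) φ)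
      fun l => coeFn_toLpTwo (hf l)] with u h1
    refine h1.trans ?_
    have h2 : ∀ l, B (Ω.toL2 fun u => g u l) φ * f u l =
        ∫ v, f u l * (g v l * φ v * Ω.density v) ∂Ω.absMeasure := fun l => by
      rw [hB, integral_const_mul, mul_comm]
      congr 1
      refine integral_congr_ae ?_
      filter_upwards [coeFn_toLpTwo (hg l)] with v hv
      rw [SpectralSet.toL2_eq_toLpTwo, hv]
      ring
    simp only [h2]
    rw [← integral_finsetSum]
    · simp only [dotProduct, Finset.sum_mul, mul_assoc]
    · exact fun l _ => ((integrable_mul_of_memLp_two (hg l) (Lp.memLp φ)).mul_bdd (c := D)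
        Ω.measurable_density.aestronglyMeasurable (Eventually.of_forall hD)).const_mul _
  refine tendsto_Lp_two_of_dominated (a := fun u => 1 * ∑ i, (D *
    ((eLpNorm (fun u => g u i) 2 Ω.absMeasure).toReal * ‖φ‖)) * ‖f u i‖) ?_ (fun n => ?_) ?_
  · exact (memLp_finsetSum _ fun i _ => (hf i).norm.const_mul _).const_mul 1
  · filter_upwards [hcomm n] with u h1
    rw [h1]
    exact norm_integral_dotProduct_le hg hD (f u) zero_le_one
      (norm_divided_difference_le zero_le_one (norm_clamp_sub_le n) u) φ
  · filter_upwards [ae_all_iff.2 hcomm, hlim, hfg] with u h1 h2 h3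
    simp only [h1, h2]
    refine tendsto_integral_of_dominated_convergence
      (fun v => ‖(f u ⬝ᵥ g v) * 1 * φ v * Ω.density v‖) (fun n => ?_) ?_ (fun n => ?_) ?_
    · exact (integrable_dotProduct_mul hg hD (f u) (k := fun v => (clamp n u - clamp n v) / (u - v))
        (by have := (continuous_clamp n).measurable; fun_prop)
        (norm_divided_difference_le zero_le_one (norm_clamp_sub_le n) u) φ).aestronglyMeasurable
    · exact (integrable_dotProduct_mul hg hD (f u) (k := fun v => 1) measurable_const
        (C := 1) (fun v => by simp) φ).norm
    · refine Eventually.of_forall fun v => ?_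
      simp only [norm_mul, norm_one]
      gcongr
      exact norm_divided_difference_le zero_le_one (norm_clamp_sub_le n) u v
    · refine Eventually.of_forall fun v => ?_
      rcases eq_or_ne u v with rfl | huv
      -- On the diagonal the divided difference is `0` instead of `1`; orthogonality of `f u` and `g
      -- u` makes this irrelevant.
      · simp [h3]
      · refine tendsto_const_nhds.congr' ?_
        filter_upwards [eventually_clamp_eq u, eventually_clamp_eq v] with n hn1 hn2
        rw [hn1, hn2, div_self (sub_ne_zero.2 huv), mul_one]

/-- The commutation relation between the resolvent of an integrable operator and the
multiplication by the variable. -/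
theorem moment_commute (hf : ∀ i, MemLp (fun u => f u i) 2 Ω.absMeasure)
    (hg : ∀ i, MemLp (fun u => g u i) 2 Ω.absMeasure)
    (hfg : ∀ᵐ u ∂Ω.absMeasure, f u ⬝ᵥ g u = 0)
    (hH : Ω.IsIntegralOperator (integrableKernel f g) H)
    (hB : ∀ ψ φ : Ω.L2, B ψ φ = ∫ z, φ z * ψ z * Ω.density z ∂Ω.absMeasure)
    (hu : IsUnit (1 - H)) {v v₁ γ γ₁ : Ω.L2}
    (hv : v₁ =ᵐ[Ω.absMeasure] fun u => u * v u) (hγ : γ₁ =ᵐ[Ω.absMeasure] fun u => u * γ u) :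
    B γ₁ (Ring.inverse (1 - H) v) = B γ (Ring.inverse (1 - H) v₁) +
      ∑ l, B γ (Ring.inverse (1 - H) (Ω.toL2 fun u => f u l)) *
        B (Ω.toL2 fun u => g u l) (Ring.inverse (1 - H) v) := by
  have hc : ∀ n (φ : Ω.L2), mulLp (clamp n) φ =ᵐ[Ω.absMeasure] fun u => clamp n u * φ u :=
    fun n φ => coeFn_mulLp_of_bounded (continuous_clamp n) (norm_clamp_le_nat n) φ
  set R := Ring.inverse (1 - H) with hR
  have hR1 : ∀ x, R ((1 - H) x) = x := fun x => by
    have := Ring.inverse_mul_cancel _ hu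
    exact congrArg (fun T : Ω.L2 →L[ℂ] Ω.L2 => T x) this
  have hR2 : ∀ x, (1 - H) (R x) = x := fun x => by
    have := Ring.mul_inverse_cancel _ hu
    exact congrArg (fun T : Ω.L2 →L[ℂ] Ω.L2 => T x) this
  -- This is `η R v = R (η v + [η, H] R v)`, obtained by multiplying `R v = v + H (R v)` by `η =
  -- clamp n`.
  have hx : ∀ n, mulLp (clamp n) (R v) = R (mulLp (clamp n) v +
      (mulLp (clamp n) (H (R v)) - H (mulLp (clamp n) (R v)))) := fun n => by
    rw [← hR1 (mulLp (clamp n) (R v))]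
    congr 1
    rw [hR1]
    have h1 : mulLp (clamp n) (R v) = mulLp (clamp n) v + mulLp (clamp n) (H (R v)) := by
      refine Lp.ext ?_
      have h2 : R v = v + H (R v) := by
        have := hR2 v
        rw [sub_apply, one_apply_eq_self, sub_eq_iff_eq_add] at this
        exact this
      filter_upwards [hc n (R v), hc n v, hc n (H (R v)), Lp.coeFn_add v (H (R v)),
        Lp.coeFn_add (mulLp (clamp n) v) (mulLp (clamp n) (H (R v)))] with u e1 e2 e3 e4 e5
      rw [e1, e5, Pi.add_apply, e2, e3, ← mul_add, ← Pi.add_apply, ← e4, ← h2]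
    rw [sub_apply, one_apply_eq_self]
    nth_rewrite 1 [h1]
    abel
  -- The product of the variable with `R v` need not be square integrable, so the factor is moved to
  -- `γ` before the limit.
  have hlim1 : Tendsto (fun n => B γ (mulLp (clamp n) (R v))) atTop (𝓝 (B γ₁ (R v))) := by
    have h1 : ∀ n, B γ (mulLp (clamp n) (R v)) = B (mulLp (clamp n) γ) (R v) := fun n => by
      rw [hB, hB]
      refine integral_congr_ae ?_
      filter_upwards [hc n (R v), hc n γ] with u e1 e2
      rw [e1, e2]
      ring
    simp only [h1]
    exact (((ContinuousLinearMap.apply ℂ ℂ (R v)).continuous.comp B.continuous).tendsto γ₁).comp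
      (tendsto_mulLp_clamp hγ)
  have hlim2 : Tendsto (fun n => B γ (mulLp (clamp n) (R v))) atTop (𝓝 (B γ (R (v₁ +
      ∑ l, B (Ω.toL2 fun u => g u l) (R v) • Ω.toL2 fun u => f u l)))) := by
    simp only [fun n => congrArg (B γ) (hx n)]
    exact (((B γ).continuous.comp R.continuous).tendsto _).comp
      ((tendsto_mulLp_clamp hv).add (tendsto_commutator_clamp hf hg hfg hH hB (R v)))
  rw [tendsto_nhds_unique hlim1 hlim2]
  simp [mul_comm]

end Moments

/-! ### Invariance of the moments under conjugation by a locally bounded function. -/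

/-- A Lipschitz cut-off function supported in the ball of radius `n + 1`. -/
noncomputable def cutoff (n : ℕ) (z : ℂ) : ℂ := (max 0 (1 - ‖z‖ / (n + 1)) : ℝ)

theorem norm_cutoff_sub_le (n : ℕ) (u v : ℂ) :
    ‖cutoff n u - cutoff n v‖ ≤ 1 / (n + 1 : ℝ) * ‖u - v‖ := by
  have hn : (0 : ℝ) < n + 1 := by positivity
  rw [cutoff, cutoff, ← Complex.ofReal_sub, Complex.norm_real, Real.norm_eq_abs, max_comm,
    max_comm (0 : ℝ)]
  refine (abs_max_sub_max_le_abs _ _ _).trans ?_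
  have : 1 - ‖u‖ / (n + 1) - (1 - ‖v‖ / (n + 1)) = 1 / (n + 1 : ℝ) * (‖v‖ - ‖u‖) := by ring
  rw [this, abs_mul, abs_of_pos (by positivity), norm_sub_rev u v]
  gcongr
  exact abs_norm_sub_norm_le v u

theorem norm_cutoff_le_one (n : ℕ) (z : ℂ) : ‖cutoff n z‖ ≤ 1 := by
  rw [cutoff, Complex.norm_real, Real.norm_of_nonneg (le_max_left _ _)]
  refine max_le zero_le_one ?_
  have : 0 ≤ ‖z‖ / (n + 1 : ℝ) := by positivity
  linarith

theorem cutoff_of_lt_norm {n : ℕ} {z : ℂ} (h : (n + 1 : ℝ) < ‖z‖) : cutoff n z = 0 := by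
  have hn : (0 : ℝ) < n + 1 := by positivity
  rw [cutoff, max_eq_left, Complex.ofReal_zero]
  have : 1 ≤ ‖z‖ / (n + 1 : ℝ) := (one_le_div hn).2 h.le
  linarith

theorem continuous_cutoff (n : ℕ) : Continuous (cutoff n) :=
  continuous_of_norm_sub_le (by positivity) (norm_cutoff_sub_le n)

theorem tendsto_cutoff (z : ℂ) : Tendsto (fun n => cutoff n z) atTop (𝓝 1) := by
  have h1 : Tendsto (fun n : ℕ => ‖z‖ / ((n : ℝ) + 1)) atTop (𝓝 0) := by
    have := (tendsto_one_div_add_atTop_nhds_zero_nat (𝕜 := ℝ)).const_mul ‖z‖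
    simpa [div_eq_mul_inv] using this
  have h2 : Tendsto (fun n : ℕ => max (0 : ℝ) (1 - ‖z‖ / ((n : ℝ) + 1))) atTop (𝓝 1) := by
    have := (tendsto_const_nhds (x := (0 : ℝ))).max (h1.const_sub 1)
    simpa using this
  rw [← Complex.ofReal_one]
  exact (Complex.continuous_ofReal.tendsto 1).comp h2

section Gauge

variable {m : ℕ} {Ω : SpectralSet} {f g f' g' : ℂ → Fin (m + 1) → ℂ} {H H' : Ω.L2 →L[ℂ] Ω.L2}
  {ρ : ℂ → ℂ} {B : Ω.L2 →L[ℂ] Ω.L2 →L[ℂ] ℂ}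

/-- The resolvents of integrable operators which are conjugate by a locally bounded function `ρ`
have the same moments. -/
theorem moment_gauge_invariant (hf : ∀ i, MemLp (fun u => f u i) 2 Ω.absMeasure)
    (hg : ∀ i, MemLp (fun u => g u i) 2 Ω.absMeasure)
    (hf' : ∀ i, MemLp (fun u => f' u i) 2 Ω.absMeasure)
    (hg' : ∀ i, MemLp (fun u => g' u i) 2 Ω.absMeasure)
    (hH : Ω.IsIntegralOperator (integrableKernel f g) H)
    (hH' : Ω.IsIntegralOperator (integrableKernel f' g') H')
    (hB : ∀ ψ φ : Ω.L2, B ψ φ = ∫ z, φ z * ψ z * Ω.density z ∂Ω.absMeasure)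
    (hu : IsUnit (1 - H)) (hu' : IsUnit (1 - H'))
    (hρ : AEStronglyMeasurable ρ Ω.absMeasure)
    (hρb : ∀ R : ℝ, ∃ C : ℝ, ∀ᵐ u ∂Ω.absMeasure, ‖u‖ ≤ R → ‖ρ u‖ ≤ C)
    (hff : ∀ᵐ u ∂Ω.absMeasure, ∀ i, f' u i = ρ u * f u i)
    (hgg : ∀ᵐ u ∂Ω.absMeasure, ∀ i, g u i = ρ u * g' u i) (i j : Fin (m + 1)) :
    B (Ω.toL2 fun u => g' u j) (Ring.inverse (1 - H') (Ω.toL2 fun u => f' u i)) =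
      B (Ω.toL2 fun u => g u j) (Ring.inverse (1 - H) (Ω.toL2 fun u => f u i)) := by
  obtain ⟨D, hD⟩ := Ω.exists_norm_density_le
  set h := Ring.inverse (1 - H) (Ω.toL2 fun u => f u i) with hh
  have hR : (1 - H) h = Ω.toL2 fun u => f u i :=
    congrArg (fun T : Ω.L2 →L[ℂ] Ω.L2 => T (Ω.toL2 fun u => f u i)) (Ring.mul_inverse_cancel _ hu)
  have hR' : ∀ x, Ring.inverse (1 - H') ((1 - H') x) = x := fun x =>
    congrArg (fun T : Ω.L2 →L[ℂ] Ω.L2 => T x) (Ring.inverse_mul_cancel _ hu')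
  set s : ℕ → Ω.L2 := fun n => mulLp (cutoff n) h with hs
  -- Formally `(1 - H')⁻¹ f' = ρ h`, but `ρ h` is not known to be in `L²`; the cut-off makes `y n`
  -- square integrable.
  set y : ℕ → Ω.L2 := fun n => mulLp (fun u => ρ u * cutoff n u) h with hy
  have hsc : ∀ n, s n =ᵐ[Ω.absMeasure] fun u => cutoff n u * h u := fun n =>
    coeFn_mulLp_of_bounded (continuous_cutoff n) (norm_cutoff_le_one n) h
  have hyc : ∀ n, y n =ᵐ[Ω.absMeasure] fun u => ρ u * cutoff n u * h u := fun n => by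
    obtain ⟨C, hC⟩ := hρb (n + 1)
    refine coeFn_mulLp (η := fun u => ρ u * cutoff n u) (C := max C 0)
      (hρ.mul (continuous_cutoff n).aestronglyMeasurable) h ?_
    filter_upwards [hC] with u hCu
    rw [norm_mul, norm_mul]
    gcongr
    rcases le_or_gt ‖u‖ (n + 1 : ℝ) with h1 | h1
    · calc ‖ρ u‖ * ‖cutoff n u‖ ≤ ‖ρ u‖ * 1 := by gcongr; exact norm_cutoff_le_one n u
        _ ≤ max C 0 := by rw [mul_one]; exact (hCu h1).trans (le_max_left _ _)
    · rw [cutoff_of_lt_norm h1, norm_zero, mul_zero]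
      exact le_max_right _ _
  -- Only `f'(u)ᵀ g'(v) ρ(v) = ρ(u) f(u)ᵀ g(v)` is used, so `ρ` is never inverted.
  have hHy : ∀ n, ∀ᵐ u ∂Ω.absMeasure, H' (y n) u = ρ u * H (s n) u := fun n => by
    filter_upwards [hH' (y n), hH (s n), hff] with u h1 h2 h3
    refine tendsto_nhds_unique h1.2 ((h2.2.const_mul (ρ u)).congr fun ε => ?_)
    rw [SpectralSet.integralOn, SpectralSet.integralOn, ← integral_const_mul]
    refine setIntegral_congr_ae (measurableSet_lt measurable_const (by fun_prop)) ?_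
    filter_upwards [hyc n, hsc n, hgg] with v h4 h5 h6 _
    rw [h4, h5, integrableKernel, integrableKernel]
    split_ifs with huv
    · simp
    · have h7 : ρ v * (f' u ⬝ᵥ g' v) = ρ u * (f u ⬝ᵥ g v) := by
        simp only [dotProduct, Finset.mul_sum]
        refine Finset.sum_congr rfl fun l _ => ?_
        rw [h3, h6]
        ring
      linear_combination (-1 / (u - v) * cutoff n v * h v * Ω.density v) * h7
  have hlim : Tendsto (fun n => (1 - H') (y n)) atTop (𝓝 (Ω.toL2 fun u => f' u i)) := by
    -- With `χ = cutoff n` this reads `(1 - H') y_n = χ f' + ρ [χ, H] h`.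
    have hval : ∀ n, ∀ᵐ u ∂Ω.absMeasure, ((1 - H') (y n) : Ω.L2) u = cutoff n u * f' u i +
        ρ u * ∫ v, (f u ⬝ᵥ g v) * ((cutoff n u - cutoff n v) / (u - v)) * h v * Ω.density v
          ∂Ω.absMeasure := fun n => by
      have hRc : ((1 - H) h : Ω.L2) =ᵐ[Ω.absMeasure] fun u => f u i := by
        rw [hR]; exact coeFn_toLpTwo (hf i)
      filter_upwards [hHy n, hyc n, Lp.coeFn_sub (y n) (H' (y n)), Lp.coeFn_sub h (H h), hRc,
        commutator_ae hg hH (by positivity) (norm_cutoff_sub_le n) (hsc n), hff]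
        with u h1 h2 h3 h4 h5 h6 h7
      rw [sub_apply, one_apply_eq_self] at h5 ⊢
      rw [h3, Pi.sub_apply, h1, h2, ← h6, h7, ← h5, h4, Pi.sub_apply]
      ring
    -- The commutator is at most `1 / (n + 1)` times a combination of the `‖f_l‖`, and `ρ` turns
    -- `f_l` into `f'_l`, which is in `L²` however fast `ρ` grows.
    have hbound : ∀ n, ∀ᵐ u ∂Ω.absMeasure,
        ‖ρ u * ∫ v, (f u ⬝ᵥ g v) * ((cutoff n u - cutoff n v) / (u - v)) * h v * Ω.density v
          ∂Ω.absMeasure‖ ≤ 1 / (n + 1 : ℝ) * ∑ l, (D *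
          ((eLpNorm (fun u => g u l) 2 Ω.absMeasure).toReal * ‖h‖)) * ‖f' u l‖ := fun n => by
      filter_upwards [hff] with u h1
      rw [norm_mul]
      refine (mul_le_mul_of_nonneg_left (norm_integral_dotProduct_le hg hD (f u) (by positivity)
        (norm_divided_difference_le (by positivity) (norm_cutoff_sub_le n) u) h)
        (norm_nonneg _)).trans (le_of_eq ?_)
      rw [mul_left_comm, Finset.mul_sum]
      congr 1
      refine Finset.sum_congr rfl fun l _ => ?_
      rw [h1, norm_mul]
      ring
    have hD0 : 0 ≤ D := (norm_nonneg _).trans (hD 0)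
    refine tendsto_Lp_two_of_dominated (a := fun u => ‖f' u i‖ + ∑ l, (D *
          ((eLpNorm (fun u => g u l) 2 Ω.absMeasure).toReal * ‖h‖)) * ‖f' u l‖) ?_ (fun n => ?_) ?_
    · exact (hf' i).norm.add (memLp_finsetSum _ fun l _ => (hf' l).norm.const_mul _)
    · filter_upwards [hval n, hbound n] with u h1 h2
      rw [h1]
      refine (norm_add_le _ _).trans (add_le_add ?_ (h2.trans ?_))
      · rw [norm_mul]
        exact mul_le_of_le_one_left (norm_nonneg _) (norm_cutoff_le_one n u)
      · refine mul_le_of_le_one_left (by positivity) ?_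
        rw [div_le_one (by positivity)]
        linarith [(Nat.cast_nonneg n : (0 : ℝ) ≤ n)]
    · filter_upwards [ae_all_iff.2 hval, ae_all_iff.2 hbound, coeFn_toLpTwo (hf' i)]
        with u h1 h2 h3
      simp only [h1]
      rw [SpectralSet.toL2_eq_toLpTwo, h3]
      have h4 := squeeze_zero_norm h2 (by
        simpa using (tendsto_one_div_add_atTop_nhds_zero_nat (𝕜 := ℝ)).mul_const _)
      simpa using ((tendsto_cutoff u).mul_const (f' u i)).add h4
  have hylim : Tendsto y atTop (𝓝 (Ring.inverse (1 - H') (Ω.toL2 fun u => f' u i))) := by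
    simpa only [Function.comp_def, hR'] using
      ((Ring.inverse (1 - H')).continuous.tendsto _).comp hlim
  have hslim : Tendsto s atTop (𝓝 h) := by
    refine tendsto_Lp_two_of_dominated (Lp.memLp h).norm (fun n => ?_) ?_
    · filter_upwards [hsc n] with u h1
      rw [h1, norm_mul]
      exact mul_le_of_le_one_left (norm_nonneg _) (norm_cutoff_le_one n u)
    · filter_upwards [ae_all_iff.2 hsc] with u h1
      simp only [h1]
      simpa using (tendsto_cutoff u).mul_const (h u)
  -- Since `g'_j y_n = g_j s_n` almost everywhere, the two pairings agree for each `n`.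
  refine tendsto_nhds_unique
    (((B (Ω.toL2 fun u => g' u j)).continuous.tendsto _).comp hylim)
    ((((B (Ω.toL2 fun u => g u j)).continuous.tendsto _).comp hslim).congr fun n => ?_)
  simp only [Function.comp_def]
  rw [hB, hB]
  refine integral_congr_ae ?_
  filter_upwards [hsc n, hyc n, hgg, coeFn_toLpTwo (hg j), coeFn_toLpTwo (hg' j)]
    with u h1 h2 h3 h4 h5
  rw [SpectralSet.toL2_eq_toLpTwo, SpectralSet.toL2_eq_toLpTwo, h4, h5, h1, h2, h3]
  ring

end Gauge

/-! ### From phases to the parameters. -/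

/-- The coordinates with index `i` of the parameters. -/
noncomputable def coords {m : ℕ} (i : Fin (m + 1)) (w : Params m) : Fin 3 → ℝ :=
  fun n => coord n i w

section Coords

variable {m : ℕ}

@[simp] theorem coords_last (w : Params m) : coords (Fin.last m) w = 0 := by
  ext n; simp [coords]

@[simp] theorem coords_zero (i : Fin (m + 1)) : coords i (0 : Params m) = 0 := by
  ext n; simp [coords]

theorem coords_add (i : Fin (m + 1)) (w w' : Params m) :
    coords i (w + w') = coords i w + coords i w' := by
  ext n; simp [coords]

theorem norm_coords_le (i : Fin (m + 1)) (w : Params m) : ‖coords i w‖ ≤ ‖w‖ :=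
  (pi_norm_le_iff_of_nonneg (norm_nonneg w)).2 fun n => norm_coord_le n i w

theorem Delta_eq_diagonal (w : Params m) (u : ℂ) :
    Delta w u = Matrix.diagonal fun i => Complex.exp (phase (coords i w) u) := by
  rw [Delta]
  congr 1
  ext i
  induction i using Fin.lastCases with
  | last => simp
  | cast k =>
    rw [Fin.snoc_castSucc, cubicExp]
    congr 1
    simp [phase, coords, Fin.sum_univ_three]
    ring

theorem fVec_apply (F : ℂ → Fin (m + 1) → ℂ) (c : ℂ → ℂ) (w : Params m) (u : ℂ)
    (i : Fin (m + 1)) :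
    fVec F c w u i = c u * (Complex.exp (phase (coords i w) u) * F u i) := by
  rw [fVec, Delta_eq_diagonal, Pi.smul_apply, Matrix.mulVec_diagonal, smul_eq_mul]

theorem gVec_apply (G : ℂ → Fin (m + 1) → ℂ) (c : ℂ → ℂ) (w : Params m) (u : ℂ)
    (i : Fin (m + 1)) :
    gVec G c w u i = (c u)⁻¹ * (Complex.exp (phase (coords i (-w)) u) * G u i) := by
  have h : (Delta w u)⁻¹ = Matrix.diagonal fun i => Complex.exp (phase (coords i (-w)) u) := by
    refine Matrix.inv_eq_right_inv ?_
    rw [Delta_eq_diagonal, Matrix.diagonal_mul_diagonal, ← Matrix.diagonal_one]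
    congr 1
    ext i
    rw [← Complex.exp_add, ← phase_add, ← coords_add]
    simp
  rw [gVec, h, Pi.smul_apply, Matrix.mulVec_diagonal, smul_eq_mul]

theorem fVec_add (F : ℂ → Fin (m + 1) → ℂ) (c : ℂ → ℂ) (w w' : Params m) (u : ℂ)
    (i : Fin (m + 1)) :
    fVec F c (w + w') u i = Complex.exp (phase (coords i w') u) * fVec F c w u i := by
  rw [fVec_apply, fVec_apply, coords_add, phase_add, Complex.exp_add]
  ring

theorem gVec_add (G : ℂ → Fin (m + 1) → ℂ) (c : ℂ → ℂ) (w w' : Params m) (u : ℂ)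
    (i : Fin (m + 1)) :
    gVec G c (w + w') u i = Complex.exp (phase (-coords i w') u) * gVec G c w u i := by
  have : coords i (-(w + w')) = coords i (-w) + -coords i w' := by
    ext n; simp [coords, add_comm]
  rw [gVec_apply, gVec_apply, this, phase_add, Complex.exp_add]
  ring

/-- The parameters all of whose coordinates are `±δ`. -/
noncomputable def corner (m : ℕ) (δ : ℝ) (σ : Fin 3 → ℤˣ) : Params m :=
  (fun _ => δ * ((σ 0 : ℤ) : ℝ), fun _ => δ * ((σ 1 : ℤ) : ℝ), fun _ => δ * ((σ 2 : ℤ) : ℝ))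

theorem coords_corner (k : Fin m) (δ : ℝ) (σ : Fin 3 → ℤˣ) :
    coords k.castSucc (corner m δ σ) = fun n => δ * ((σ n : ℤ) : ℝ) := by
  ext n; fin_cases n <;> simp [coords, corner]

theorem norm_corner_le {δ : ℝ} (hδ : 0 ≤ δ) (σ : Fin 3 → ℤˣ) : ‖corner m δ σ‖ ≤ δ := by
  have h : ∀ n, ‖(fun _ : Fin m => δ * ((σ n : ℤ) : ℝ))‖ ≤ δ := fun n => by
    refine (pi_norm_le_iff_of_nonneg hδ).2 fun _ => ?_
    rw [norm_mul, Real.norm_of_nonneg hδ]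
    rcases Int.units_eq_one_or (σ n) with h | h <;> simp [h]
  exact max_le (h 0) (max_le (h 1) (h 2))

end Coords

theorem memLp_expWeight_mul {μ : Measure ℂ} {δ : ℝ} {F₀ : ℂ → ℂ} (h₀ : AEStronglyMeasurable F₀ μ)
    (h : ∀ σ : Fin 3 → ℤˣ,
      MemLp (fun z => Complex.exp (phase (fun n => δ * ((σ n : ℤ) : ℝ)) z) * F₀ z) 2 μ) :
    MemLp (fun z => (expWeight δ z : ℂ) * F₀ z) 2 μ := by
  have hs : MemLp (fun z => ∑ σ : Fin 3 → ℤˣ,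
      ‖Complex.exp (phase (fun n => δ * ((σ n : ℤ) : ℝ)) z) * F₀ z‖) 2 μ :=
    memLp_finsetSum _ fun σ _ => (h σ).norm
  refine hs.of_le ?_ (Eventually.of_forall fun z => ?_)
  · exact (by fun_prop : Measurable fun z => (expWeight δ z : ℂ)).aestronglyMeasurable.mul h₀
  · rw [norm_mul, Complex.norm_real, Real.norm_of_nonneg (expWeight_pos δ z).le,
      Real.norm_of_nonneg (by positivity)]
    simp only [norm_mul, ← Finset.sum_mul]
    gcongr
    exact expWeight_le_sum δ z

/-- A quadratic remainder on the ball gives differentiability there, and `coords i` is linear with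
norm at most one. -/
theorem hasFDerivAt_comp_coords {X : Type*} [NormedAddCommGroup X] [NormedSpace ℂ X]
    [NormedSpace ℝ X] [IsScalarTower ℝ ℂ X] {m : ℕ} {Φ : (Fin 3 → ℝ) → X}
    {y : Fin 3 → (Fin 3 → ℝ) → X} {δ : ℝ}
    (hΦ : ∃ C : ℝ, ∀ ξ h : Fin 3 → ℝ, ‖ξ‖ ≤ δ → ‖ξ + h‖ ≤ δ →
      ‖Φ (ξ + h) - Φ ξ - ∑ n : Fin 3, (h n : ℂ) • y n ξ‖ ≤ C * ‖h‖ ^ 2)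
    (i : Fin (m + 1)) {w₀ w : Params m} (hw : w ∈ Metric.ball w₀ δ) :
    HasFDerivAt (fun w => Φ (coords i (w - w₀)))
      (∑ n : Fin 3, (coord n i).smulRight (y n (coords i (w - w₀)))) w := by
  obtain ⟨C, hC⟩ := hΦ
  rw [hasFDerivAt_iff_isLittleO]
  have hO : (fun w' => Φ (coords i (w' - w₀)) - Φ (coords i (w - w₀)) -
      (∑ n : Fin 3, (coord n i).smulRight (y n (coords i (w - w₀)))) (w' - w)) =O[𝓝 w]
      fun w' => ‖w' - w‖ ^ 2 := by
    refine Asymptotics.IsBigO.of_bound |C| ?_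
    filter_upwards [Metric.isOpen_ball.mem_nhds hw] with w' hw'
    rw [mem_ball_iff_norm] at hw hw'
    have h1 : coords i (w' - w₀) = coords i (w - w₀) + coords i (w' - w) := by
      rw [← coords_add]
      congr 1
      abel
    have h2 := hC (coords i (w - w₀)) (coords i (w' - w))
      ((norm_coords_le _ _).trans hw.le) (by
        rw [← h1]; exact (norm_coords_le _ _).trans hw'.le)
    have h3 : (∑ n : Fin 3, (coord n i).smulRight (y n (coords i (w - w₀)))) (w' - w) =
        ∑ n : Fin 3, (coords i (w' - w) n : ℂ) • y n (coords i (w - w₀)) := by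
      rw [sum_apply]
      refine Finset.sum_congr rfl fun n _ => ?_
      rw [ContinuousLinearMap.smulRight_apply, coords, ← Complex.coe_algebraMap, algebraMap_smul]
    rw [h3, h1]
    refine h2.trans ?_
    rw [norm_pow, norm_norm]
    gcongr
    · exact le_abs_self C
    · exact norm_coords_le i _
  refine hO.trans_isLittleO ?_
  have := Asymptotics.isLittleO_pow_sub_sub w one_lt_two
  exact this

section Generic

variable {X : Type*} [NormedAddCommGroup X] [NormedSpace ℝ X] {m : ℕ}

theorem sum_coord_last_smulRight (x : Fin 3 → X) :
    (∑ n : Fin 3, (coord n (Fin.last m)).smulRight (x n) : Params m →L[ℝ] X) = 0 := by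
  simp

theorem hasFDerivAt_of_eq_const {φ : Params m → X} {x₀ : X} (h : ∀ w, φ w = x₀) (x : Fin 3 → X)
    (w : Params m) :
    HasFDerivAt φ (∑ n : Fin 3, (coord n (Fin.last m)).smulRight (x n)) w := by
  rw [sum_coord_last_smulRight, show φ = fun _ => x₀ from funext h]
  exact hasFDerivAt_const _ _

theorem hasFDerivAt_of_eq_const_neg {φ : Params m → X} {x₀ : X} (h : ∀ w, φ w = x₀)
    (x : Fin 3 → X) (w : Params m) :
    HasFDerivAt φ (-∑ n : Fin 3, (coord n (Fin.last m)).smulRight (x n)) w := by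
  rw [sum_coord_last_smulRight, neg_zero, show φ = fun _ => x₀ from funext h]
  exact hasFDerivAt_const _ _

/-- `Y` is prescribed only on the first `m` indices: the coordinates of the last index vanish, so
its term drops out. -/
theorem hasFDerivAt_const_add_sum_comp_coords [NormedSpace ℂ X] [IsScalarTower ℝ ℂ X]
    {T : Fin m → (Fin 3 → ℝ) → X} {y : Fin m → Fin 3 → (Fin 3 → ℝ) → X} {δ : ℝ}
    (hT : ∀ k, ∃ C : ℝ, ∀ ξ h : Fin 3 → ℝ, ‖ξ‖ ≤ δ → ‖ξ + h‖ ≤ δ →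
      ‖T k (ξ + h) - T k ξ - ∑ n : Fin 3, (h n : ℂ) • y k n ξ‖ ≤ C * ‖h‖ ^ 2)
    (x₀ : X) {w₀ w : Params m} (hw : w ∈ Metric.ball w₀ δ) {Y : Fin 3 → Fin (m + 1) → X}
    (hY : ∀ n k, Y n k.castSucc = y k n (coords k.castSucc (w - w₀))) :
    HasFDerivAt (fun w => x₀ + ∑ k, T k (coords k.castSucc (w - w₀)))
      (∑ n : Fin 3, ∑ k, (coord n k).smulRight (Y n k)) w := by
  have h1 := (HasFDerivAt.fun_sum (u := Finset.univ) fun k _ =>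
    hasFDerivAt_comp_coords (hT k) k.castSucc hw).const_add x₀
  refine h1.congr_fderiv ?_
  rw [Finset.sum_comm]
  refine Finset.sum_congr rfl fun n _ => ?_
  rw [Fin.sum_univ_castSucc, coord_last, ContinuousLinearMap.zero_smulRight, add_zero]
  simp only [hY]

theorem hasFDerivAt_comp_neg_coords {E : Type*} [NormedAddCommGroup E] [NormedSpace ℂ E]
    [NormedSpace ℂ X] [IsScalarTower ℝ ℂ X] (B : E →L[ℂ] X) {Ψ : (Fin 3 → ℝ) → E}
    {y : Fin 3 → (Fin 3 → ℝ) → E} {δ : ℝ}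
    (hΨ : ∃ C : ℝ, ∀ ξ h : Fin 3 → ℝ, ‖ξ‖ ≤ δ → ‖ξ + h‖ ≤ δ →
      ‖Ψ (ξ + h) - Ψ ξ - ∑ n : Fin 3, (h n : ℂ) • y n ξ‖ ≤ C * ‖h‖ ^ 2)
    (i : Fin (m + 1)) {w₀ w : Params m} (hw : w ∈ Metric.ball w₀ δ) :
    HasFDerivAt (fun w => B (Ψ (-coords i (w - w₀))))
      (-∑ n : Fin 3, (coord n i).smulRight (B (y n (-coords i (w - w₀))))) w := by
  obtain ⟨C, hC⟩ := hΨ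
  have h1 : ∃ C : ℝ, ∀ ξ h : Fin 3 → ℝ, ‖ξ‖ ≤ δ → ‖ξ + h‖ ≤ δ →
      ‖B (Ψ (-(ξ + h))) - B (Ψ (-ξ)) - ∑ n : Fin 3, (h n : ℂ) • -B (y n (-ξ))‖ ≤
        C * ‖h‖ ^ 2 := by
    refine ⟨‖B‖ * C, fun ξ h hξ hξh => ?_⟩
    have h2 := hC (-ξ) (-h) (by rwa [norm_neg]) (by rwa [← neg_add, norm_neg])
    rw [← neg_add, norm_neg] at h2
    rw [mul_assoc]
    refine le_trans (le_of_eq ?_) ((B.le_opNorm _).trans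
      (mul_le_mul_of_nonneg_left h2 (norm_nonneg _)))
    simp [-Complex.coe_smul]
  refine (hasFDerivAt_comp_coords (Φ := fun ξ => B (Ψ (-ξ)))
    (y := fun n ξ => -B (y n (-ξ))) h1 i hw).congr_fderiv ?_
  rw [← Finset.sum_neg_distrib]
  refine Finset.sum_congr rfl fun n _ => ContinuousLinearMap.ext fun d => ?_
  simp

end Generic

/-! ### Integral operators and the local cubic flow. -/

section IntegralOperator

variable {Ω : SpectralSet} {K K' : ℂ → ℂ → ℂ} {H H' : Ω.L2 →L[ℂ] Ω.L2}

theorem isIntegralOperator_add (h : Ω.IsIntegralOperator K H) (h' : Ω.IsIntegralOperator K' H') :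
    Ω.IsIntegralOperator (fun u v => K u v + K' u v) (H + H') := by
  obtain ⟨D, hD⟩ := Ω.exists_norm_density_le
  intro φ
  filter_upwards [h φ, h' φ, Lp.coeFn_add (H φ) (H' φ)] with u h1 h2 h3
  refine ⟨fun ε hε => ?_, ?_⟩
  · simp only [add_mul]
    exact (h1.1 ε hε).add (h2.1 ε hε)
  · rw [add_apply, h3, Pi.add_apply]
    refine (h1.2.add h2.2).congr' ?_
    filter_upwards [self_mem_nhdsWithin] with ε hε
    rw [SpectralSet.integralOn, SpectralSet.integralOn, SpectralSet.integralOn, ← integral_add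
      ((h1.1 ε hε).mul_bdd (c := D) Ω.measurable_density.aestronglyMeasurable
        (Eventually.of_forall hD))
      ((h2.1 ε hε).mul_bdd (c := D) Ω.measurable_density.aestronglyMeasurable
        (Eventually.of_forall hD))]
    simp only [add_mul]

theorem isIntegralOperator_of_expWeight {δ C : ℝ} {F₀ G₀ : ℂ → ℂ} {k : ℂ → ℂ → ℂ}
    (hG : MemLp (fun z => (expWeight δ z : ℂ) * G₀ z) 2 Ω.absMeasure)
    (hk : ∀ u, Measurable (k u))
    (hC : ∀ u v, ‖k u v‖ ≤ C * (expWeight δ u * expWeight δ v)) (hk0 : ∀ u, k u u = 0)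
    (hT : ∀ φ : Ω.L2, H φ =ᵐ[Ω.absMeasure] fun u =>
      F₀ u * ∫ v, k u v * G₀ v * φ v * Ω.density v ∂Ω.absMeasure) :
    Ω.IsIntegralOperator (fun u v => F₀ u * k u v * G₀ v) H := by
  obtain ⟨D, hD⟩ := Ω.exists_norm_density_le
  intro φ
  have hC' : ∀ u v, ‖k u v‖ ≤ C * expWeight δ u * expWeight δ v := fun u v => by
    rw [mul_assoc]; exact hC u v
  filter_upwards [hT φ] with u hu
  refine ⟨fun ε hε => ?_, ?_⟩
  · refine (((integrable_mul_of_memLp_two (memLp_of_norm_le_expWeight hG (hk u) (hC' u))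
      (Lp.memLp φ)).const_mul (F₀ u)).integrableOn).congr (Eventually.of_forall fun v => ?_)
    ring
  · rw [hu]
    refine ((tendsto_setIntegral_norm_sub_gt (u := u) (integrable_kernel_mul
      Ω.measurable_density.aestronglyMeasurable hD hG (hk u) (hC' u) φ)
      (by simp [hk0])).const_mul (F₀ u)).congr fun ε => ?_
    rw [SpectralSet.integralOn, ← integral_const_mul]
    congr 1
    ext v
    ring

end IntegralOperator

section Local

variable {m : ℕ} {Ω : SpectralSet} {F G : ℂ → Fin (m + 1) → ℂ}

/-- A shift by `w'` multiplies `f_k(u) g_k(v)` by `exp (φ_k(u) - φ_k(v))`; subtracting the old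
kernel leaves `expQuot`. The last component has zero phase. A singular kernel thus changes by a
nonsingular one. -/
theorem integrableKernel_add (F G : ℂ → Fin (m + 1) → ℂ) (c : ℂ → ℂ) (w w' : Params m) :
    integrableKernel (fVec F c (w + w')) (gVec G c (w + w')) = fun u v =>
      integrableKernel (fVec F c w) (gVec G c w) u v +
        ∑ k : Fin m, fVec F c w u k.castSucc * expQuot (coords k.castSucc w') u v *
          gVec G c w v k.castSucc := by
  ext u v
  rw [integrableKernel, integrableKernel]
  split_ifs with huv
  · simp [huv, expQuot]
  · simp only [dotProduct, fVec_add, gVec_add, Fin.sum_univ_castSucc, coords_last, neg_zero,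
      phase_zero, Complex.exp_zero, one_mul, add_div, Finset.sum_div]
    rw [add_right_comm, ← Finset.sum_add_distrib]
    congr 1
    refine Finset.sum_congr rfl fun k _ => ?_
    rw [expQuot, sub_eq_add_neg (phase _ u), ← phase_neg, Complex.exp_add]
    ring

theorem IsCubicIntegrable.fVec_mul_gVec {c : ℂ → ℂ} {w₀ : Params m} {H : Ω.L2 →L[ℂ] Ω.L2}
    (h : IsCubicIntegrable Ω F G c w₀ H) (c' : ℂ → ℂ) (w : Params m) {u : ℂ} (hu : u ∈ Ω.carrier)
    (i : Fin (m + 1)) : fVec F c' w u i * gVec G c' w u i = 0 := by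
  have h1 : F u i * G u i = 0 := by
    have := h.orthogonal u hu i
    simpa [Matrix.mulVec, dotProduct, Matrix.single_apply, ite_and] using this
  rw [fVec_apply, gVec_apply]
  linear_combination (c' u * Complex.exp (phase (coords i w) u) * (c' u)⁻¹ *
    Complex.exp (phase (coords i (-w)) u)) * h1

/-- Near `w₀`, with the scalar `c` frozen at `w₀`, cubic integrable operators are a cubic flow. -/
theorem exists_isCubicFlow {c : Params m → ℂ → ℂ} {H : Params m → (Ω.L2 →L[ℂ] Ω.L2)}
    {U : Set (Params m)} (hU : IsOpen U)
    (hH : ∀ w ∈ U, IsCubicIntegrable Ω F G (c w) w (H w))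
    (hc : ∀ w ∈ U, TameScalarAt Ω F G c w)
    (hinv : ∀ w ∈ U, IsUnit (1 - H w)) {w₀ : Params m} (hw₀ : w₀ ∈ U) :
    ∃ W : Set (Params m), ∃ f : ℕ → Fin (m + 1) → Params m → Ω.L2,
      ∃ g : ℕ → Fin (m + 1) → Params m → (Ω.L2 →L[ℂ] ℂ), ∃ A : Params m → (Ω.L2 →L[ℂ] Ω.L2),
        w₀ ∈ W ∧ IsCubicFlow W f g A ∧
        ∀ w ∈ W, ∀ i j, Y1 Ω F G (c w) w (H w) i j = moment f g A 0 0 i j w := by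
  obtain ⟨D, hD⟩ := Ω.exists_norm_density_le
  obtain ⟨B, hB⟩ := exists_pairing Ω.measurable_density.aestronglyMeasurable hD
  obtain ⟨δ₀, hδ₀, hball⟩ := Metric.eventually_nhds_iff_ball.1 ((hc w₀ hw₀).and
    (hU.mem_nhds hw₀))
  have h0 := hH w₀ hw₀
  set f₀ : Fin (m + 1) → ℂ → ℂ := fun i u => fVec F (c w₀) w₀ u i with hf₀
  set g₀ : Fin (m + 1) → ℂ → ℂ := fun i u => gVec G (c w₀) w₀ u i with hg₀
  -- Corners of size `δ` stay in the ball of radius `δ₀`, where square integrability is known; `δ' <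
  -- δ` leaves room for the powers of `z`.
  set δ : ℝ := δ₀ / 2 with hδ
  set δ' : ℝ := δ₀ / 4 with hδ'
  have hδδ : δ' < δ := by rw [hδ, hδ']; linarith
  have hδ'0 : 0 < δ' := by positivity
  have hδ0 : 0 < δ := by positivity
  have hcorner : ∀ σ : Fin 3 → ℤˣ, w₀ + corner m δ σ ∈ Metric.ball w₀ δ₀ := fun σ => by
    rw [mem_ball_iff_norm, add_sub_cancel_left]
    exact (norm_corner_le hδ0.le σ).trans_lt (by rw [hδ]; linarith)
  have hF : ∀ k : Fin m, MemLp (fun z => (expWeight δ z : ℂ) * f₀ k.castSucc z) 2 Ω.absMeasure :=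
    fun k => memLp_expWeight_mul (h0.f_memLp_two _).1 fun σ => by
      have := (hball _ (hcorner σ)).1.1 k.castSucc
      simpa only [fVec_add, coords_corner] using this
  have hG : ∀ k : Fin m, MemLp (fun z => (expWeight δ z : ℂ) * g₀ k.castSucc z) 2 Ω.absMeasure :=
    fun k => memLp_expWeight_mul (h0.g_memLp_two _).1 fun σ => by
      -- The opposite corner is taken because `g` carries the inverse exponentials.
      have := (hball _ (hcorner (-σ))).1.2.1 k.castSucc
      simp only [gVec_add, coords_corner] at this
      have h1 : (-fun n => δ * (((-σ) n : ℤ) : ℝ)) = fun n => δ * ((σ n : ℤ) : ℝ) := by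
        ext n
        simp
      rwa [h1] at this
  have hFG : ∀ k : Fin m, ∀ᵐ u ∂Ω.absMeasure, f₀ k.castSucc u * g₀ k.castSucc u = 0 := fun k => by
    filter_upwards [Ω.ae_mem_carrier] with u hu
    exact h0.fVec_mul_gVec _ _ hu _
  choose T hT hTC using fun k : Fin m => exists_expQuotOperator
    Ω.measurable_density.aestronglyMeasurable hD hB (hF k) (hG k) (hFG k) hδδ
  set ξ : Fin m → Params m → (Fin 3 → ℝ) := fun k w => coords k.castSucc (w - w₀) with hξ
  have hξn : ∀ k, ∀ w ∈ Metric.ball w₀ δ', ‖ξ k w‖ ≤ δ' := fun k w hw => by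
    rw [mem_ball_iff_norm] at hw
    exact (norm_coords_le _ _).trans hw.le
  -- `A w` is the operator with `c` frozen at `w₀`. Its dependence on `w` sits in the `T k`, so no
  -- regularity of `w ↦ H w` is needed.
  set A : Params m → (Ω.L2 →L[ℂ] Ω.L2) := fun w => H w₀ + ∑ k, T k (ξ k w) with hA
  -- For the last index and `a > 0` the value `0` is harmless: that index has zero coordinates, and
  -- `commute` involves it only with power zero.
  set f : ℕ → Fin (m + 1) → Params m → Ω.L2 := fun a i w =>
    Fin.lastCases (if a = 0 then Ω.toL2 (f₀ (Fin.last m)) else 0)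
      (fun k => expFamily Ω.absMeasure (f₀ k.castSucc) a (ξ k w)) i with hf
  set g' : ℕ → Fin (m + 1) → Params m → Ω.L2 := fun a i w =>
    Fin.lastCases (if a = 0 then Ω.toL2 (g₀ (Fin.last m)) else 0)
      (fun k => expFamily Ω.absMeasure (g₀ k.castSucc) a (-ξ k w)) i with hg'
  have hf0 : ∀ i w, f 0 i w = Ω.toL2 fun u => fVec F (c w₀) w u i := fun i w => by
    have h1 : ∀ u, fVec F (c w₀) w u i =
        Complex.exp (phase (coords i (w - w₀)) u) * fVec F (c w₀) w₀ u i := fun u => by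
      rw [← fVec_add, add_sub_cancel]
    simp only [h1]
    induction i using Fin.lastCases with
    | last => simp [hf, hf₀]
    | cast k => simp [hf, hf₀, hξ, expFamily, SpectralSet.toL2_eq_toLpTwo]
  have hg0 : ∀ i w, g' 0 i w = Ω.toL2 fun u => gVec G (c w₀) w u i := fun i w => by
    have h1 : ∀ u, gVec G (c w₀) w u i =
        Complex.exp (phase (-coords i (w - w₀)) u) * gVec G (c w₀) w₀ u i := fun u => by
      rw [← gVec_add, add_sub_cancel]
    simp only [h1]
    induction i using Fin.lastCases with
    | last => simp [hg', hg₀]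
    | cast k => simp [hg', hg₀, hξ, expFamily, SpectralSet.toL2_eq_toLpTwo]
  have hfc : ∀ a (k : Fin m) w, f a k.castSucc w =
      expFamily Ω.absMeasure (f₀ k.castSucc) a (ξ k w) := fun a k w => by simp [hf]
  have hgc : ∀ a (k : Fin m) w, g' a k.castSucc w =
      expFamily Ω.absMeasure (g₀ k.castSucc) a (-ξ k w) := fun a k w => by simp [hg']
  have hdA : ∀ w ∈ Metric.ball w₀ δ', HasFDerivAt A (∑ n : Fin 3, ∑ k, (coord n k).smulRight
      (∑ x ∈ Finset.HasAntidiagonal.antidiagonal (n : ℕ),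
        (B (g' x.2 k w)).smulRight (f x.1 k w))) w := by
    intro w hw
    exact hasFDerivAt_const_add_sum_comp_coords hTC (H w₀) hw fun n k => by simp only [hfc, hgc, hξ]
  have hAint : ∀ w ∈ Metric.ball w₀ δ',
      Ω.IsIntegralOperator (integrableKernel (fVec F (c w₀) w) (gVec G (c w₀) w)) (A w) := by
    intro w hw
    obtain ⟨C, -, hC⟩ := exists_norm_expQuot_le hδδ
    have hs : ∀ s : Finset (Fin m), Ω.IsIntegralOperator (fun u v =>
        integrableKernel (fVec F (c w₀) w₀) (gVec G (c w₀) w₀) u v +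
        ∑ k ∈ s, fVec F (c w₀) w₀ u k.castSucc * expQuot (coords k.castSucc (w - w₀)) u v *
          gVec G (c w₀) w₀ v k.castSucc) (H w₀ + ∑ k ∈ s, T k (ξ k w)) := by
      intro s
      induction s using Finset.induction_on with
      | empty => simpa using h0.kernel
      | insert k s hk ih =>
        have h1 := isIntegralOperator_add ih (isIntegralOperator_of_expWeight (hG k)
          (fun u => (measurable_expQuot (ξ k w)).comp measurable_prodMk_left)
          (hC _ (hξn k w hw)) (fun u => by simp [expQuot]) (hT k (ξ k w) (hξn k w hw)))
        convert h1 using 1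
        · ext u v
          rw [Finset.sum_insert hk]
          simp only [Function.comp_apply, Function.uncurry_apply_pair, hf₀, hg₀, hξ]
          ring
        · rw [Finset.sum_insert hk]
          abel
    have h2 := hs Finset.univ
    rwa [← integrableKernel_add, add_sub_cancel] at h2
  have hA0 : A w₀ = H w₀ := by
    have h1 : ∀ k, T k (ξ k w₀) = 0 := fun k => by
      refine ContinuousLinearMap.ext fun φ => Lp.ext ?_
      filter_upwards [hT k _ (hξn k w₀ (Metric.mem_ball_self hδ'0)) φ, Lp.coeFn_zero ℂ 2 Ω.absMeasure]
        with u h1 h2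
      rw [h1, zero_apply, h2]
      simp [hξ, expQuot]
    simp only [hA, h1, Finset.sum_const_zero, add_zero]
  have hAcont : ContinuousOn (fun w => 1 - A w) (Metric.ball w₀ δ') := fun w hw =>
    (continuousAt_const.sub (hdA w hw).continuousAt).continuousWithinAt
  have hmemf : ∀ w ∈ Metric.ball w₀ δ', ∀ i,
      MemLp (fun u => fVec F (c w₀) w u i) 2 Ω.absMeasure := fun w hw =>
    (hball w (Metric.ball_subset_ball (by rw [hδ']; linarith) hw)).1.1
  have hmemg : ∀ w ∈ Metric.ball w₀ δ', ∀ i,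
      MemLp (fun u => gVec G (c w₀) w u i) 2 Ω.absMeasure := fun w hw =>
    (hball w (Metric.ball_subset_ball (by rw [hδ']; linarith) hw)).1.2.1
  -- Invertibility of `1 - A w` is built into `W`. It holds at `w₀`, where `A w₀ = H w₀`, and is an
  -- open condition; conjugation by a possibly unbounded `ρ` would not transfer it from `1 - H w`.
  refine ⟨Metric.ball w₀ δ' ∩ (fun w => 1 - A w) ⁻¹' {x | IsUnit x}, f,
    fun b j w => B (g' b j w), A, ⟨Metric.mem_ball_self hδ'0, ?_⟩, ?_, ?_⟩
  · show IsUnit (1 - A w₀)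
    rw [hA0]
    exact hinv w₀ hw₀
  · refine ⟨hAcont.isOpen_inter_preimage Metric.isOpen_ball Units.isOpen, fun w hw => hw.2, ?_, ?_,
      fun w hw => hdA w hw.1, ?_⟩
    · intro a i w hw
      induction i using Fin.lastCases with
      | last =>
        exact hasFDerivAt_of_eq_const (x₀ := if a = 0 then Ω.toL2 (f₀ (Fin.last m)) else 0)
          (fun w => by simp only [hf, Fin.lastCases_last]) _ w
      | cast k =>
        have h1 := hasFDerivAt_comp_coords
          (exists_norm_expFamily_remainder_le (hF k) hδδ a) k.castSucc hw.1
        simp only [hfc]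
        exact h1.congr_of_eventuallyEq (Eventually.of_forall fun w => hfc a k w)
    · intro b j w hw
      induction j using Fin.lastCases with
      | last =>
        exact hasFDerivAt_of_eq_const_neg
          (x₀ := B (if b = 0 then Ω.toL2 (g₀ (Fin.last m)) else 0))
          (fun w => by simp only [hg', Fin.lastCases_last]) _ w
      | cast k =>
        have h1 := hasFDerivAt_comp_neg_coords B
          (exists_norm_expFamily_remainder_le (hG k) hδδ b) k.castSucc hw.1
        simp only [hgc]
        exact h1.congr_of_eventuallyEq (Eventually.of_forall fun w => rfl)
    · intro w hw a b i j
      have hmul : ∀ (F₀ : ℂ → ℂ) (_ : MemLp (fun z => (expWeight δ z : ℂ) * F₀ z) 2 Ω.absMeasure)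
          (a : ℕ) (η : Fin 3 → ℝ), ‖η‖ ≤ δ' → expFamily Ω.absMeasure F₀ (a + 1) η
            =ᵐ[Ω.absMeasure] fun u => u * expFamily Ω.absMeasure F₀ a η u := by
        intro F₀ h a η hη
        filter_upwards [coeFn_expFamily h hδδ (a + 1) hη, coeFn_expFamily h hδδ a hη] with u h1 h2
        rw [h1, h2]
        ring
      have hfg : ∀ᵐ u ∂Ω.absMeasure, fVec F (c w₀) w u ⬝ᵥ gVec G (c w₀) w u = 0 := by
        filter_upwards [Ω.ae_mem_carrier] with u hu
        exact Finset.sum_eq_zero fun i _ => h0.fVec_mul_gVec _ _ hu i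
      simp only [hf0, hg0, hfc, hgc]
      exact moment_commute (hmemf w hw.1) (hmemg w hw.1) hfg (hAint w hw.1) hB hw.2
        (hmul _ (hF i) a _ (hξn i w hw.1))
        (hmul _ (hG j) b _ (by rw [norm_neg]; exact hξn j w hw.1))
  · intro w hw i j
    have hwb := hball w (Metric.ball_subset_ball (by rw [hδ']; linarith) hw.1)
    have h1 := hH w hwb.2
    -- The frozen scalar is exchanged for the actual one here.
    have hgauge := moment_gauge_invariant (ρ := fun u => c w u / c w₀ u) (hmemf w hw.1)
      (hmemg w hw.1) h1.f_memLp_two h1.g_memLp_two (hAint w hw.1) h1.kernel hB hw.2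
      (hinv w hwb.2) (h1.scalar_measurable.div₀ h0.scalar_measurable) ?_ ?_ ?_ i j
    · rw [moment, hf0, hg0, ← hgauge, hB]
      simp only [Y1, Matrix.of_apply, SpectralSet.integralOn, Measure.restrict_univ]
      refine integral_congr_ae ?_
      filter_upwards [coeFn_toLpTwo (h1.g_memLp_two j)] with u hu
      rw [SpectralSet.toL2_eq_toLpTwo Ω fun u => gVec G (c w) w u j, hu]
    · intro R
      obtain ⟨C, hC⟩ := hwb.1.2.2 R
      refine ⟨C, ?_⟩
      filter_upwards [Ω.ae_mem_carrier] with u hu hR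
      rw [norm_div, div_le_iff₀ (norm_pos_iff.2 (h0.scalar_ne_zero u hu))]
      exact hC u hu hR
    · filter_upwards [Ω.ae_mem_carrier] with u hu l
      have := h0.scalar_ne_zero u hu
      rw [fVec_apply, fVec_apply]
      field_simp
    · filter_upwards [Ω.ae_mem_carrier] with u hu l
      have := h0.scalar_ne_zero u hu
      have := h1.scalar_ne_zero u hu
      rw [gVec_apply, gVec_apply]
      field_simp

end Local

/-! ### Passage to the blocks `p` and `r`. -/

theorem pBlock_apply {m : ℕ} (S : Finset (Fin m)) (Y : Matrix (Fin (m + 1)) (Fin (m + 1)) ℂ)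
    (i : Fin S.card) (j : Fin (m + 1 - S.card)) :
    pBlock S Y i j = Y (perm S (Sum.inl i)) (perm S (Sum.inr j)) := by
  simp [pBlock, permMatrix, Matrix.toBlocks₁₂, Matrix.mul_apply]

theorem rBlock_apply {m : ℕ} (S : Finset (Fin m)) (Y : Matrix (Fin (m + 1)) (Fin (m + 1)) ℂ)
    (i : Fin (m + 1 - S.card)) (j : Fin S.card) :
    rBlock S Y i j = Y (perm S (Sum.inr i)) (perm S (Sum.inl j)) := by
  simp [rBlock, permMatrix, Matrix.toBlocks₂₁, Matrix.mul_apply]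

section EventuallyEq

variable {m : ℕ} {a b : Type} {S : Finset (Fin m)} {A B : Params m → Matrix a b ℂ} {w : Params m}

theorem sum_lineDeriv_congr (h : A =ᶠ[𝓝 w] B) (v : Fin m → Params m) (i : a) (j : b) :
    ∑ k ∈ S, lineDeriv ℝ (fun w' => A w' i j) w (v k) =
      ∑ k ∈ S, lineDeriv ℝ (fun w' => B w' i j) w (v k) :=
  Finset.sum_congr rfl fun _ _ => Filter.EventuallyEq.lineDeriv_eq
    (h.mono fun w' hw => by simp only [hw])

theorem Dx_congr (h : A =ᶠ[𝓝 w] B) : Dx S A w = Dx S B w :=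
  Matrix.ext fun i j => sum_lineDeriv_congr h _ i j

theorem Dy_congr (h : A =ᶠ[𝓝 w] B) : Dy S A w = Dy S B w :=
  Matrix.ext fun i j => sum_lineDeriv_congr h _ i j

theorem Dt_congr (h : A =ᶠ[𝓝 w] B) : Dt S A w = Dt S B w :=
  Matrix.ext fun i j => sum_lineDeriv_congr h _ i j

theorem eventuallyEq_Dx (h : A =ᶠ[𝓝 w] B) : Dx S A =ᶠ[𝓝 w] Dx S B :=
  h.eventuallyEq_nhds.mono fun _ => Dx_congr

end EventuallyEq

end CubicIntegrable

theorem mainTheorem1 (m : ℕ) (Ω : SpectralSet)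
    (F G : ℂ → Fin (m + 1) → ℂ)
    (c : CubicIntegrable.Params m → ℂ → ℂ)
    (H : CubicIntegrable.Params m → (Ω.L2 →L[ℂ] Ω.L2))
    (U : Set (CubicIntegrable.Params m)) (hU : IsOpen U)
    (hH : ∀ w ∈ U, CubicIntegrable.IsCubicIntegrable Ω F G (c w) w (H w))
    (hc : ∀ w ∈ U, CubicIntegrable.TameScalarAt Ω F G c w)
    (hinv : ∀ w ∈ U, IsUnit (1 - H w))
    (S : Finset (Fin m)) (hS : S.Nonempty)
    (p : CubicIntegrable.Params m → Matrix (Fin S.card) (Fin (m + 1 - S.card)) ℂ)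
    (hp : p = fun w => CubicIntegrable.pBlock S (CubicIntegrable.Y1 Ω F G (c w) w (H w)))
    (r : CubicIntegrable.Params m → Matrix (Fin (m + 1 - S.card)) (Fin S.card) ℂ)
    (hr : r = fun w => CubicIntegrable.rBlock S (CubicIntegrable.Y1 Ω F G (c w) w (H w))) :
    (∀ i j, ContDiffOn ℝ 3 (fun w => p w i j) U) ∧
    (∀ i j, ContDiffOn ℝ 3 (fun w => r w i j) U) ∧
    (∀ w ∈ U,
      CubicIntegrable.Dy S p w =
        CubicIntegrable.Dx S (CubicIntegrable.Dx S p) w + (2 : ℂ) • (p w * r w * p w)) ∧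
    (∀ w ∈ U,
      CubicIntegrable.Dy S r w =
        -CubicIntegrable.Dx S (CubicIntegrable.Dx S r) w - (2 : ℂ) • (r w * p w * r w)) ∧
    (∀ w ∈ U,
      CubicIntegrable.Dt S p w =
        CubicIntegrable.Dx S (CubicIntegrable.Dx S (CubicIntegrable.Dx S p)) w
          + (3 : ℂ) • (CubicIntegrable.Dx S p w * r w * p w)
          + (3 : ℂ) • (p w * r w * CubicIntegrable.Dx S p w)) ∧
    (∀ w ∈ U,
      CubicIntegrable.Dt S r w =
        CubicIntegrable.Dx S (CubicIntegrable.Dx S (CubicIntegrable.Dx S r)) w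
          + (3 : ℂ) • (CubicIntegrable.Dx S r w * p w * r w)
          + (3 : ℂ) • (r w * p w * CubicIntegrable.Dx S r w)) := by
  -- All claims are local, so near each point `p` and `r` may be replaced by moment blocks of a flow
  -- that depends on the point.
  have key : ∀ w₀ ∈ U, ∃ W : Set (CubicIntegrable.Params m),
      ∃ f : ℕ → Fin (m + 1) → CubicIntegrable.Params m → Ω.L2,
      ∃ g : ℕ → Fin (m + 1) → CubicIntegrable.Params m → (Ω.L2 →L[ℂ] ℂ),
      ∃ A : CubicIntegrable.Params m → (Ω.L2 →L[ℂ] Ω.L2),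
        w₀ ∈ W ∧ CubicIntegrable.IsCubicFlow W f g A ∧
        p =ᶠ[𝓝 w₀] CubicIntegrable.momentBlock f g A
          (CubicIntegrable.perm S ∘ Sum.inl) (CubicIntegrable.perm S ∘ Sum.inr) 0 0 ∧
        r =ᶠ[𝓝 w₀] CubicIntegrable.momentBlock f g A
          (CubicIntegrable.perm S ∘ Sum.inr) (CubicIntegrable.perm S ∘ Sum.inl) 0 0 := by
    intro w₀ hw₀
    obtain ⟨W, f, g, A, hW, hflow, hY⟩ :=
      CubicIntegrable.exists_isCubicFlow hU hH hc hinv hw₀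
    refine ⟨W, f, g, A, hW, hflow, ?_, ?_⟩
    · filter_upwards [hflow.isOpen.mem_nhds hW] with w hw
      ext i j
      simp only [hp, CubicIntegrable.pBlock_apply, hY w hw]
      rfl
    · filter_upwards [hflow.isOpen.mem_nhds hW] with w hw
      ext i j
      simp only [hr, CubicIntegrable.rBlock_apply, hY w hw]
      rfl
  refine ⟨fun i j w hw => ?_, fun i j w hw => ?_, fun w hw => ?_, fun w hw => ?_,
    fun w hw => ?_, fun w hw => ?_⟩ <;>
  obtain ⟨W, f, g, A, hW, hflow, hpe, hre⟩ := key w hw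
  · exact (((hflow.contDiffOn_moment 3 0 0 _ _).contDiffAt
      (hflow.isOpen.mem_nhds hW)).congr_of_eventuallyEq
      (hpe.mono fun w' h => congrFun (congrFun h i) j)).contDiffWithinAt
  · exact (((hflow.contDiffOn_moment 3 0 0 _ _).contDiffAt
      (hflow.isOpen.mem_nhds hW)).congr_of_eventuallyEq
      (hre.mono fun w' h => congrFun (congrFun h i) j)).contDiffWithinAt
  all_goals
    have hx := CubicIntegrable.eventuallyEq_Dx (S := S) hpe
    have hy := CubicIntegrable.eventuallyEq_Dx (S := S) hre
    have heq := hflow.flow_equations S rfl rfl hW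
  · rw [CubicIntegrable.Dy_congr hpe, CubicIntegrable.Dx_congr hx, hpe.eq_of_nhds, hre.eq_of_nhds]
    exact heq.1
  · rw [CubicIntegrable.Dy_congr hre, CubicIntegrable.Dx_congr hy, hpe.eq_of_nhds, hre.eq_of_nhds]
    exact heq.2.1
  · rw [CubicIntegrable.Dt_congr hpe,
      CubicIntegrable.Dx_congr (CubicIntegrable.eventuallyEq_Dx hx), hx.eq_of_nhds,
      hpe.eq_of_nhds, hre.eq_of_nhds]
    exact heq.2.2.1
  · rw [CubicIntegrable.Dt_congr hre,
      CubicIntegrable.Dx_congr (CubicIntegrable.eventuallyEq_Dx hy), hy.eq_of_nhds,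
      hpe.eq_of_nhds, hre.eq_of_nhds]
    exact heq.2.2.2
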